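/- Let $\alpha\in[-\tfrac12,0]$ and let $(P_n)_{n\ge0}$ be the Gegenbauer polynomials of index $\alpha$ normalised by $P_n(1)=1$, that is, $P_0=1$, $P_1(x)=x$ and $(2n+2\alpha+1)\,xP_n=n\,P_{n-1}+(n+2\alpha+1)\,P_{n+1}$ for $n\ge1$. Write $P_mP_n=\sum_k c(m,n,k)P_k$ and $\delta_m\star\delta_n=\sum_k c(m,n,k)\,\delta_k$. Let $\mu$ be a probability measure on $\mathbb N=\{0,1,2,\dots\}$ with $\sum_n n^2\mu(n)<\infty$ whose support is not contained in $2\mathbb N$; if $\alpha=-\tfrac12$, assume moreover that the support of $\mu$ is not contained in $d\,\mathbb N$ for any integer $d\ge2$. Let $(S_n)_{n\ge0}$ be, under $\mathbb P_x$, the Markov chain on $\mathbb N$ started at $x$ with transition probabilities $$p(u,v)=(\delta_u\star\mu)(v)=\sum_{n\ge0}\mu(n)\,c(u,n,v),$$ and let $N_n(y)=\sum_{k=0}^n\mathbf 1_{\{S_k=y\}}$. Put $$C=\frac1{4(\alpha+1)}\sum_{n\ge1}\mu(n)\,n(n+2\alpha+1),\qquad w_y=\frac{(2y+2\alpha+1)\,\Gamma(y+2\alpha+1)}{2^{2\alpha+1}\,\Gamma(y+1)\,\Gamma(\alpha+1)^2},$$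 where $w_0=1/\pi$ if $\alpha=-\tfrac12$. For $a\in(0,1)$, let $\mathcal M(a)$ be the Mittag-Leffler distribution: the probability law on $[0,\infty)$ with Laplace transform $s\mapsto\sum_{p\ge0}\frac{(-s)^p}{\Gamma(pa+1)}$, $s\ge0$. (i) If $\alpha\in[-\tfrac12,0)$, then for all $x,y\in\mathbb N$, under $\mathbb P_x$, as $n\to\infty$, $$\frac{N_n(y)}{n^{|\alpha|}}\ \xrightarrow{\ \mathcal L\ }\ \frac{w_y\,\Gamma(\alpha+1)\,\Gamma(|\alpha|)}{2\,C^{\alpha+1}}\,\mathcal M(|\alpha|).$$ (ii) If $\alpha=0$, then for all $x,y\in\mathbb N$, under $\mathbb P_x$, as $n\to\infty$, $$\frac{N_n(y)}{\log n}\ \xrightarrow{\ \mathcal L\ }\ \frac{2y+1}{4C}\,\mathcal E(1),$$ where $\mathcal E(1)$ is the exponential distribution with parameter $1$. -/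

import Mathlib

open MeasureTheory ProbabilityTheory Filter

open scoped Topology Polynomial

/-! ### Gegenbauer polynomials -/

/-- The Gegenbauer (ultraspherical) polynomials of index `α > -1`, normalised by
`P_n(1) = 1`, through their three-term recurrence
`(2n + 2α + 1) x P_n = n P_{n-1} + (n + 2α + 1) P_{n+1}` for `n ≥ 1`, `P_0 = 1`, `P_1 = x`.
They are the polynomials given by the Rodrigues formula: see `gegenbauer_rodrigues` below. -/
noncomputable def gegenbauer (α : ℝ) : ℕ → ℝ[X]
  | 0 => 1
  | 1 => Polynomial.X
  | n + 2 =>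
      Polynomial.C ((2 * (n + 1) + 2 * α + 1) / ((n + 1) + 2 * α + 1)) *
          (Polynomial.X * gegenbauer α (n + 1)) -
        Polynomial.C ((n + 1) / ((n + 1) + 2 * α + 1)) * gegenbauer α n

theorem gegenbauer_degree {α : ℝ} (hα : -1 < α) :
    ∀ n : ℕ, (gegenbauer α n).degree = n
  | 0 => by simp [gegenbauer]
  | 1 => by simp [gegenbauer]
  | n + 2 => by
      have h1 := gegenbauer_degree hα (n + 1)
      have h0 := gegenbauer_degree hα n
      have hn : (0 : ℝ) ≤ n := Nat.cast_nonneg n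
      have hc : (2 * ((n : ℝ) + 1) + 2 * α + 1) / ((n + 1) + 2 * α + 1) ≠ 0 :=
        div_ne_zero (by linarith) (by linarith)
      have hd : (Polynomial.C ((2 * ((n : ℝ) + 1) + 2 * α + 1) / ((n + 1) + 2 * α + 1)) *
          (Polynomial.X * gegenbauer α (n + 1))).degree = ((n + 2 : ℕ) : WithBot ℕ) := by
        rw [Polynomial.degree_mul, Polynomial.degree_C hc, Polynomial.degree_mul,
          Polynomial.degree_X, h1, zero_add]
        norm_cast
        omega
      rw [gegenbauer, Polynomial.degree_sub_eq_left_of_degree_lt, hd]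
      rw [hd]
      rw [Polynomial.C_mul']
      refine lt_of_le_of_lt (Polynomial.degree_smul_le _ _) ?_
      rw [h0]
      exact_mod_cast (by omega : n < n + 2)

/-- The Gegenbauer polynomials as a sequence of polynomials of degrees `0, 1, 2, …`. -/
noncomputable def gegenbauerSequence (α : ℝ) (hα : -1 < α) : Polynomial.Sequence ℝ where
  elems' := gegenbauer α
  degree_eq' := gegenbauer_degree hα

/-- The basis `(P_n)` of `ℝ[X]`. -/
noncomputable def gegenbauerBasis (α : ℝ) (hα : -1 < α) : Module.Basis ℕ ℝ ℝ[X] :=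
  (gegenbauerSequence α hα).basis fun i =>
    (Polynomial.leadingCoeff_ne_zero.mpr ((gegenbauerSequence α hα).ne_zero i)).isUnit

/-- The mass `(δ_m ⋆ δ_n)({k})`: the coefficient of `P_k` in the linearization
`P_m P_n = ∑_k c(m,n,k) P_k` of a product of two Gegenbauer polynomials. -/
noncomputable def gegenbauerConv (α : ℝ) (hα : -1 < α) (m n k : ℕ) : ℝ :=
  (gegenbauerBasis α hα).repr (gegenbauer α m * gegenbauer α n) k

theorem gegenbauer_linearization {α : ℝ} (hα : -1 < α) (m n : ℕ) :
    gegenbauer α m * gegenbauer α n =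
      ∑ᶠ k, gegenbauerConv α hα m n k • gegenbauer α k := by
  have h := (gegenbauerBasis α hα).linearCombination_repr (gegenbauer α m * gegenbauer α n)
  have hb : ∀ k, gegenbauerBasis α hα k = gegenbauer α k := fun k => by
    rw [gegenbauerBasis, Polynomial.Sequence.basis_eq_self]; rfl
  rw [Finsupp.linearCombination_apply, Finsupp.sum] at h
  rw [finsum_eq_sum_of_support_subset
    (s := ((gegenbauerBasis α hα).repr (gegenbauer α m * gegenbauer α n)).support)]
  · simpa only [hb, gegenbauerConv] using h.symm
  · intro k hk
    rw [Function.mem_support] at hk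
    rw [Finset.mem_coe, Finsupp.mem_support_iff]
    intro h0
    exact hk (by rw [gegenbauerConv, h0, zero_smul])

/-! ### The Rodrigues formula -/

theorem gegenbauer_rec {α : ℝ} (hα : -1 < α) (n : ℕ) (x : ℝ) :
    (n + 2 * α + 2) * (gegenbauer α (n + 2)).eval x =
      (2 * n + 2 * α + 3) * (x * (gegenbauer α (n + 1)).eval x)
        - (n + 1) * (gegenbauer α n).eval x := by
  have hn : (0 : ℝ) ≤ n := Nat.cast_nonneg n
  have h : (n : ℝ) + 1 + 2 * α + 1 ≠ 0 := by linarith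
  simp only [gegenbauer, Polynomial.eval_sub, Polynomial.eval_mul, Polynomial.eval_C,
    Polynomial.eval_X]
  field_simp
  ring

theorem gegenbauer_shift {b : ℝ} (hb : 0 < b) (x : ℝ) : ∀ n : ℕ,
    (2 * n + 2 * b + 1) * ((1 - x ^ 2) * (gegenbauer b n).eval x) =
      2 * b * ((gegenbauer (b - 1) n).eval x - (gegenbauer (b - 1) (n + 2)).eval x)
  | 0 => by
      have h0 := gegenbauer_rec (by linarith : -1 < b - 1) 0 x
      simp only [gegenbauer.eq_1, gegenbauer.eq_2, Polynomial.eval_one, Polynomial.eval_X,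
        zero_add] at h0 ⊢
      push_cast at h0 ⊢
      linear_combination h0
  | 1 => by
      have h0 := gegenbauer_rec (by linarith : -1 < b - 1) 0 x
      have h1 := gegenbauer_rec (by linarith : -1 < b - 1) 1 x
      simp only [gegenbauer.eq_1, gegenbauer.eq_2, Polynomial.eval_one, Polynomial.eval_X,
        zero_add, Nat.reduceAdd] at h0 h1 ⊢
      push_cast at h0 h1 ⊢
      have hb' : 2 * b + 1 ≠ 0 := by linarith
      apply mul_left_cancel₀ hb'
      linear_combination ((2 * b + 3) * x) * h0 + 2 * b * h1
  | n + 2 => by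
      have i0 := gegenbauer_shift hb x n
      have i1 := gegenbauer_shift hb x (n + 1)
      have hP := gegenbauer_rec (by linarith : -1 < b) n x
      have hR1 := gegenbauer_rec (by linarith : -1 < b - 1) n x
      have hR3 := gegenbauer_rec (by linarith : -1 < b - 1) (n + 2) x
      have hn : (0 : ℝ) ≤ n := Nat.cast_nonneg n
      have e1 : (2 * (n : ℝ) + 2 * b + 1) ≠ 0 := by linarith
      have e2 : ((n : ℝ) + 2 * b + 2) ≠ 0 := by linarith
      simp only [add_assoc, Nat.reduceAdd] at i0 i1 hP hR1 hR3 ⊢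
      push_cast at i0 i1 hP hR1 hR3 ⊢
      apply mul_left_cancel₀ (mul_ne_zero e1 e2)
      linear_combination
        (2 * (n : ℝ) + 2 * b + 1) * (2 * n + 2 * b + 5) * (1 - x ^ 2) * hP
          + (2 * (n : ℝ) + 2 * b + 1) * (2 * n + 2 * b + 5) * x * i1
          - (2 * (n : ℝ) + 2 * b + 5) * (n + 1) * i0
          - 2 * b * (2 * (n : ℝ) + 2 * b + 5) * hR1
          + 2 * b * (2 * (n : ℝ) + 2 * b + 1) * hR3

theorem gegenbauer_derivative {b : ℝ} (hb : 0 < b) (x : ℝ) : ∀ n : ℕ,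
    (1 - x ^ 2) * (gegenbauer b n).derivative.eval x =
      2 * b * (x * (gegenbauer b n).eval x - (gegenbauer (b - 1) (n + 1)).eval x)
  | 0 => by simp [gegenbauer]
  | 1 => by
      have h0 := gegenbauer_rec (by linarith : -1 < b - 1) 0 x
      simp only [gegenbauer.eq_1, gegenbauer.eq_2, Polynomial.eval_one, Polynomial.eval_X,
        Polynomial.derivative_X, zero_add, Nat.reduceAdd] at h0 ⊢
      push_cast at h0 ⊢
      linear_combination h0
  | n + 2 => by
      have i0 := gegenbauer_derivative hb x n
      have i1 := gegenbauer_derivative hb x (n + 1)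
      have hn : (0 : ℝ) ≤ n := Nat.cast_nonneg n
      have e : (n : ℝ) + 2 * b + 2 ≠ 0 := by linarith
      have hP := gegenbauer_rec (by linarith : -1 < b) n x
      have hQ := gegenbauer_rec (by linarith : -1 < b - 1) (n + 1) x
      have hA := gegenbauer_shift hb x (n + 1)
      have hD : (n + 2 * b + 2) * (gegenbauer b (n + 2)).derivative.eval x =
          (2 * n + 2 * b + 3) * ((gegenbauer b (n + 1)).eval x
            + x * (gegenbauer b (n + 1)).derivative.eval x)
          - (n + 1) * (gegenbauer b n).derivative.eval x := by
        have h : (n : ℝ) + 1 + 2 * b + 1 ≠ 0 := by linarith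
        rw [gegenbauer.eq_3]
        simp only [Polynomial.derivative_sub, Polynomial.derivative_mul, Polynomial.derivative_C,
          Polynomial.derivative_X, Polynomial.eval_sub, Polynomial.eval_mul, Polynomial.eval_add,
          Polynomial.eval_C, Polynomial.eval_X, Polynomial.eval_one, Polynomial.eval_zero]
        field_simp
        ring
      simp only [add_assoc, Nat.reduceAdd] at i0 i1 hP hQ hA hD ⊢
      push_cast at i0 i1 hP hQ hA hD ⊢
      apply mul_left_cancel₀ e
      linear_combination (1 - x ^ 2) * hD + (2 * (n : ℝ) + 2 * b + 3) * x * i1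
        - ((n : ℝ) + 1) * i0 - 2 * b * x * hP + hA + 2 * b * hQ

/-- Differentiating `(1 - x²)^b P_j^{(b)}` lowers the index by one. -/
theorem gegenbauer_hasDerivAt {b : ℝ} (hb : 0 < b) (j : ℕ) {x : ℝ}
    (hx : x ∈ Set.Ioo (-1 : ℝ) 1) :
    HasDerivAt (fun t : ℝ => (1 - t ^ 2) ^ b * (gegenbauer b j).eval t)
      (-2 * b * ((1 - x ^ 2) ^ (b - 1) * (gegenbauer (b - 1) (j + 1)).eval x)) x := by
  have hpos : 0 < 1 - x ^ 2 := by nlinarith [hx.1, hx.2]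
  have h1 : HasDerivAt (fun t : ℝ => 1 - t ^ 2) (-(2 * x)) x := by
    simpa using (hasDerivAt_pow 2 x).const_sub 1
  have h2 := (h1.rpow_const (p := b) (Or.inl hpos.ne')).mul
    ((gegenbauer b j).hasDerivAt x)
  refine h2.congr_deriv ?_
  have h3 : (1 - x ^ 2) ^ b = (1 - x ^ 2) ^ (b - 1) * (1 - x ^ 2) := by
    rw [Real.rpow_sub_one hpos.ne', div_mul_cancel₀ _ hpos.ne']
  rw [h3]
  linear_combination (1 - x ^ 2) ^ (b - 1) * gegenbauer_derivative hb x j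

theorem gegenbauer_iteratedDeriv {b : ℝ} : ∀ (j : ℕ), (j : ℝ) - 1 < b →
    ∀ x ∈ Set.Ioo (-1 : ℝ) 1,
    iteratedDeriv j (fun t : ℝ => (1 - t ^ 2) ^ b) x =
      (-2) ^ j * (∏ i ∈ Finset.range j, (b - i)) *
        ((1 - x ^ 2) ^ (b - j) * (gegenbauer (b - j) j).eval x)
  | 0, _, x, _ => by simp [gegenbauer]
  | j + 1, hj, x, hx => by
      push_cast at hj
      have ih := gegenbauer_iteratedDeriv (b := b) j (by linarith)
      rw [iteratedDeriv_succ]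
      have he : iteratedDeriv j (fun t : ℝ => (1 - t ^ 2) ^ b) =ᶠ[𝓝 x] fun t =>
          (-2) ^ j * (∏ i ∈ Finset.range j, (b - i)) *
            ((1 - t ^ 2) ^ (b - j) * (gegenbauer (b - j) j).eval t) := by
        filter_upwards [isOpen_Ioo.mem_nhds hx] with t ht using ih t ht
      rw [he.deriv_eq, ((gegenbauer_hasDerivAt (b := b - j) (by linarith) j hx).const_mul _).deriv,
        Finset.prod_range_succ, pow_succ]
      push_cast
      rw [← sub_sub]
      ring

/-- The Rodrigues formula. -/
theorem gegenbauer_rodrigues {α : ℝ} (hα : -1 < α) (n : ℕ) {x : ℝ}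
    (hx : x ∈ Set.Ioo (-1 : ℝ) 1) :
    (gegenbauer α n).eval x =
      (-1) ^ n / (2 ^ n * ∏ i ∈ Finset.range n, (α + (i + 1))) * (1 - x ^ 2) ^ (-α) *
        iteratedDeriv n (fun t : ℝ => (1 - t ^ 2) ^ (n + α)) x := by
  have hpos : 0 < 1 - x ^ 2 := by nlinarith [hx.1, hx.2]
  rw [gegenbauer_iteratedDeriv (b := n + α) n (by linarith) x hx, add_sub_cancel_left]
  have hp : ∏ i ∈ Finset.range n, ((n : ℝ) + α - i) = ∏ i ∈ Finset.range n, (α + (i + 1)) := by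
    rw [← Finset.prod_range_reflect]
    refine Finset.prod_congr rfl fun i hi => ?_
    have hi' : i + 1 ≤ n := Finset.mem_range.mp hi
    rw [Nat.sub_sub, Nat.cast_sub (by omega)]
    push_cast
    ring
  have hne : ∏ i ∈ Finset.range n, (α + ((i : ℝ) + 1)) ≠ 0 :=
    Finset.prod_ne_zero_iff.mpr fun i _ => by
      have : (0 : ℝ) ≤ i := Nat.cast_nonneg i
      linarith
  rw [hp, Real.rpow_neg hpos.le, show (-2 : ℝ) = -1 * 2 by norm_num, mul_pow]
  have hr : (1 - x ^ 2) ^ α ≠ 0 := (Real.rpow_pos_of_pos hpos α).ne'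
  have h1 : ((-1 : ℝ) ^ n) * (-1) ^ n = 1 := by rw [← mul_pow]; norm_num
  field_simp
  linear_combination (-(gegenbauer α n).eval x) * h1

/-! ### The random walk and its local time -/

/-- The transition probabilities `p(x,y) = (δ_x ⋆ μ)({y}) = ∑_n μ(n) (δ_x ⋆ δ_n)({y})`. -/
noncomputable def gegenbauerTransition (α : ℝ) (hα : -1 < α) (μ : PMF ℕ) (x y : ℕ) : ℝ :=
  ∑' n : ℕ, (μ n).toReal * gegenbauerConv α hα x n y

/-- Under `P`, the process `S` is a homogeneous Markov chain on `ℕ` with transition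
probabilities `p`, starting from `x`: its finite-dimensional laws are
`P(S_0 = s_0, …, S_n = s_n) = 1_{s_0 = x} p(s_0,s_1) ⋯ p(s_{n-1},s_n)`. -/
structure IsMarkovChainFrom {Ω : Type*} [MeasurableSpace Ω] (p : ℕ → ℕ → ℝ) (x : ℕ)
    (S : ℕ → Ω → ℕ) (P : Measure Ω) : Prop where
  measurable : ∀ n, Measurable (S n)
  law : ∀ (n : ℕ) (s : ℕ → ℕ),
    P.real {ω | ∀ k ≤ n, S k ω = s k} =
      if s 0 = x then ∏ k ∈ Finset.range n, p (s k) (s (k + 1)) else 0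

/-- The local time `N_n(y)`: the number of `k ∈ {0, …, n}` with `S_k = y`. -/
def localTime {Ω : Type*} (S : ℕ → Ω → ℕ) (n y : ℕ) (ω : Ω) : ℕ :=
  ((Finset.range (n + 1)).filter fun k => S k ω = y).card

/-- The support of `μ` is not contained in `2ℕ`. In the degenerate case `α = -1/2` (where
`P_n` is the Chebyshev polynomial, and the walk started at `0` stays in `dℕ` if `μ` is carried by
`dℕ`), the support is not contained in `dℕ` for any `d ≥ 2`. -/
def IsAperiodic (α : ℝ) (μ : PMF ℕ) : Prop :=
  (¬ μ.support ⊆ {n | 2 ∣ n}) ∧ (α = -1 / 2 → ∀ d : ℕ, 2 ≤ d → ¬ μ.support ⊆ {n | d ∣ n})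

/-- The constant `C = (1 / (4(α+1))) ∑_{n ≥ 1} μ(n) n (n + 2α + 1)`. -/
noncomputable def walkConst (α : ℝ) (μ : PMF ℕ) : ℝ :=
  1 / (4 * (α + 1)) * ∑' n : ℕ, (μ n).toReal * (n * (n + 2 * α + 1))

/-- The weights `w_n`, the inverses of the squared norms of the `P_n` in
`L²((1-x²)^α dx)`. -/
noncomputable def gegenbauerWeight (α : ℝ) (n : ℕ) : ℝ :=
  if n = 0 ∧ α = -1 / 2 then 1 / Real.pi
  else (2 * n + 2 * α + 1) * Real.Gamma (n + 2 * α + 1) /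
    (2 ^ (2 * α + 1) * Real.Gamma (n + 1) * Real.Gamma (α + 1) ^ 2)

/-! ### The limit laws -/

/-- `ν` is the Mittag-Leffler distribution of index `a`: the law on `[0, ∞)` whose Laplace
transform at `s ≥ 0` is `∑_p (-s)^p / Γ(p a + 1)`. -/
structure IsMittagLeffler (a : ℝ) (ν : Measure ℝ) : Prop where
  nonneg : ν (Set.Iio 0) = 0
  laplace : ∀ s : ℝ, 0 ≤ s →
    HasSum (fun p : ℕ => (-s) ^ p / Real.Gamma (p * a + 1)) (∫ t, Real.exp (-s * t) ∂ν)

instance isProbabilityMeasure_expMeasure_one : IsProbabilityMeasure (expMeasure 1) :=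
  isProbabilityMeasure_expMeasure one_pos

/-! ### Bounds for the Gegenbauer polynomials -/

/-! Everything is read off the spectral side. For fixed t in [-1, 1] the function v ↦ P_v(t) is a
bounded eigenfunction of the transition kernel, with eigenvalue the Gegenbauer transform μ̂(t) = ∑
μ(n) P_n(t). Orthogonality of the P_n for (1-t²)^α dt inverts this relation: the m-step probability
from x to y is w_y ∫ P_x P_y μ̂^m (1-t²)^α dt (`measureReal_pathEvent_inter`), and the Green
function is G_r(x,y) = w_y ∫ P_x P_y (1 - r μ̂)⁻¹ (1-t²)^α dt.

As r = 1-ε increases to 1, only the point t = 1 makes G diverge: aperiodicity gives μ̂ < 1 on [-1,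
1), and the second moment gives 1 - μ̂(t) ~ 2C(1-t). Rescaling around t = 1 shows that G grows like
c ε^α with c = w_y Γ(α+1) Γ(-α) / (2 C^(α+1)) when α < 0 (`tendsto_spectralGreen_of_neg`), and like
c log(1/ε) with c = (2y+1)/(4C) when α = 0 (`tendsto_spectralGreen_zero`). The start x disappears
because P_x(1) = 1.

The local time enters through a renewal equation at the visits to y, which gives ∑ r^n (1 - E
z^{N_n}) = (1-z) G_r(x,y) / ((z + (1-z) G_r(y,y)) (1-r)) (`hasSum_integral_pow_localTime`). Put r =
e^{-L/n} and z = e^{-s/g(n)} with g(n) = n^{-α} or log n. Divided by n, the right side tends to L⁻¹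
sκ/(1+sκ), where κ = c L^α or c. This is the Laplace transform at L of t ↦ 1 - E_{-α}(-s c t^{-α}),
E being the Mittag-Leffler function, or of the constant sc/(1+sc). Since N_n increases with n, a
Karamata argument (`tendsto_diagonal_of_tendsto_laplace`) recovers the value at t = 1, which is the
limit of 1 - E e^{-s N_n/g(n)}. The continuity theorem for Laplace transforms then gives convergence
in law.

The Mittag-Leffler law itself is constructed: the rescaled local times of the concrete chain with μ
= δ_1 have Laplace transforms converging to E_{-α}(-s), and compactness produces a law with that
transform (`exists_isMittagLeffler`). -/

theorem gegenbauer_eval_one {α : ℝ} (hα : -1 < α) : ∀ n : ℕ, (gegenbauer α n).eval 1 = 1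
  | 0 => by simp [gegenbauer]
  | 1 => by simp [gegenbauer]
  | n + 2 => by
      have h := gegenbauer_rec hα n 1
      rw [gegenbauer_eval_one hα n, gegenbauer_eval_one hα (n + 1)] at h
      have hn : (0 : ℝ) ≤ n := Nat.cast_nonneg n
      have h2 : (n : ℝ) + 2 * α + 2 ≠ 0 := by linarith
      apply mul_left_cancel₀ h2
      linarith

theorem gegenbauer_eval_neg_one {α : ℝ} (hα : -1 < α) :
    ∀ n : ℕ, (gegenbauer α n).eval (-1) = (-1) ^ n
  | 0 => by simp [gegenbauer]
  | 1 => by simp [gegenbauer]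
  | n + 2 => by
      have h := gegenbauer_rec hα n (-1)
      rw [gegenbauer_eval_neg_one hα n, gegenbauer_eval_neg_one hα (n + 1)] at h
      have hn : (0 : ℝ) ≤ n := Nat.cast_nonneg n
      have h2 : (n : ℝ) + 2 * α + 2 ≠ 0 := by linarith
      apply mul_left_cancel₀ h2
      rw [h]
      ring

/-- A quadratic form in two consecutive Gegenbauer polynomials, which decreases in `n`. -/
noncomputable def gegenbauerEnergy (α x : ℝ) (n : ℕ) : ℝ :=
  (gegenbauer α n).eval x ^ 2
    - 2 * x * ((gegenbauer α n).eval x * (gegenbauer α (n + 1)).eval x)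
    + (gegenbauer α (n + 1)).eval x ^ 2

theorem gegenbauerEnergy_zero (α x : ℝ) : gegenbauerEnergy α x 0 = 1 - x ^ 2 := by
  simp [gegenbauerEnergy, gegenbauer]
  ring

/-- The difference of energies factors as (P_{n+2} - P_n)(P_{n+2} + P_n - 2x P_{n+1}), and the
recurrence turns the second factor into a multiple of the first. The sign of -(2α+1) is what makes α
= -1/2 the threshold for monotonicity. -/
theorem gegenbauerEnergy_succ {α : ℝ} (hα : -1 < α) (x : ℝ) (n : ℕ) :
    (2 * n + 2 * α + 3) * (gegenbauerEnergy α x (n + 1) - gegenbauerEnergy α x n) =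
      -(2 * α + 1) * ((gegenbauer α (n + 2)).eval x - (gegenbauer α n).eval x) ^ 2 := by
  have h := gegenbauer_rec hα n x
  simp only [gegenbauerEnergy, add_assoc, Nat.reduceAdd]
  linear_combination 2 * ((gegenbauer α (n + 2)).eval x - (gegenbauer α n).eval x) * h

theorem gegenbauerEnergy_antitone {α : ℝ} (hα : -1 / 2 ≤ α) (x : ℝ) :
    Antitone (gegenbauerEnergy α x) := by
  refine antitone_nat_of_succ_le fun n => ?_
  have h := gegenbauerEnergy_succ (by linarith : -1 < α) x n
  have hn : (0 : ℝ) ≤ n := Nat.cast_nonneg n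
  have hc : 0 < 2 * (n : ℝ) + 2 * α + 3 := by linarith
  have : (2 * n + 2 * α + 3) * (gegenbauerEnergy α x (n + 1) - gegenbauerEnergy α x n) ≤ 0 := by
    rw [h, neg_mul, neg_nonpos]
    exact mul_nonneg (by linarith) (sq_nonneg _)
  nlinarith

theorem le_gegenbauerEnergy (α x : ℝ) (n : ℕ) :
    (1 - x ^ 2) * (gegenbauer α n).eval x ^ 2 ≤ gegenbauerEnergy α x n := by
  have := sq_nonneg ((gegenbauer α (n + 1)).eval x - x * (gegenbauer α n).eval x)
  rw [gegenbauerEnergy]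
  nlinarith

/-- Inside the interval, (1-x²) P_n² is at most the energy, which decreases from its initial value
1-x². The endpoints, where this says nothing, are evaluated directly. -/
theorem abs_gegenbauer_le_one {α : ℝ} (hα : -1 / 2 ≤ α) (n : ℕ) {x : ℝ}
    (hx : x ∈ Set.Icc (-1 : ℝ) 1) : |(gegenbauer α n).eval x| ≤ 1 := by
  have hα' : -1 < α := by linarith
  rcases eq_or_lt_of_le hx.1 with h | h
  · rw [← h, gegenbauer_eval_neg_one hα', abs_pow]
    simp
  rcases eq_or_lt_of_le hx.2 with h' | h'
  · simp [h', gegenbauer_eval_one hα']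
  have hpos : 0 < 1 - x ^ 2 := by nlinarith
  have h1 := (le_gegenbauerEnergy α x n).trans (gegenbauerEnergy_antitone hα x (Nat.zero_le n))
  rw [gegenbauerEnergy_zero] at h1
  rw [← sq_le_one_iff_abs_le_one]
  nlinarith

/-- If P_n(x) = 1 with n ≥ 1, the energy cannot drop between 0 and 1. As 2α+1 > 0, this forces
P_2(x) = P_0(x) = 1, and the recurrence then gives x² = 1. At α = -1/2 the energy is constant and
the argument breaks down. -/
theorem gegenbauer_lt_one {α : ℝ} (hα : -1 / 2 < α) {n : ℕ} (hn : n ≠ 0) {x : ℝ}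
    (hx : x ∈ Set.Ioo (-1 : ℝ) 1) : (gegenbauer α n).eval x < 1 := by
  have hα' : -1 < α := by linarith
  refine lt_of_le_of_ne (abs_le.mp (abs_gegenbauer_le_one hα.le n ⟨hx.1.le, hx.2.le⟩)).2 ?_
  intro h
  have hpos : 0 < 1 - x ^ 2 := by nlinarith [hx.1, hx.2]
  have h1 := (le_gegenbauerEnergy α x n).trans
    (gegenbauerEnergy_antitone hα.le x (Nat.one_le_iff_ne_zero.mpr hn))
  have h2 := gegenbauerEnergy_succ hα' x 0
  have h3 := gegenbauer_rec hα' 0 x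
  rw [gegenbauerEnergy_zero] at h2
  simp only [gegenbauer.eq_1, gegenbauer.eq_2, Polynomial.eval_one, Polynomial.eval_X,
    zero_add, h] at h1 h2 h3
  push_cast at h2 h3
  set p := (gegenbauer α 2).eval x
  have h4 : (2 * α + 1) * (p - 1) ^ 2 ≤ 0 := by nlinarith
  have h5 : (p - 1) ^ 2 = 0 := le_antisymm (by nlinarith) (sq_nonneg _)
  have h6 : p = 1 := by
    have := pow_eq_zero_iff (two_ne_zero) |>.mp h5
    linarith
  rw [h6] at h3
  nlinarith

/-- The recurrence expresses P_{n+1} - P_{n+2} through P_n - P_{n+1} and (1-x) P_{n+1}. The bound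
|P_{n+1}| ≤ 1 and 2α+1 ≥ 0 close the induction. -/
theorem abs_gegenbauer_sub_succ_le {α : ℝ} (hα : -1 / 2 ≤ α) {x : ℝ}
    (hx : x ∈ Set.Icc (-1 : ℝ) 1) : ∀ n : ℕ,
    |(gegenbauer α n).eval x - (gegenbauer α (n + 1)).eval x| ≤ (2 * n + 1) * (1 - x)
  | 0 => by
      simp [gegenbauer, abs_of_nonneg (sub_nonneg.mpr hx.2)]
  | n + 1 => by
      have ih := abs_gegenbauer_sub_succ_le hα hx n
      have h := gegenbauer_rec (by linarith : -1 < α) n x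
      have hb := abs_gegenbauer_le_one hα (n + 1) hx
      simp only [add_assoc, Nat.reduceAdd] at *
      set p := (gegenbauer α n).eval x
      set q := (gegenbauer α (n + 1)).eval x
      set r := (gegenbauer α (n + 2)).eval x
      have hn : (0 : ℝ) ≤ n := Nat.cast_nonneg n
      have h1x : 0 ≤ 1 - x := sub_nonneg.mpr hx.2
      have hc : 0 < (n : ℝ) + 2 * α + 2 := by linarith
      have e : (n + 2 * α + 2) * (q - r) =
          (n + 1) * (p - q) + (2 * n + 2 * α + 3) * ((1 - x) * q) := by
        linear_combination -h
      have h1 : (n + 2 * α + 2) * |q - r| ≤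
          (n + 1) * ((2 * n + 1) * (1 - x)) + (2 * n + 2 * α + 3) * (1 - x) := by
        nth_rewrite 1 [← abs_of_pos hc]
        rw [← abs_mul, e]
        refine (abs_add_le _ _).trans (add_le_add ?_ ?_)
        · rw [abs_mul, abs_of_nonneg (by linarith : (0 : ℝ) ≤ n + 1)]
          gcongr
        · rw [abs_mul, abs_mul, abs_of_nonneg h1x,
            abs_of_nonneg (by linarith : 0 ≤ 2 * (n : ℝ) + 2 * α + 3)]
          have := mul_le_mul_of_nonneg_left hb h1x
          have h0 : 0 ≤ 2 * (n : ℝ) + 2 * α + 3 := by linarith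
          nlinarith
      have h2 : (n + 1) * ((2 * n + 1) * (1 - x)) + (2 * n + 2 * α + 3) * (1 - x) ≤
          (n + 2 * α + 2) * ((2 * (n + 1) + 1) * (1 - x)) := by
        have : 0 ≤ (2 * α + 1) * (2 * n + 2) * (1 - x) :=
          mul_nonneg (mul_nonneg (by linarith) (by linarith)) h1x
        nlinarith
      push_cast
      exact le_of_mul_le_mul_left (h1.trans h2) hc

/-- Telescoping, with ∑_{k<n} (2k+1) = n². This is the domination through which the second moment of
μ controls 1 - μ̂ near 1. -/
theorem abs_one_sub_gegenbauer_le {α : ℝ} (hα : -1 / 2 ≤ α) {x : ℝ}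
    (hx : x ∈ Set.Icc (-1 : ℝ) 1) : ∀ n : ℕ,
    |1 - (gegenbauer α n).eval x| ≤ (n : ℝ) ^ 2 * (1 - x)
  | 0 => by simp [gegenbauer]
  | n + 1 => by
      have ih := abs_one_sub_gegenbauer_le hα hx n
      have h := abs_gegenbauer_sub_succ_le hα hx n
      rw [← sub_add_sub_cancel 1 ((gegenbauer α n).eval x)]
      refine (abs_add_le _ _).trans ((add_le_add ih h).trans (le_of_eq ?_))
      push_cast
      ring

/-! ### Slope of the polynomials at the endpoint 1 -/

theorem gegenbauer_derivative_eval_one {α : ℝ} (hα : -1 < α) : ∀ n : ℕ,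
    (gegenbauer α n).derivative.eval 1 = n * (n + 2 * α + 1) / (2 * (α + 1))
  | 0 => by simp [gegenbauer]
  | 1 => by
      have : 2 * (α + 1) ≠ 0 := by linarith
      rw [eq_div_iff this]
      simp [gegenbauer]
      ring
  | n + 2 => by
      have hn : (0 : ℝ) ≤ n := Nat.cast_nonneg n
      have h1 : (n : ℝ) + 1 + 2 * α + 1 ≠ 0 := by linarith
      have h2 : α + 1 ≠ 0 := by linarith
      rw [gegenbauer.eq_3]
      simp only [Polynomial.derivative_sub, Polynomial.derivative_mul, Polynomial.derivative_C,
        Polynomial.derivative_X, Polynomial.eval_sub, Polynomial.eval_mul, Polynomial.eval_add,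
        Polynomial.eval_C, Polynomial.eval_X, Polynomial.eval_one, Polynomial.eval_zero,
        gegenbauer_eval_one hα, gegenbauer_derivative_eval_one hα n,
        gegenbauer_derivative_eval_one hα (n + 1)]
      push_cast
      field_simp
      ring

theorem tendsto_one_sub_gegenbauer_div {α : ℝ} (hα : -1 < α) (n : ℕ) :
    Tendsto (fun x : ℝ => (1 - (gegenbauer α n).eval x) / (1 - x)) (𝓝[≠] 1)
      (𝓝 (n * (n + 2 * α + 1) / (2 * (α + 1)))) := by
  have h := hasDerivAt_iff_tendsto_slope.mp ((gegenbauer α n).hasDerivAt 1)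
  rw [gegenbauer_derivative_eval_one hα] at h
  refine h.congr fun x => ?_
  rw [slope_def_field, gegenbauer_eval_one hα, ← neg_div_neg_eq, neg_sub, neg_sub]

/-! ### Products of Gegenbauer polynomials -/

theorem X_mul_gegenbauer_succ {α : ℝ} (hα : -1 < α) (n : ℕ) :
    Polynomial.X * gegenbauer α (n + 1) =
      ((n + 1) / (2 * n + 2 * α + 3) : ℝ) • gegenbauer α n +
        ((n + 2 * α + 2) / (2 * n + 2 * α + 3) : ℝ) • gegenbauer α (n + 2) := by
  refine Polynomial.funext fun x => ?_
  have h := gegenbauer_rec hα n x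
  have hn : (0 : ℝ) ≤ n := Nat.cast_nonneg n
  have h2 : 2 * (n : ℝ) + 2 * α + 3 ≠ 0 := by linarith
  simp only [Polynomial.eval_mul, Polynomial.eval_X, Polynomial.eval_add, Polynomial.eval_smul,
    smul_eq_mul]
  rw [div_mul_eq_mul_div, div_mul_eq_mul_div, ← add_div, eq_div_iff h2]
  linear_combination -h

/-- X P_n is a convex combination of the neighbouring P_{n-1} and P_{n+1}, or is P_1 when n = 0.
Hence multiplication by X preserves the functionals bounded by 1 on the basis. -/
theorem abs_map_X_mul_gegenbauer_le {α : ℝ} (hα : -1 / 2 ≤ α) {φ : ℝ[X] →ₗ[ℝ] ℝ}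
    (hφ : ∀ n, |φ (gegenbauer α n)| ≤ 1) (n : ℕ) :
    |φ (Polynomial.X * gegenbauer α n)| ≤ 1 := by
  cases n with
  | zero => simpa [gegenbauer] using hφ 1
  | succ n =>
    have hn : (0 : ℝ) ≤ n := Nat.cast_nonneg n
    have h2 : 0 < 2 * (n : ℝ) + 2 * α + 3 := by linarith
    rw [X_mul_gegenbauer_succ (by linarith), map_add, map_smul, map_smul, smul_eq_mul, smul_eq_mul]
    have h3 : 0 ≤ ((n : ℝ) + 1) / (2 * n + 2 * α + 3) := by positivity
    have h4 : 0 ≤ ((n : ℝ) + 2 * α + 2) / (2 * n + 2 * α + 3) := div_nonneg (by linarith) h2.le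
    refine (abs_add_le _ _).trans ?_
    rw [abs_mul, abs_mul, abs_of_nonneg h3, abs_of_nonneg h4]
    have h5 := mul_le_mul_of_nonneg_left (hφ n) h3
    have h6 := mul_le_mul_of_nonneg_left (hφ (n + 2)) h4
    have h7 : ((n : ℝ) + 1) / (2 * n + 2 * α + 3) + (n + 2 * α + 2) / (2 * n + 2 * α + 3) = 1 := by
      rw [← add_div, div_eq_one_iff_eq h2.ne']
      ring
    linarith

theorem exists_abs_map_gegenbauer_mul_le {α : ℝ} (hα : -1 / 2 ≤ α) : ∀ u : ℕ,
    ∃ K : ℝ, ∀ φ : ℝ[X] →ₗ[ℝ] ℝ, (∀ n, |φ (gegenbauer α n)| ≤ 1) →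
      ∀ n, |φ (gegenbauer α u * gegenbauer α n)| ≤ K
  | 0 => ⟨1, fun φ hφ n => by simpa [gegenbauer] using hφ n⟩
  | 1 => ⟨1, fun φ hφ n => by simpa [gegenbauer] using abs_map_X_mul_gegenbauer_le hα hφ n⟩
  | u + 2 => by
      obtain ⟨K, hK⟩ := exists_abs_map_gegenbauer_mul_le hα u
      obtain ⟨K', hK'⟩ := exists_abs_map_gegenbauer_mul_le hα (u + 1)
      refine ⟨|(2 * ((u : ℝ) + 1) + 2 * α + 1) / ((u + 1) + 2 * α + 1)| * K' +
        |((u : ℝ) + 1) / ((u + 1) + 2 * α + 1)| * K, fun φ hφ n => ?_⟩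
      have h1 := hK φ hφ n
      -- The induction hypothesis is applied to p ↦ φ(X p), which is again bounded by 1 on the
      -- basis. This is why K is uniform over all such functionals.
      have h2 := hK' (φ ∘ₗ LinearMap.mulLeft ℝ Polynomial.X)
        (fun n => abs_map_X_mul_gegenbauer_le hα hφ n) n
      rw [LinearMap.comp_apply, LinearMap.mulLeft_apply] at h2
      rw [gegenbauer.eq_3, sub_mul, Polynomial.C_mul', Polynomial.C_mul', smul_mul_assoc,
        smul_mul_assoc, map_sub, map_smul, map_smul, smul_eq_mul, smul_eq_mul, mul_assoc]
      refine (abs_sub _ _).trans ?_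
      rw [abs_mul, abs_mul]
      gcongr

theorem gegenbauerBasis_apply {α : ℝ} (hα : -1 < α) (n : ℕ) :
    gegenbauerBasis α hα n = gegenbauer α n := by
  rw [gegenbauerBasis, Polynomial.Sequence.basis_eq_self]; rfl

/-- For fixed `u`, the signed measures `δ_u ⋆ δ_n` have uniformly bounded total variation. -/
theorem exists_sum_abs_gegenbauerConv_le {α : ℝ} (hα : -1 / 2 ≤ α) (hα' : -1 < α) (u : ℕ) :
    ∃ K : ℝ, ∀ n (s : Finset ℕ), ∑ v ∈ s, |gegenbauerConv α hα' u n v| ≤ K := by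
  obtain ⟨K, hK⟩ := exists_abs_map_gegenbauer_mul_le hα u
  refine ⟨K, fun n s => ?_⟩
  -- The functional reading off coefficients with the signs of c(u,n,v): its value at P_u P_n is the
  -- total variation on s, while its values on the basis lie in {-1, 0, 1}.
  let φ : ℝ[X] →ₗ[ℝ] ℝ := ∑ v ∈ s,
    (SignType.sign (gegenbauerConv α hα' u n v) : ℝ) • (gegenbauerBasis α hα').coord v
  have h : φ (gegenbauer α u * gegenbauer α n) = ∑ v ∈ s, |gegenbauerConv α hα' u n v| := by
    simp only [φ, LinearMap.sum_apply, LinearMap.smul_apply, Module.Basis.coord_apply, smul_eq_mul]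
    exact Finset.sum_congr rfl fun v _ => sign_mul_self _
  rw [← h]
  refine (le_abs_self _).trans (hK φ (fun m => ?_) n)
  have h1 : φ (gegenbauer α m) = if m ∈ s then
      (SignType.sign (gegenbauerConv α hα' u n m) : ℝ) else 0 := by
    simp only [φ, LinearMap.sum_apply, LinearMap.smul_apply, Module.Basis.coord_apply, smul_eq_mul]
    rw [← gegenbauerBasis_apply hα' m]
    simp [Module.Basis.repr_self, Finsupp.single_apply]
  rw [h1]
  split_ifs
  · rcases SignType.trichotomy (SignType.sign (gegenbauerConv α hα' u n m)) with h | h | h <;>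
      simp [h]
  · simp

theorem gegenbauerConv_support_finite {α : ℝ} (hα : -1 < α) (m n : ℕ) :
    (Function.support (gegenbauerConv α hα m n)).Finite :=
  ((gegenbauerBasis α hα).repr (gegenbauer α m * gegenbauer α n)).hasFiniteSupport

theorem hasSum_gegenbauerConv_mul {α : ℝ} (hα : -1 < α) (m n : ℕ) (x : ℝ) :
    HasSum (fun k => gegenbauerConv α hα m n k * (gegenbauer α k).eval x)
      ((gegenbauer α m).eval x * (gegenbauer α n).eval x) := by
  have h := congrArg (Polynomial.eval x) (gegenbauer_linearization hα m n)
  have hs := gegenbauerConv_support_finite hα m n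
  have hs' : (Function.support fun k => gegenbauerConv α hα m n k • gegenbauer α k) ⊆
      hs.toFinset := fun k hk => by
    rw [Set.Finite.coe_toFinset]
    intro h0
    exact hk (by simp [h0])
  rw [finsum_eq_sum_of_support_subset _ hs', Polynomial.eval_mul, Polynomial.eval_finsetSum] at h
  rw [h]
  simp only [Polynomial.eval_smul, smul_eq_mul]
  refine hasSum_sum_of_ne_finset_zero fun k hk => ?_
  have : gegenbauerConv α hα m n k = 0 := by simpa using hk
  rw [this, zero_mul]

/-! ### Orthogonality of the Gegenbauer polynomials -/

theorem integral_rpow_mul_one_sub_rpow {a b : ℝ} (ha : 0 < a) (hb : 0 < b) :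
    ∫ x in (0 : ℝ)..1, x ^ (a - 1) * (1 - x) ^ (b - 1) =
      Real.Gamma a * Real.Gamma b / Real.Gamma (a + b) := by
  have h := beta_eq_betaIntegralReal a b ha hb
  rw [beta] at h
  rw [h, Complex.betaIntegral]
  have hc : ∀ x ∈ Set.uIcc (0 : ℝ) 1,
      (x : ℂ) ^ ((a : ℂ) - 1) * (1 - (x : ℂ)) ^ ((b : ℂ) - 1) =
        ((x ^ (a - 1) * (1 - x) ^ (b - 1) : ℝ) : ℂ) := fun x hx => by
    rw [Set.uIcc_of_le zero_le_one] at hx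
    rw [Complex.ofReal_mul, Complex.ofReal_cpow hx.1, Complex.ofReal_cpow (by linarith [hx.2])]
    push_cast
    rfl
  rw [intervalIntegral.integral_congr hc, intervalIntegral.integral_ofReal, Complex.ofReal_re]

theorem integral_one_sub_sq_rpow {α : ℝ} (hα : -1 < α) :
    ∫ t in (-1 : ℝ)..1, (1 - t ^ 2) ^ α =
      2 ^ (2 * α + 1) * Real.Gamma (α + 1) ^ 2 / Real.Gamma (2 * α + 2) := by
  have h := integral_rpow_mul_one_sub_rpow (a := α + 1) (b := α + 1) (by linarith) (by linarith)
  have hs := intervalIntegral.integral_comp_div_add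
    (fun x : ℝ => x ^ (α + 1 - 1) * (1 - x) ^ (α + 1 - 1)) (two_ne_zero) (1 / 2) (a := -1) (b := 1)
  norm_num only at hs
  -- With x = (t+1)/2 one has x(1-x) = (1-t²)/4, whence the factor (1/4)^α.
  rw [intervalIntegral.integral_congr (g := fun t => (1 / 4 : ℝ) ^ α * (1 - t ^ 2) ^ α),
    intervalIntegral.integral_const_mul] at hs
  · norm_num only [smul_eq_mul, add_sub_cancel_right] at hs h
    rw [h] at hs
    have h4 : (4 : ℝ) ^ α * (1 / 4 : ℝ) ^ α = 1 := by
      rw [← Real.mul_rpow (by norm_num) (by norm_num)]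
      norm_num
    have h2 : (2 : ℝ) ^ (2 * α + 1) = 4 ^ α * 2 := by
      rw [Real.rpow_add two_pos, Real.rpow_mul two_pos.le, Real.rpow_one]
      norm_num
    have h5 : α + 1 + (α + 1) = 2 * α + 2 := by ring
    rw [h5] at hs
    calc ∫ t in (-1 : ℝ)..1, (1 - t ^ 2) ^ α
        = 4 ^ α * ((1 / 4 : ℝ) ^ α * ∫ t in (-1 : ℝ)..1, (1 - t ^ 2) ^ α) := by
          rw [← mul_assoc, h4, one_mul]
      _ = _ := by
          rw [hs, h2]
          ring
  · intro t ht
    rw [Set.uIcc_of_le (by norm_num)] at ht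
    simp only [add_sub_cancel_right]
    rw [← Real.mul_rpow (by linarith [ht.1]) (by linarith [ht.2]),
      ← Real.mul_rpow (by norm_num) (by nlinarith [ht.1, ht.2])]
    congr 1
    ring

theorem integral_one_sub_sq_rpow_pos {α : ℝ} (hα : -1 < α) :
    0 < ∫ t in (-1 : ℝ)..1, (1 - t ^ 2) ^ α := by
  rw [integral_one_sub_sq_rpow hα]
  have := Real.Gamma_pos_of_pos (by linarith : 0 < α + 1)
  have := Real.Gamma_pos_of_pos (by linarith : 0 < 2 * α + 2)
  positivity

theorem integrableOn_one_sub_sq_rpow {α : ℝ} (hα : -1 < α) :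
    IntegrableOn (fun t : ℝ => (1 - t ^ 2) ^ α) (Set.Ioo (-1) 1) := by
  -- The integral of a non-integrable function is 0 by convention, so a positive value certifies
  -- integrability.
  have h := intervalIntegral.intervalIntegrable_of_integral_ne_zero
    (integral_one_sub_sq_rpow_pos hα).ne'
  rwa [intervalIntegrable_iff_integrableOn_Ioo_of_le (by norm_num)] at h

/-- The orthogonality measure `(1 - t²)^α dt` on `(-1, 1)`. -/
noncomputable def gegenbauerMeasure (α : ℝ) : Measure ℝ :=
  (volume.restrict (Set.Ioo (-1) 1)).withDensity fun t => ENNReal.ofReal ((1 - t ^ 2) ^ α)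

theorem isFiniteMeasure_gegenbauerMeasure {α : ℝ} (hα : -1 < α) :
    IsFiniteMeasure (gegenbauerMeasure α) := by
  refine isFiniteMeasure_withDensity_ofReal (integrableOn_one_sub_sq_rpow hα).2

theorem integral_gegenbauerMeasure (α : ℝ) (f : ℝ → ℝ) :
    ∫ t, f t ∂gegenbauerMeasure α = ∫ t in Set.Ioo (-1 : ℝ) 1, (1 - t ^ 2) ^ α * f t := by
  rw [gegenbauerMeasure, integral_withDensity_eq_integral_toReal_smul (by fun_prop)
    (ae_of_all _ fun _ => ENNReal.ofReal_lt_top)]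
  refine setIntegral_congr_fun measurableSet_Ioo fun t ht => ?_
  simp only [smul_eq_mul]
  rw [ENNReal.toReal_ofReal (Real.rpow_nonneg (by nlinarith [ht.1, ht.2]) _)]

theorem ae_gegenbauerMeasure (α : ℝ) : ∀ᵐ t ∂gegenbauerMeasure α, t ∈ Set.Ioo (-1 : ℝ) 1 :=
  (withDensity_absolutelyContinuous _ _).ae_le (ae_restrict_mem measurableSet_Ioo)

theorem aestronglyMeasurable_gegenbauerMeasure (α : ℝ) {f : ℝ → ℝ}
    (hf : ContinuousOn f (Set.Icc (-1) 1)) : AEStronglyMeasurable f (gegenbauerMeasure α) :=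
  ((hf.mono Set.Ioo_subset_Icc_self).aestronglyMeasurable measurableSet_Ioo).mono_ac
    (withDensity_absolutelyContinuous _ _)

theorem integrable_gegenbauerMeasure {α : ℝ} (hα : -1 < α) {f : ℝ → ℝ}
    (hf : ContinuousOn f (Set.Icc (-1) 1)) : Integrable f (gegenbauerMeasure α) := by
  have := isFiniteMeasure_gegenbauerMeasure hα
  obtain ⟨K, hK⟩ := isCompact_Icc.exists_bound_of_continuousOn hf
  refine Integrable.of_bound (aestronglyMeasurable_gegenbauerMeasure α hf) K ?_
  filter_upwards [ae_gegenbauerMeasure α] with t ht using hK t ⟨ht.1.le, ht.2.le⟩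

theorem integrable_eval_gegenbauerMeasure {α : ℝ} (hα : -1 < α) (p : ℝ[X]) :
    Integrable (fun t => p.eval t) (gegenbauerMeasure α) :=
  integrable_gegenbauerMeasure hα p.continuous.continuousOn

/-- Up to a constant, (1-t²)^α P_{n+1} is the derivative of (1-t²)^(α+1) times the polynomial of
degree n and index α+1, and that primitive vanishes at both endpoints. -/
theorem integral_gegenbauer_succ {α : ℝ} (hα : -1 < α) (n : ℕ) :
    ∫ t, (gegenbauer α (n + 1)).eval t ∂gegenbauerMeasure α = 0 := by
  have hb : 0 < α + 1 := by linarith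
  have hd : ∀ x ∈ Set.Ioo (-1 : ℝ) 1, HasDerivAt
      (fun t : ℝ => (1 - t ^ 2) ^ (α + 1) * (gegenbauer (α + 1) n).eval t)
      (-2 * (α + 1) * ((1 - x ^ 2) ^ α * (gegenbauer α (n + 1)).eval x)) x := fun x hx => by
    simpa only [add_sub_cancel_right] using gegenbauer_hasDerivAt hb n hx
  have hc : ContinuousOn
      (fun t : ℝ => (1 - t ^ 2) ^ (α + 1) * (gegenbauer (α + 1) n).eval t) (Set.Icc (-1) 1) := by
    refine Continuous.continuousOn (Continuous.mul ?_ (gegenbauer (α + 1) n).continuous)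
    exact (Real.continuous_rpow_const hb.le).comp (by fun_prop)
  have hi : IntegrableOn (fun x : ℝ => (1 - x ^ 2) ^ α * (gegenbauer α (n + 1)).eval x)
      (Set.Ioo (-1) 1) := by
    obtain ⟨K, hK⟩ := isCompact_Icc.exists_bound_of_continuousOn
      (gegenbauer α (n + 1)).continuous.continuousOn (s := Set.Icc (-1 : ℝ) 1)
    refine (integrableOn_one_sub_sq_rpow hα).mul_bdd (c := K)
      (gegenbauer α (n + 1)).continuous.aestronglyMeasurable ?_
    filter_upwards [ae_restrict_mem measurableSet_Ioo] with t ht using hK t ⟨ht.1.le, ht.2.le⟩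
  have h := intervalIntegral.integral_eq_sub_of_hasDerivAt_of_le (by norm_num) hc hd
    ((intervalIntegrable_iff_integrableOn_Ioo_of_le (by norm_num)).mpr (hi.const_mul _))
  rw [intervalIntegral.integral_const_mul, intervalIntegral.integral_of_le (by norm_num),
    integral_Ioc_eq_integral_Ioo, ← integral_gegenbauerMeasure] at h
  norm_num [Real.zero_rpow hb.ne'] at h
  exact h.resolve_left hb.ne'

/-! ### The weights as inverse squared norms -/

theorem gegenbauerWeight_pos {α : ℝ} (hα : -1 / 2 ≤ α) (n : ℕ) : 0 < gegenbauerWeight α n := by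
  rw [gegenbauerWeight]
  split_ifs with h
  · positivity
  · have hn : (0 : ℝ) ≤ n := Nat.cast_nonneg n
    have h1 : 0 < (n : ℝ) + 2 * α + 1 := by
      rcases Nat.eq_zero_or_pos n with h0 | h0
      · have : α ≠ -1 / 2 := fun h' => h ⟨h0, h'⟩
        have := lt_of_le_of_ne hα this.symm
        linarith
      · have : (1 : ℝ) ≤ n := by exact_mod_cast h0
        linarith
    have := Real.Gamma_pos_of_pos h1
    have := Real.Gamma_pos_of_pos (by linarith : 0 < α + 1)
    have := Real.Gamma_pos_of_pos (by linarith : 0 < (n : ℝ) + 1)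
    have : 0 < 2 * (n : ℝ) + 2 * α + 1 := by linarith
    positivity

theorem gegenbauerWeight_zero_mul_integral {α : ℝ} (hα : -1 / 2 ≤ α) :
    gegenbauerWeight α 0 * ∫ t in (-1 : ℝ)..1, (1 - t ^ 2) ^ α = 1 := by
  rw [integral_one_sub_sq_rpow (by linarith), gegenbauerWeight]
  have h1 := (Real.Gamma_pos_of_pos (by linarith : 0 < α + 1)).ne'
  split_ifs with h
  · rw [h.2]
    norm_num [Real.Gamma_one_half_eq, Real.Gamma_one]
    rw [Real.sq_sqrt Real.pi_pos.le, inv_mul_cancel₀ Real.pi_pos.ne']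
  · have h2 : 2 * α + 1 ≠ 0 := fun h' => h ⟨rfl, by linarith⟩
    have h3 : Real.Gamma (2 * α + 2) = (2 * α + 1) * Real.Gamma (2 * α + 1) := by
      rw [← Real.Gamma_add_one h2]
      ring_nf
    have h4 : Real.Gamma (2 * α + 1) ≠ 0 := by
      have := (Real.Gamma_pos_of_pos (by linarith : 0 < 2 * α + 2)).ne'
      rw [h3] at this
      exact right_ne_zero_of_mul this
    have h5 : (2 : ℝ) ^ (2 * α + 1) ≠ 0 := by positivity
    rw [h3]
    norm_num
    field_simp

theorem gegenbauerWeight_one {α : ℝ} (hα : -1 / 2 ≤ α) :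
    gegenbauerWeight α 1 = (2 * α + 3) * gegenbauerWeight α 0 := by
  have hs : Real.Gamma (2 * α + 1 + 1) = Real.Gamma (1 + 2 * α + 1) := by ring_nf
  have h1 := (Real.Gamma_pos_of_pos (by linarith : 0 < α + 1)).ne'
  have h5 : (2 : ℝ) ^ (2 * α + 1) ≠ 0 := by positivity
  by_cases h : α = -1 / 2
  · subst h
    norm_num [gegenbauerWeight, Real.Gamma_one_half_eq, Real.Gamma_one]
    rw [Real.sq_sqrt Real.pi_pos.le]
    field_simp
  · have h2 : 2 * α + 1 ≠ 0 := fun h' => h (by linarith)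
    rw [Real.Gamma_add_one h2] at hs
    simp [gegenbauerWeight, h, ← hs, one_add_one_eq_two]
    ring

/-- Detailed balance between n+1 and n+2 for the nearest-neighbour walk given by multiplication by
X. It is the compatibility needed for that multiplication to be symmetric in L². -/
theorem gegenbauerWeight_succ_succ {α : ℝ} (hα : -1 / 2 ≤ α) (n : ℕ) :
    (n + 2) / (2 * n + 2 * α + 5) * gegenbauerWeight α (n + 2) =
      (n + 2 * α + 2) / (2 * n + 2 * α + 3) * gegenbauerWeight α (n + 1) := by
  have hn : (0 : ℝ) ≤ n := Nat.cast_nonneg n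
  have h1 : (n : ℝ) + 2 * α + 2 ≠ 0 := by linarith
  have h2 : (n : ℝ) + 2 ≠ 0 := by linarith
  have e1 : Real.Gamma (n + 2 + 2 * α + 1) = (n + 2 * α + 2) * Real.Gamma (n + 2 * α + 2) := by
    rw [← Real.Gamma_add_one h1]
    ring_nf
  have e2 : Real.Gamma (n + 1 + 2 * α + 1) = Real.Gamma (n + 2 * α + 2) := by ring_nf
  have e3 : Real.Gamma (n + 2 + 1) = (n + 2) * Real.Gamma (n + 2) := Real.Gamma_add_one h2
  have e4 : Real.Gamma (n + 1 + 1) = Real.Gamma (n + 2) := by ring_nf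
  have h3 := (Real.Gamma_pos_of_pos (by linarith : 0 < α + 1)).ne'
  have h4 := (Real.Gamma_pos_of_pos (by linarith : 0 < (n : ℝ) + 2)).ne'
  have h5 : (2 : ℝ) ^ (2 * α + 1) ≠ 0 := by positivity
  have h6 : 2 * ((n : ℝ) + 2) + 2 * α + 1 = 2 * n + 2 * α + 5 := by ring
  have h7 : 2 * ((n : ℝ) + 1) + 2 * α + 1 = 2 * n + 2 * α + 3 := by ring
  have h8 : 2 * (n : ℝ) + 2 * α + 5 ≠ 0 := by linarith
  have h9 : 2 * (n : ℝ) + 2 * α + 3 ≠ 0 := by linarith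
  simp only [gegenbauerWeight, Nat.add_eq_zero_iff, OfNat.ofNat_ne_zero, one_ne_zero, and_false,
    false_and, if_false, Nat.cast_add, Nat.cast_ofNat, Nat.cast_one]
  rw [e1, e2, e3, e4, h6, h7]
  generalize 2 * (n : ℝ) + 2 * α + 5 = A at *
  generalize 2 * (n : ℝ) + 2 * α + 3 = B at *
  field_simp

/-- The Gegenbauer polynomials are orthogonal in `L²((1 - t²)^α dt)`, with squared norms
`1 / w_n`. -/
theorem integral_gegenbauer_mul_gegenbauer {α : ℝ} (hα : -1 / 2 ≤ α) : ∀ m n : ℕ,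
    gegenbauerWeight α n *
      ∫ t, (gegenbauer α m).eval t * (gegenbauer α n).eval t ∂gegenbauerMeasure α =
      if m = n then 1 else 0 := by
  have hα' : -1 < α := by linarith
  let I : ℝ[X] → ℝ := fun p => ∫ t, p.eval t ∂gegenbauerMeasure α
  have hadd : ∀ p q : ℝ[X], I (p + q) = I p + I q := fun p q => by
    simp only [I, Polynomial.eval_add]
    exact integral_add (integrable_eval_gegenbauerMeasure hα' p)
      (integrable_eval_gegenbauerMeasure hα' q)
  have hsmul : ∀ (c : ℝ) (p : ℝ[X]), I (c • p) = c * I p := fun c p => by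
    simp only [I, Polynomial.eval_smul, smul_eq_mul]
    exact integral_const_mul _ _
  suffices h : ∀ m n : ℕ, gegenbauerWeight α n * I (gegenbauer α m * gegenbauer α n) =
      if m = n then 1 else 0 by
    simpa only [I, Polynomial.eval_mul] using h
  have hz : ∀ n : ℕ, gegenbauerWeight α n * I (gegenbauer α 0 * gegenbauer α n) =
      if 0 = n then 1 else 0 := fun n => by
    cases n with
    | zero =>
      rw [if_pos rfl, ← gegenbauerWeight_zero_mul_integral hα]
      simp only [I, integral_gegenbauerMeasure, gegenbauer, mul_one, Polynomial.eval_one]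
      rw [intervalIntegral.integral_of_le (by norm_num), integral_Ioc_eq_integral_Ioo]
    | succ n =>
      simp [I, gegenbauer.eq_1, integral_gegenbauer_succ hα']
  -- multiplication by `X` on either factor
  have hX : ∀ m n : ℕ, I (Polynomial.X * gegenbauer α m * gegenbauer α n) =
      I (gegenbauer α m * (Polynomial.X * gegenbauer α n)) := fun m n => by
    congr 1
    ring
  have hX0 : ∀ q : ℝ[X], I (Polynomial.X * gegenbauer α 0 * q) = I (gegenbauer α 1 * q) :=
    fun q => by simp [gegenbauer]
  have hX0' : ∀ q : ℝ[X], I (q * (Polynomial.X * gegenbauer α 0)) = I (q * gegenbauer α 1) :=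
    fun q => by simp [gegenbauer]
  have hXl : ∀ (m : ℕ) (q : ℝ[X]), I (Polynomial.X * gegenbauer α (m + 1) * q) =
      (m + 1) / (2 * m + 2 * α + 3) * I (gegenbauer α m * q) +
        (m + 2 * α + 2) / (2 * m + 2 * α + 3) * I (gegenbauer α (m + 2) * q) := fun m q => by
    rw [X_mul_gegenbauer_succ hα', add_mul, hadd, smul_mul_assoc, smul_mul_assoc, hsmul, hsmul]
  have hXr : ∀ (n : ℕ) (q : ℝ[X]), I (q * (Polynomial.X * gegenbauer α (n + 1))) =
      (n + 1) / (2 * n + 2 * α + 3) * I (q * gegenbauer α n) +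
        (n + 2 * α + 2) / (2 * n + 2 * α + 3) * I (q * gegenbauer α (n + 2)) := fun n q => by
    rw [X_mul_gegenbauer_succ hα', mul_add, hadd, mul_smul_comm, mul_smul_comm, hsmul, hsmul]
  have hw := fun n => (gegenbauerWeight_pos hα n).ne'
  have hI : ∀ m n : ℕ, (gegenbauerWeight α n * I (gegenbauer α m * gegenbauer α n) =
      if m = n then 1 else 0) ↔ I (gegenbauer α m * gegenbauer α n) =
      if m = n then (gegenbauerWeight α n)⁻¹ else 0 := fun m n => by
    rw [← eq_inv_mul_iff_mul_eq₀ (hw n)]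
    split_ifs <;> simp
  simp only [hI] at hz ⊢
  have hone : ∀ n : ℕ, I (gegenbauer α 1 * gegenbauer α n) =
      if 1 = n then (gegenbauerWeight α n)⁻¹ else 0 := fun n => by
    rw [← hX0, hX]
    cases n with
    | zero => rw [hX0', hz]; simp
    | succ n =>
      rw [hXr, hz, hz]
      cases n with
      | zero =>
        simp [gegenbauerWeight_one hα, mul_comm]
      | succ n => simp
  have hw2 : ∀ n : ℕ, ((n : ℝ) + 2) / (2 * n + 2 * α + 5) * (gegenbauerWeight α (n + 1))⁻¹ =
      (n + 2 * α + 2) / (2 * n + 2 * α + 3) * (gegenbauerWeight α (n + 2))⁻¹ := fun n => by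
    rw [← div_eq_mul_inv, ← div_eq_mul_inv, div_eq_div_iff (hw _) (hw _)]
    exact gegenbauerWeight_succ_succ hα n
  intro m
  induction m using Nat.strong_induction_on with
  | _ m ih =>
    match m with
    | 0 => exact hz
    | 1 => exact hone
    | m + 2 =>
      intro n
      have hm : (0 : ℝ) ≤ m := Nat.cast_nonneg m
      have h2 : 2 * (m : ℝ) + 2 * α + 3 ≠ 0 := by linarith
      have h3 : (m : ℝ) + 2 * α + 2 ≠ 0 := by linarith
      -- Solve for P_{m+2} in terms of X P_{m+1} and P_m, move X onto P_n, and use the two preceding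
      -- cases of the induction. The nonzero terms sit at n = m or n = m+2 and are matched by
      -- detailed balance.
      have h := hXl m (gegenbauer α n)
      rw [hX, ih m (by omega) n] at h
      have hd : ((m : ℝ) + 2 * α + 2) / (2 * m + 2 * α + 3) ≠ 0 := div_ne_zero h3 h2
      apply mul_left_cancel₀ hd
      rw [← sub_eq_iff_eq_add'.mpr h]
      cases n with
      | zero =>
        rw [hX0', ih (m + 1) (by omega)]
        by_cases h0 : m = 0
        · subst h0
          simp [gegenbauerWeight_one hα, mul_comm]
        · simp [h0]
      | succ n =>
        rw [hXr, ih (m + 1) (by omega), ih (m + 1) (by omega)]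
        by_cases h0 : m + 1 = n
        · subst h0
          have h5 : 2 * ((m : ℝ) + 1) + 2 * α + 3 = 2 * m + 2 * α + 5 := by ring
          have h6 : (m : ℝ) + 1 + 1 = m + 2 := by ring
          simp only [if_true, if_neg (show m ≠ m + 1 + 1 by omega), mul_zero, sub_zero, add_zero,
            Nat.cast_add, Nat.cast_one, h5, h6, show m + 1 ≠ m + 1 + 2 by omega, if_false]
          exact hw2 m
        · by_cases h1 : m = n + 1
          · subst h1
            have h5 : 2 * ((n : ℝ) + 1) + 2 * α + 3 = 2 * n + 2 * α + 5 := by ring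
            have h6 : (n : ℝ) + 1 + 1 = n + 2 := by ring
            simp only [if_true, if_neg (show n + 1 + 1 ≠ n by omega), mul_zero, zero_add,
              Nat.cast_add, Nat.cast_one, h5, h6, if_neg (show n + 1 + 2 ≠ n + 1 by omega)]
            exact sub_eq_zero.mpr (hw2 n).symm
          · simp [h0, h1]

/-! ### The Gegenbauer transform of the step distribution -/

theorem gegenbauer_neg_half_eval_cos (θ : ℝ) : ∀ n : ℕ,
    (gegenbauer (-1 / 2) n).eval (Real.cos θ) = Real.cos (n * θ)
  | 0 => by simp [gegenbauer]
  | 1 => by simp [gegenbauer]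
  | n + 2 => by
      have h := gegenbauer_rec (by norm_num : (-1 : ℝ) < -1 / 2) n (Real.cos θ)
      rw [gegenbauer_neg_half_eval_cos θ n, gegenbauer_neg_half_eval_cos θ (n + 1)] at h
      have hn : (n : ℝ) + 1 ≠ 0 := by positivity
      apply mul_left_cancel₀ hn
      have e1 : Real.cos ((n + 2 : ℕ) * θ) =
          Real.cos ((n + 1 : ℕ) * θ) * Real.cos θ - Real.sin ((n + 1 : ℕ) * θ) * Real.sin θ := by
        rw [← Real.cos_add]
        push_cast
        ring_nf
      have e2 : Real.cos (n * θ) =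
          Real.cos ((n + 1 : ℕ) * θ) * Real.cos θ + Real.sin ((n + 1 : ℕ) * θ) * Real.sin θ := by
        rw [← Real.cos_sub]
        push_cast
        ring_nf
      rw [e2] at h
      rw [e1]
      linear_combination h

theorem PMF.hasSum_toReal (μ : PMF ℕ) : HasSum (fun n => (μ n).toReal) 1 := by
  have h := ENNReal.hasSum_toReal (f := μ) (by rw [μ.tsum_coe]; exact ENNReal.one_ne_top)
  rwa [← ENNReal.tsum_toReal_eq (fun n => μ.apply_ne_top n), μ.tsum_coe, ENNReal.toReal_one] at h

theorem PMF.toReal_pos {μ : PMF ℕ} {n : ℕ} (hn : n ∈ μ.support) : 0 < (μ n).toReal :=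
  ENNReal.toReal_pos ((μ.mem_support_iff n).mp hn) (μ.apply_ne_top n)

/-- The Gegenbauer transform `t ↦ ∑_n μ(n) P_n(t)` of `μ`. -/
noncomputable def gegenbauerTransform (α : ℝ) (μ : PMF ℕ) (t : ℝ) : ℝ :=
  ∑' n : ℕ, (μ n).toReal * (gegenbauer α n).eval t

theorem hasSum_gegenbauerTransform {α : ℝ} (hα : -1 / 2 ≤ α) (μ : PMF ℕ) {t : ℝ}
    (ht : t ∈ Set.Icc (-1 : ℝ) 1) :
    HasSum (fun n => (μ n).toReal * (gegenbauer α n).eval t) (gegenbauerTransform α μ t) := by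
  refine (Summable.of_norm_bounded μ.hasSum_toReal.summable fun n => ?_).hasSum
  rw [norm_mul, Real.norm_eq_abs, abs_of_nonneg ENNReal.toReal_nonneg]
  exact mul_le_of_le_one_right ENNReal.toReal_nonneg (abs_gegenbauer_le_one hα n ht)

theorem hasSum_one_sub_gegenbauerTransform {α : ℝ} (hα : -1 / 2 ≤ α) (μ : PMF ℕ) {t : ℝ}
    (ht : t ∈ Set.Icc (-1 : ℝ) 1) :
    HasSum (fun n => (μ n).toReal * (1 - (gegenbauer α n).eval t))
      (1 - gegenbauerTransform α μ t) := by
  simpa only [mul_sub, mul_one] using μ.hasSum_toReal.sub (hasSum_gegenbauerTransform hα μ ht)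

theorem abs_gegenbauerTransform_le_one {α : ℝ} (hα : -1 / 2 ≤ α) (μ : PMF ℕ) {t : ℝ}
    (ht : t ∈ Set.Icc (-1 : ℝ) 1) : |gegenbauerTransform α μ t| ≤ 1 := by
  rw [← Real.norm_eq_abs]
  refine tsum_of_norm_bounded μ.hasSum_toReal fun n => ?_
  rw [norm_mul, Real.norm_eq_abs, abs_of_nonneg ENNReal.toReal_nonneg]
  exact mul_le_of_le_one_right ENNReal.toReal_nonneg (abs_gegenbauer_le_one hα n ht)

theorem continuousOn_gegenbauerTransform {α : ℝ} (hα : -1 / 2 ≤ α) (μ : PMF ℕ) :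
    ContinuousOn (gegenbauerTransform α μ) (Set.Icc (-1) 1) := by
  refine continuousOn_tsum (u := fun n => (μ n).toReal)
    (fun n => (continuous_const.mul (gegenbauer α n).continuous).continuousOn)
    μ.hasSum_toReal.summable fun n t ht => ?_
  rw [norm_mul, Real.norm_eq_abs, abs_of_nonneg ENNReal.toReal_nonneg]
  exact mul_le_of_le_one_right ENNReal.toReal_nonneg (abs_gegenbauer_le_one hα n ht)

theorem IsAperiodic.exists_odd {α : ℝ} {μ : PMF ℕ} (hμ : IsAperiodic α μ) :
    ∃ n ∈ μ.support, Odd n := by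
  obtain ⟨n, hn, h⟩ := Set.not_subset.mp hμ.1
  exact ⟨n, hn, Nat.not_even_iff_odd.mp fun h' => h h'.two_dvd⟩

/-- An odd n in the support settles t = -1, and the interior when α > -1/2. For α = -1/2, P_n(cos θ)
= cos nθ equals 1 exactly when the order of θ in the circle divides n, so failure would put the
support inside the multiples of that order. -/
theorem IsAperiodic.exists_gegenbauer_lt_one {α : ℝ} (hα : -1 / 2 ≤ α) {μ : PMF ℕ}
    (hμ : IsAperiodic α μ) {t : ℝ} (ht : t ∈ Set.Ico (-1 : ℝ) 1) :
    ∃ n ∈ μ.support, (gegenbauer α n).eval t < 1 := by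
  obtain ⟨n, hn, hodd⟩ := hμ.exists_odd
  rcases eq_or_lt_of_le ht.1 with h1 | h1
  · refine ⟨n, hn, ?_⟩
    rw [← h1, gegenbauer_eval_neg_one (by linarith), hodd.neg_one_pow]
    norm_num
  rcases eq_or_lt_of_le hα with h2 | h2
  · subst h2
    by_contra! h
    set θ := Real.arccos t
    have hθ : Real.cos θ = t := Real.cos_arccos ht.1 ht.2.le
    have hθ0 : (θ : Real.Angle) ≠ 0 := fun h0 => by
      have := congrArg Real.Angle.cos h0
      rw [Real.Angle.cos_coe, hθ, Real.Angle.cos_zero] at this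
      exact ht.2.ne this
    have hdvd : ∀ n ∈ μ.support, addOrderOf (θ : Real.Angle) ∣ n := fun n hn => by
      have h3 := le_antisymm (abs_le.mp (abs_gegenbauer_le_one hα n ⟨ht.1, ht.2.le⟩)).2 (h n hn)
      rw [← hθ, gegenbauer_neg_half_eval_cos, Real.cos_eq_one_iff] at h3
      obtain ⟨k, hk⟩ := h3
      rw [addOrderOf_dvd_iff_nsmul_eq_zero, ← Real.Angle.natCast_mul_eq_nsmul, ← hk,
        Real.Angle.coe_eq_zero_iff]
      exact ⟨k, by simp⟩
    have hne : addOrderOf (θ : Real.Angle) ≠ 1 := fun h1 =>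
      hθ0 (AddMonoid.addOrderOf_eq_one_iff.mp h1)
    -- Order 0 encodes infinite order: the support would then be {0}, which contains no odd integer.
    rcases Nat.eq_zero_or_pos (addOrderOf (θ : Real.Angle)) with h0 | h0
    · have := hdvd n hn
      rw [h0, zero_dvd_iff] at this
      rw [this] at hodd
      exact absurd hodd (by decide)
    · exact hμ.2 rfl _ (by omega) hdvd
  · exact ⟨n, hn, gegenbauer_lt_one h2 hodd.pos.ne' ⟨h1, ht.2⟩⟩

theorem gegenbauerTransform_lt_one {α : ℝ} (hα : -1 / 2 ≤ α) {μ : PMF ℕ}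
    (hμ : IsAperiodic α μ) {t : ℝ} (ht : t ∈ Set.Ico (-1 : ℝ) 1) :
    gegenbauerTransform α μ t < 1 := by
  have ht' : t ∈ Set.Icc (-1 : ℝ) 1 := ⟨ht.1, ht.2.le⟩
  obtain ⟨n, hn, h⟩ := hμ.exists_gegenbauer_lt_one hα ht
  have hs := hasSum_one_sub_gegenbauerTransform hα μ ht'
  have h0 : ∀ k, 0 ≤ (μ k).toReal * (1 - (gegenbauer α k).eval t) := fun k =>
    mul_nonneg ENNReal.toReal_nonneg
      (sub_nonneg.mpr (abs_le.mp (abs_gegenbauer_le_one hα k ht')).2)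
  have := hs.summable.tsum_pos h0 n (mul_pos (PMF.toReal_pos hn) (sub_pos.mpr h))
  rw [hs.tsum_eq] at this
  linarith

theorem summable_walkConst {α : ℝ} {μ : PMF ℕ}
    (hμ2 : Summable fun n : ℕ => (μ n).toReal * (n : ℝ) ^ 2) :
    Summable fun n : ℕ => (μ n).toReal * (n * (n + 2 * α + 1)) := by
  have h1 : Summable fun n : ℕ => (μ n).toReal * (n : ℝ) := by
    refine Summable.of_nonneg_of_le (fun n => by positivity) (fun n => ?_) hμ2
    refine mul_le_mul_of_nonneg_left ?_ ENNReal.toReal_nonneg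
    exact_mod_cast Nat.le_self_pow two_ne_zero n
  refine (hμ2.add (h1.mul_left (2 * α + 1))).congr fun n => ?_
  ring

theorem walkConst_pos {α : ℝ} (hα : -1 / 2 ≤ α) {μ : PMF ℕ} (hμ : IsAperiodic α μ)
    (hμ2 : Summable fun n : ℕ => (μ n).toReal * (n : ℝ) ^ 2) : 0 < walkConst α μ := by
  obtain ⟨n, hn, hodd⟩ := hμ.exists_odd
  have h0 : ∀ k : ℕ, (0 : ℝ) ≤ k + 2 * α + 1 := fun k => by
    have : (0 : ℝ) ≤ k := Nat.cast_nonneg k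
    linarith
  have hn1 : (1 : ℝ) ≤ n := by exact_mod_cast hodd.pos
  have := (summable_walkConst (α := α) hμ2).tsum_pos
    (fun k => mul_nonneg ENNReal.toReal_nonneg (mul_nonneg k.cast_nonneg (h0 k))) n
    (mul_pos (PMF.toReal_pos hn) (mul_pos (by linarith) (by linarith)))
  rw [walkConst]
  have : 0 < 4 * (α + 1) := by linarith
  positivity

/-- Dominated convergence in n: each quotient tends to the derivative P_n'(1), with bound μ(n) n².
The constant C is half the μ-average of these derivatives. -/
theorem tendsto_one_sub_gegenbauerTransform_div {α : ℝ} (hα : -1 / 2 ≤ α) {μ : PMF ℕ}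
    (hμ2 : Summable fun n : ℕ => (μ n).toReal * (n : ℝ) ^ 2) :
    Tendsto (fun t => (1 - gegenbauerTransform α μ t) / (1 - t)) (𝓝[<] 1)
      (𝓝 (2 * walkConst α μ)) := by
  have hc : 2 * walkConst α μ =
      ∑' n : ℕ, (μ n).toReal * (n * (n + 2 * α + 1) / (2 * (α + 1))) := by
    have : α + 1 ≠ 0 := by linarith
    rw [walkConst, ← tsum_mul_left, ← tsum_mul_left]
    refine tsum_congr fun n => ?_
    field_simp
    ring
  have hev : ∀ᶠ t : ℝ in 𝓝[<] 1, t ∈ Set.Ioo (-1 : ℝ) 1 :=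
    Ioo_mem_nhdsLT (by norm_num)
  rw [hc]
  refine (tendsto_tsum_of_dominated_convergence hμ2
    (f := fun t n => (μ n).toReal * ((1 - (gegenbauer α n).eval t) / (1 - t)))
    (fun n => ((tendsto_one_sub_gegenbauer_div (by linarith) n).mono_left
      (nhdsWithin_mono _ fun t ht => ne_of_lt ht)).const_mul _) ?_).congr' ?_
  · filter_upwards [hev] with t ht n
    have h1 : 0 < 1 - t := by linarith [ht.2]
    rw [norm_mul, Real.norm_eq_abs, abs_of_nonneg ENNReal.toReal_nonneg, Real.norm_eq_abs, abs_div,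
      abs_of_pos h1]
    refine mul_le_mul_of_nonneg_left ?_ ENNReal.toReal_nonneg
    rw [div_le_iff₀ h1]
    exact abs_one_sub_gegenbauer_le hα ⟨ht.1.le, ht.2.le⟩ n
  · filter_upwards [hev] with t ht
    rw [← (hasSum_one_sub_gegenbauerTransform hα μ ⟨ht.1.le, ht.2.le⟩).tsum_eq, ← tsum_div_const]
    exact tsum_congr fun n => (mul_div_assoc _ _ _).symm

theorem exists_mul_one_sub_le {α : ℝ} (hα : -1 / 2 ≤ α) {μ : PMF ℕ} (hμ : IsAperiodic α μ)
    (hμ2 : Summable fun n : ℕ => (μ n).toReal * (n : ℝ) ^ 2) :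
    ∃ κ : ℝ, 0 < κ ∧ ∀ t ∈ Set.Icc (-1 : ℝ) 1, κ * (1 - t) ≤ 1 - gegenbauerTransform α μ t := by
  have hC := walkConst_pos hα hμ hμ2
  have h1 := (tendsto_one_sub_gegenbauerTransform_div hα hμ2).eventually
    (lt_mem_nhds (by linarith : walkConst α μ < 2 * walkConst α μ))
  obtain ⟨a, ha, h2⟩ := (mem_nhdsLT_iff_exists_Ioo_subset' (by norm_num : (-1 : ℝ) < 1)).mp h1
  have hcont : ContinuousOn (fun t => 1 - gegenbauerTransform α μ t) (Set.Icc (-1) (max a (-1))) :=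
    (continuousOn_const.sub (continuousOn_gegenbauerTransform hα μ)).mono
      (Set.Icc_subset_Icc le_rfl (max_le (le_of_lt ha) (by norm_num)))
  obtain ⟨s, hs, hmin⟩ := isCompact_Icc.exists_isMinOn
    (Set.nonempty_Icc.mpr (le_max_right _ _)) hcont
  have hs1 : s < 1 := hs.2.trans_lt (max_lt ha (by norm_num))
  have hpos : 0 < 1 - gegenbauerTransform α μ s :=
    sub_pos.mpr (gegenbauerTransform_lt_one hα hμ ⟨hs.1, hs1⟩)
  -- Near 1 the quotient exceeds C, being close to 2C. On the remaining compact interval 1 - μ̂ is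
  -- at least its value at the minimiser s, and the division by 2 accounts for 1-t ≤ 2.
  refine ⟨min (walkConst α μ) ((1 - gegenbauerTransform α μ s) / 2), by positivity, fun t ht => ?_⟩
  rcases eq_or_lt_of_le ht.2 with h | h
  · rw [h, sub_self, mul_zero]
    exact sub_nonneg.mpr (abs_le.mp (abs_gegenbauerTransform_le_one hα μ (by simp))).2
  have h3 : 0 < 1 - t := by linarith
  by_cases hta : t ≤ max a (-1)
  · have h4 : 1 - gegenbauerTransform α μ s ≤ 1 - gegenbauerTransform α μ t := hmin ⟨ht.1, hta⟩
    have h5 : min (walkConst α μ) ((1 - gegenbauerTransform α μ s) / 2) * (1 - t) ≤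
        (1 - gegenbauerTransform α μ s) / 2 * (1 - t) :=
      mul_le_mul_of_nonneg_right (min_le_right _ _) h3.le
    nlinarith [ht.1]
  · rw [not_le, max_lt_iff] at hta
    have h4 := h2 ⟨hta.1, h⟩
    rw [Set.mem_ofPred_eq, lt_div_iff₀ h3] at h4
    exact (mul_le_mul_of_nonneg_right (min_le_left _ _) h3.le).trans h4.le

/-! ### The transition probabilities -/

/-- Integrating a bounded function against a mixture of uniformly bounded signed measures. -/
theorem hasSum_tsum_mul_mul {m f : ℕ → ℝ} {c : ℕ → ℕ → ℝ} {g : ℕ → ℝ} {K : ℝ}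
    (hm0 : ∀ n, 0 ≤ m n) (hm : Summable m) (hK : ∀ n (s : Finset ℕ), ∑ v ∈ s, |c n v| ≤ K)
    (hf : ∀ v, |f v| ≤ 1) (hg : ∀ n, HasSum (fun v => c n v * f v) (g n)) :
    HasSum (fun v => (∑' n, m n * c n v) * f v) (∑' n, m n * g n) := by
  have hc : ∀ n, Summable fun v => |c n v| := fun n =>
    summable_of_sum_le (fun _ => abs_nonneg _) (hK n)
  have hK' : ∀ n, ∑' v, |c n v| ≤ K := fun n =>
    Real.tsum_le_of_sum_le (fun _ => abs_nonneg _) (hK n)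
  have habs : Summable fun q : ℕ × ℕ => m q.1 * |c q.1 q.2| := by
    have h0 : (0 : ℕ × ℕ → ℝ) ≤ fun q => m q.1 * |c q.1 q.2| :=
      fun q => mul_nonneg (hm0 _) (abs_nonneg _)
    refine (summable_prod_of_nonneg h0).mpr ⟨fun n => (hc n).mul_left (m n), ?_⟩
    simp only [tsum_mul_left]
    refine Summable.of_nonneg_of_le (fun n => mul_nonneg (hm0 n)
      (tsum_nonneg fun _ => abs_nonneg _)) (fun n => ?_) (hm.mul_right K)
    exact mul_le_mul_of_nonneg_left (hK' n) (hm0 n)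
  have hs : Summable fun q : ℕ × ℕ => m q.1 * (c q.1 q.2 * f q.2) := by
    refine Summable.of_norm_bounded habs fun q => ?_
    rw [norm_mul, norm_mul, Real.norm_eq_abs, abs_of_nonneg (hm0 _)]
    exact mul_le_mul_of_nonneg_left (mul_le_of_le_one_right (abs_nonneg _) (hf _)) (hm0 _)
  have h1 := hs.hasSum
  rw [hs.tsum_prod' fun n => ((hg n).mul_left (m n)).summable] at h1
  simp only [fun n => ((hg n).mul_left (m n)).tsum_eq] at h1
  refine ((Equiv.prodComm ℕ ℕ).hasSum_iff.mpr h1).prod_fiberwise fun v => ?_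
  have h6 : Summable fun n => m n * c n v := by
    refine (Summable.of_norm_bounded (habs.comp_injective (i := fun n : ℕ => (n, v))
      (fun a b h => (Prod.mk.inj h).1)) fun n => ?_)
    rw [norm_mul, Real.norm_eq_abs, abs_of_nonneg (hm0 _)]
    rfl
  have h7 := h6.hasSum.mul_right (f v)
  simpa [mul_assoc, Function.comp_def] using h7

/-- The eigenfunction relation: summing the linearization formula against μ gives eigenvalue μ̂(t).
The uniform total-variation bound for δ_u ⋆ δ_n justifies exchanging the sums. -/
theorem hasSum_gegenbauerTransition_mul {α : ℝ} (hα : -1 / 2 ≤ α) (hα' : -1 < α) (μ : PMF ℕ)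
    (u : ℕ) {t : ℝ} (ht : t ∈ Set.Icc (-1 : ℝ) 1) :
    HasSum (fun v => gegenbauerTransition α hα' μ u v * (gegenbauer α v).eval t)
      ((gegenbauer α u).eval t * gegenbauerTransform α μ t) := by
  obtain ⟨K, hK⟩ := exists_sum_abs_gegenbauerConv_le hα hα' u
  have h := hasSum_tsum_mul_mul (fun n => ENNReal.toReal_nonneg) μ.hasSum_toReal.summable hK
    (fun v => abs_gegenbauer_le_one hα v ht) (fun n => hasSum_gegenbauerConv_mul hα' u n t)
  have e : (gegenbauer α u).eval t * gegenbauerTransform α μ t =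
      ∑' n, (μ n).toReal * ((gegenbauer α u).eval t * (gegenbauer α n).eval t) := by
    rw [gegenbauerTransform, ← tsum_mul_left]
    exact tsum_congr fun n => by ring
  rw [e]
  exact h

/-! ### The Markov property -/

theorem hasSum_setIntegral_inter_eq {Ω ι : Type*} [MeasurableSpace Ω] [Countable ι]
    [MeasurableSpace ι] [MeasurableSingletonClass ι] {P : Measure Ω} {A : Set Ω} {X : Ω → ι}
    (hA : MeasurableSet A) (hX : Measurable X) {f : Ω → ℝ} (hf : IntegrableOn f A P) :
    HasSum (fun i => ∫ ω in A ∩ {ω | X ω = i}, f ω ∂P) (∫ ω in A, f ω ∂P) := by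
  have hU : ⋃ i, A ∩ {ω | X ω = i} = A := by
    ext ω
    simp
  have h := hasSum_integral_iUnion (μ := P) (f := f) (s := fun i => A ∩ {ω | X ω = i})
    (fun i => hA.inter (hX (measurableSet_singleton i))) (fun i j hij => ?_) (by rwa [hU])
  · rwa [hU] at h
  · refine Set.disjoint_left.mpr fun ω h1 h2 => hij ?_
    exact h1.2.symm.trans h2.2

/-- The spectral expression of the probability that the walk goes from `u` to `y` in `m` steps. -/
noncomputable def spectralTransition (α : ℝ) (μ : PMF ℕ) (m u y : ℕ) : ℝ :=
  gegenbauerWeight α y * ∫ t, (gegenbauer α u).eval t * (gegenbauer α y).eval t *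
    gegenbauerTransform α μ t ^ m ∂gegenbauerMeasure α

/-- The event that the path follows `s` up to time `n`. -/
def pathEvent {Ω : Type*} (S : ℕ → Ω → ℕ) (n : ℕ) (s : ℕ → ℕ) : Set Ω :=
  {ω | ∀ k ≤ n, S k ω = s k}

theorem pathEvent_inter {Ω : Type*} (S : ℕ → Ω → ℕ) (n : ℕ) (s : ℕ → ℕ) (u : ℕ) :
    pathEvent S n s ∩ {ω | S (n + 1) ω = u} =
      pathEvent S (n + 1) (Function.update s (n + 1) u) := by
  ext ω
  simp only [pathEvent, Set.mem_inter_iff, Set.mem_ofPred_eq]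
  constructor
  · rintro ⟨h1, h2⟩ k hk
    rcases Nat.lt_or_eq_of_le hk with h | h
    · rw [Function.update_of_ne h.ne]
      exact h1 k (Nat.lt_succ_iff.mp h)
    · subst h
      simpa using h2
  · intro h
    refine ⟨fun k hk => ?_, by simpa using h (n + 1) le_rfl⟩
    have := h k (hk.trans (Nat.le_succ n))
    rwa [Function.update_of_ne (by omega)] at this

namespace IsMarkovChainFrom

variable {Ω : Type*} [MeasurableSpace Ω] {α : ℝ} {hα' : -1 < α} {μ : PMF ℕ} {x : ℕ}
  {S : ℕ → Ω → ℕ} {P : Measure Ω}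

theorem measurableSet_pathEvent {p : ℕ → ℕ → ℝ} (h : IsMarkovChainFrom p x S P) (n : ℕ)
    (s : ℕ → ℕ) : MeasurableSet (pathEvent S n s) := by
  have : pathEvent S n s = ⋂ k ∈ Finset.range (n + 1), S k ⁻¹' {s k} := by
    ext ω
    simp [pathEvent]
  rw [this]
  exact Finset.measurableSet_biInter _ fun k _ => h.measurable k (measurableSet_singleton _)

theorem measureReal_pathEvent_update {p : ℕ → ℕ → ℝ} (h : IsMarkovChainFrom p x S P) (n : ℕ)
    (s : ℕ → ℕ) (u : ℕ) :
    P.real (pathEvent S (n + 1) (Function.update s (n + 1) u)) =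
      P.real (pathEvent S n s) * p (s n) u := by
  have h1 := h.law (n + 1) (Function.update s (n + 1) u)
  have h2 := h.law n s
  rw [Function.update_of_ne (by omega), Finset.prod_range_succ, Function.update_self,
    Function.update_of_ne (by omega)] at h1
  have h3 : ∏ k ∈ Finset.range n, p (Function.update s (n + 1) u k)
      (Function.update s (n + 1) u (k + 1)) = ∏ k ∈ Finset.range n, p (s k) (s (k + 1)) := by
    refine Finset.prod_congr rfl fun k hk => ?_
    have := Finset.mem_range.mp hk
    rw [Function.update_of_ne (by omega), Function.update_of_ne (by omega)]
  rw [h3] at h1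
  rw [pathEvent, pathEvent, h1, h2]
  split_ifs <;> simp

theorem integrable_gegenbauer [IsProbabilityMeasure P] {p : ℕ → ℕ → ℝ}
    (h : IsMarkovChainFrom p x S P) (hα : -1 / 2 ≤ α) {t : ℝ} (ht : t ∈ Set.Icc (-1 : ℝ) 1)
    (n : ℕ) : Integrable (fun ω => (gegenbauer α (S n ω)).eval t) P := by
  refine Integrable.of_bound ((measurable_of_countable
    (fun k => (gegenbauer α k).eval t)).comp (h.measurable n)).aestronglyMeasurable 1 ?_
  exact ae_of_all _ fun ω => abs_gegenbauer_le_one hα _ ht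

/-- Iteration of the eigenfunction relation. Restricting to path events makes the induction close:
fixing the next state turns a path event into a longer one. -/
theorem setIntegral_pathEvent_gegenbauer [IsProbabilityMeasure P]
    (h : IsMarkovChainFrom (gegenbauerTransition α hα' μ) x S P) (hα : -1 / 2 ≤ α) {t : ℝ}
    (ht : t ∈ Set.Icc (-1 : ℝ) 1) (m : ℕ) : ∀ (n : ℕ) (s : ℕ → ℕ),
    ∫ ω in pathEvent S n s, (gegenbauer α (S (n + m) ω)).eval t ∂P =
      P.real (pathEvent S n s) * ((gegenbauer α (s n)).eval t * gegenbauerTransform α μ t ^ m) := by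
  induction m with
  | zero =>
    intro n s
    rw [setIntegral_congr_fun (g := fun _ => (gegenbauer α (s n)).eval t)
      (h.measurableSet_pathEvent n s)
      (fun ω hω => by simp only [add_zero]; rw [hω n le_rfl])]
    simp
  | succ m ih =>
    intro n s
    have h1 := hasSum_setIntegral_inter_eq (h.measurableSet_pathEvent n s) (h.measurable (n + 1))
      (h.integrable_gegenbauer hα ht (n + (m + 1))).integrableOn
    have h2 := ((hasSum_gegenbauerTransition_mul hα hα' μ (s n) ht).mul_left
      (P.real (pathEvent S n s))).mul_right (gegenbauerTransform α μ t ^ m)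
    have h3 : ∀ u, ∫ ω in pathEvent S n s ∩ {ω | S (n + 1) ω = u},
        (gegenbauer α (S (n + (m + 1)) ω)).eval t ∂P =
        P.real (pathEvent S n s) * (gegenbauerTransition α hα' μ (s n) u *
          (gegenbauer α u).eval t) * gegenbauerTransform α μ t ^ m := fun u => by
      rw [pathEvent_inter, show n + (m + 1) = n + 1 + m by ring, ih,
        h.measureReal_pathEvent_update, Function.update_self]
      ring
    simp only [h3] at h1
    rw [h1.unique h2]
    ring

/-- The Markov property and spectral inversion together. The masses a_v of the joint events have the
known transform ∑ a_v P_v(t); integrating it against w_y P_y isolates a_y by orthogonality. The a_v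
are summable because the events are disjoint, which permits integration term by term. -/
theorem measureReal_pathEvent_inter [IsProbabilityMeasure P]
    (h : IsMarkovChainFrom (gegenbauerTransition α hα' μ) x S P) (hα : -1 / 2 ≤ α)
    (m n : ℕ) (s : ℕ → ℕ) (y : ℕ) :
    P.real (pathEvent S n s ∩ {ω | S (n + m) ω = y}) =
      P.real (pathEvent S n s) * spectralTransition α μ m (s n) y := by
  have := isFiniteMeasure_gegenbauerMeasure hα'
  have hA := h.measurableSet_pathEvent n s
  have hm : ∀ v, MeasurableSet (pathEvent S n s ∩ {ω | S (n + m) ω = v}) := fun v =>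
    hA.inter (h.measurable (n + m) (measurableSet_singleton v))
  set a : ℕ → ℝ := fun v => P.real (pathEvent S n s ∩ {ω | S (n + m) ω = v}) with ha
  have hsum : Summable a := by
    have h1 := hasSum_setIntegral_inter_eq (f := fun _ => (1 : ℝ)) hA (h.measurable (n + m))
      (integrable_const (μ := P) (1 : ℝ)).integrableOn
    simpa using h1.summable
  have h1 : ∀ t ∈ Set.Icc (-1 : ℝ) 1, HasSum (fun v => a v * (gegenbauer α v).eval t)
      (P.real (pathEvent S n s) *
        ((gegenbauer α (s n)).eval t * gegenbauerTransform α μ t ^ m)) := fun t ht => by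
    rw [← h.setIntegral_pathEvent_gegenbauer hα ht m n s]
    convert hasSum_setIntegral_inter_eq hA (h.measurable (n + m))
      (h.integrable_gegenbauer hα ht (n + m)).integrableOn using 2 with v
    rw [setIntegral_congr_fun (g := fun _ => (gegenbauer α v).eval t) (hm v)
      (fun ω hω => by
        have : S (n + m) ω = v := hω.2
        simp only [this])]
    simp [ha]
  have hint : ∀ v, Integrable (fun t => a v * (gegenbauer α v).eval t *
      (gegenbauerWeight α y * (gegenbauer α y).eval t)) (gegenbauerMeasure α) := fun v =>
    integrable_gegenbauerMeasure hα' (Continuous.continuousOn (by fun_prop))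
  have hb : ∀ v, ∫ t, ‖a v * (gegenbauer α v).eval t *
      (gegenbauerWeight α y * (gegenbauer α y).eval t)‖ ∂gegenbauerMeasure α ≤
      a v * (gegenbauerWeight α y * (gegenbauerMeasure α).real Set.univ) := fun v => by
    have h2 : ∫ _, a v * gegenbauerWeight α y ∂gegenbauerMeasure α =
        a v * (gegenbauerWeight α y * (gegenbauerMeasure α).real Set.univ) := by
      rw [integral_const, smul_eq_mul]
      ring
    rw [← h2]
    refine integral_mono_ae (hint v).norm (integrable_const _) ?_
    filter_upwards [ae_gegenbauerMeasure α] with t ht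
    have ht' : t ∈ Set.Icc (-1 : ℝ) 1 := ⟨ht.1.le, ht.2.le⟩
    have e1 := abs_gegenbauer_le_one hα v ht'
    have e2 := abs_gegenbauer_le_one hα y ht'
    have e3 := (gegenbauerWeight_pos hα y).le
    have e4 : 0 ≤ a v := measureReal_nonneg
    simp only [norm_mul, Real.norm_eq_abs, abs_of_nonneg e3, abs_of_nonneg e4]
    exact mul_le_mul (mul_le_of_le_one_right e4 e1) (mul_le_of_le_one_right e3 e2)
      (by positivity) e4
  have h3 := hasSum_integral_of_summable_integral_norm hint
    (Summable.of_nonneg_of_le (fun v => integral_nonneg fun t => norm_nonneg _) hb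
      (hsum.mul_right _))
  have h4 : ∀ v, ∫ t, a v * (gegenbauer α v).eval t *
      (gegenbauerWeight α y * (gegenbauer α y).eval t) ∂gegenbauerMeasure α =
      if v = y then a y else 0 := fun v => by
    have h5 := integral_gegenbauer_mul_gegenbauer hα v y
    have h6 : ∀ t, a v * (gegenbauer α v).eval t *
        (gegenbauerWeight α y * (gegenbauer α y).eval t) = (a v * gegenbauerWeight α y) *
        ((gegenbauer α v).eval t * (gegenbauer α y).eval t) := fun t => by ring
    simp only [h6]
    rw [integral_const_mul, mul_assoc, h5]
    split_ifs with hv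
    · rw [hv, mul_one]
    · rw [mul_zero]
  simp only [h4] at h3
  have h5 : HasSum (fun v => if v = y then a y else 0) (a y) := hasSum_ite_eq y (a y)
  rw [show P.real (pathEvent S n s ∩ {ω | S (n + m) ω = y}) = a y from rfl, h5.unique h3,
    spectralTransition, ← integral_const_mul, ← integral_const_mul]
  refine integral_congr_ae ?_
  filter_upwards [ae_gegenbauerMeasure α] with t ht
  rw [tsum_mul_right, (h1 t ⟨ht.1.le, ht.2.le⟩).tsum_eq]
  ring

/-- The case of the path event {S_0 = x}, which has probability 1. -/
theorem measureReal_eq [IsProbabilityMeasure P]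
    (h : IsMarkovChainFrom (gegenbauerTransition α hα' μ) x S P) (hα : -1 / 2 ≤ α) (m y : ℕ) :
    P.real {ω | S m ω = y} = spectralTransition α μ m x y := by
  have h1 : P.real (pathEvent S 0 fun _ => x) = 1 := by simpa [pathEvent] using h.law 0 fun _ => x
  have h2 := h.measureReal_pathEvent_inter hα m 0 (fun _ => x) y
  rw [h1, one_mul, zero_add] at h2
  rw [← h2, Set.inter_comm]
  refine (measureReal_congr (inter_ae_eq_left_of_ae_eq_univ ?_)).symm
  rw [eventuallyEq_univ, mem_ae_iff_prob_eq_one (h.measurableSet_pathEvent _ _)]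
  rw [Measure.real, ENNReal.toReal_eq_one_iff] at h1
  exact h1

/-- The Markov property at a fixed time at which the walk is at `y`, for functions of the past. -/
theorem integral_mul_indicator_eq [IsProbabilityMeasure P]
    (h : IsMarkovChainFrom (gegenbauerTransition α hα' μ) x S P) (hα : -1 / 2 ≤ α) (m n y : ℕ)
    {f : Ω → ℝ} (hf : Integrable f P)
    (hpast : ∀ ω ω', (∀ k ≤ n, S k ω = S k ω') → f ω = f ω')
    (hfy : ∀ ω, S n ω ≠ y → f ω = 0) :
    ∫ ω, f ω * Set.indicator {ω | S (n + m) ω = y} 1 ω ∂P =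
      spectralTransition α μ m y y * ∫ ω, f ω ∂P := by
  have hX : Measurable fun ω (i : Fin (n + 1)) => S i ω :=
    measurable_pi_lambda _ fun i => h.measurable i
  have hmeas : MeasurableSet {ω | S (n + m) ω = y} :=
    h.measurable (n + m) (measurableSet_singleton y)
  have hf' : Integrable (fun ω => f ω * Set.indicator {ω | S (n + m) ω = y} 1 ω) P := by
    refine hf.mul_bdd (c := 1) (aestronglyMeasurable_one.indicator hmeas) (ae_of_all _ fun ω => ?_)
    refine (norm_indicator_le_norm_self _ _).trans ?_
    simp
  have h1 := hasSum_setIntegral_inter_eq MeasurableSet.univ hX hf'.integrableOn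
  have h2 := (hasSum_setIntegral_inter_eq MeasurableSet.univ hX hf.integrableOn).mul_left
    (spectralTransition α μ m y y)
  simp only [Set.univ_inter, Measure.restrict_univ] at h1 h2
  refine (h1.unique (h2.congr_fun fun z => ?_))
  -- The past up to time n takes countably many values, so Ω splits into path events. On each of
  -- them f is constant, and it is zero unless the path ends at y.
  have hz : {ω | (fun i : Fin (n + 1) => S i ω) = z} =
      pathEvent S n fun k => if hk : k < n + 1 then z ⟨k, hk⟩ else 0 := by
    ext ω
    simp only [Set.mem_ofPred_eq, pathEvent, funext_iff]
    constructor
    · intro h k hk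
      rw [dif_pos (Nat.lt_succ_iff.mpr hk)]
      exact h ⟨k, Nat.lt_succ_iff.mpr hk⟩
    · intro h i
      have := h i (Nat.lt_succ_iff.mp i.2)
      rwa [dif_pos i.2] at this
  rw [hz]
  set s : ℕ → ℕ := fun k => if hk : k < n + 1 then z ⟨k, hk⟩ else 0
  have hA := h.measurableSet_pathEvent n s
  rcases Set.eq_empty_or_nonempty (pathEvent S n s) with h0 | ⟨ω₀, hω₀⟩
  · simp [h0]
  have hc : ∀ ω ∈ pathEvent S n s, f ω = f ω₀ := fun ω hω =>
    hpast ω ω₀ fun k hk => (hω k hk).trans (hω₀ k hk).symm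
  rw [setIntegral_congr_fun (g := fun ω => f ω₀ * Set.indicator {ω | S (n + m) ω = y} 1 ω) hA
      (fun ω hω => by simp only [hc ω hω]),
    setIntegral_congr_fun (g := fun _ => f ω₀) hA hc, integral_const_mul, setIntegral_const,
    setIntegral_indicator hmeas]
  simp only [Pi.one_apply, setIntegral_const, smul_eq_mul, mul_one]
  rw [h.measureReal_pathEvent_inter hα]
  by_cases hy : s n = y
  · rw [hy]
    ring
  · rw [hfy ω₀ (by rw [hω₀ n le_rfl]; exact hy)]
    ring

/-! ### The renewal equation for the local time -/

theorem measurable_localTime {p : ℕ → ℕ → ℝ} (h : IsMarkovChainFrom p x S P) (n y : ℕ) :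
    Measurable (localTime S n y) := by
  have : localTime S n y = fun ω => ∑ k ∈ Finset.range (n + 1), if S k ω = y then 1 else 0 := by
    ext ω
    rw [localTime, Finset.card_filter]
  rw [this]
  exact Finset.measurable_sum _ fun k _ => Measurable.ite
    (h.measurable k (measurableSet_singleton y)) measurable_const measurable_const

end IsMarkovChainFrom

/-- The number of visits to `y` strictly before time `n`. -/
def visitsBefore {Ω : Type*} (S : ℕ → Ω → ℕ) (y n : ℕ) (ω : Ω) : ℕ :=
  ((Finset.range n).filter fun k => S k ω = y).card

/-- Telescoping over visits: a visit at time k lowers z^(visits so far) by (1-z) z^(visits before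
k), and other times leave it unchanged. -/
theorem pow_visitsBefore {Ω : Type*} (S : ℕ → Ω → ℕ) (y : ℕ) (z : ℝ) (ω : Ω) : ∀ n : ℕ,
    z ^ visitsBefore S y n ω = 1 - (1 - z) * ∑ k ∈ Finset.range n,
      Set.indicator {ω | S k ω = y} (fun ω => z ^ visitsBefore S y k ω) ω
  | 0 => by simp [visitsBefore]
  | n + 1 => by
      have ih := pow_visitsBefore S y z ω n
      rw [Finset.sum_range_succ, mul_add, ← sub_sub, ← ih]
      simp only [visitsBefore, Finset.range_add_one, Finset.filter_insert, Set.indicator,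
        Set.mem_ofPred_eq]
      split_ifs
      · rw [Finset.card_insert_of_notMem (by simp), pow_succ]
        ring
      · ring

/-- The expectation of `z ^ (number of visits to y before n)` on the event of a visit at `n`. -/
noncomputable def visitMoment {Ω : Type*} [MeasurableSpace Ω] (P : Measure Ω) (S : ℕ → Ω → ℕ)
    (y : ℕ) (z : ℝ) (n : ℕ) : ℝ :=
  ∫ ω, Set.indicator {ω | S n ω = y} (fun ω => z ^ visitsBefore S y n ω) ω ∂P

namespace IsMarkovChainFrom

variable {Ω : Type*} [MeasurableSpace Ω] {α : ℝ} {hα' : -1 < α} {μ : PMF ℕ} {x : ℕ}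
  {S : ℕ → Ω → ℕ} {P : Measure Ω}

theorem measurable_visitsBefore {p : ℕ → ℕ → ℝ} (h : IsMarkovChainFrom p x S P) (y : ℕ) :
    ∀ n, Measurable (visitsBefore S y n)
  | 0 => measurable_const
  | n + 1 => h.measurable_localTime n y

theorem integrable_visit [IsProbabilityMeasure P] {p : ℕ → ℕ → ℝ}
    (h : IsMarkovChainFrom p x S P) {z : ℝ} (hz : z ∈ Set.Icc (0 : ℝ) 1) (y n : ℕ) :
    Integrable (Set.indicator {ω | S n ω = y} fun ω => z ^ visitsBefore S y n ω) P := by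
  refine Integrable.indicator ?_ (h.measurable n (measurableSet_singleton y))
  refine Integrable.of_bound ((measurable_of_countable fun k : ℕ => z ^ k).comp
    (h.measurable_visitsBefore y n)).aestronglyMeasurable 1 (ae_of_all _ fun ω => ?_)
  rw [Real.norm_eq_abs, abs_of_nonneg (pow_nonneg hz.1 _)]
  exact pow_le_one₀ hz.1 hz.2

theorem visitMoment_mem_Icc [IsProbabilityMeasure P] {p : ℕ → ℕ → ℝ}
    (h : IsMarkovChainFrom p x S P) {z : ℝ} (hz : z ∈ Set.Icc (0 : ℝ) 1) (y n : ℕ) :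
    visitMoment P S y z n ∈ Set.Icc (0 : ℝ) 1 := by
  refine ⟨integral_nonneg fun ω => Set.indicator_nonneg (fun _ _ => pow_nonneg hz.1 _) _, ?_⟩
  have h1 : ∫ _, (1 : ℝ) ∂P = 1 := by simp
  rw [← h1]
  refine integral_mono (h.integrable_visit hz y n) (integrable_const _) fun ω => ?_
  exact Set.indicator_le' (fun _ _ => pow_le_one₀ hz.1 hz.2) (fun _ _ => zero_le_one) ω

theorem integral_pow_localTime [IsProbabilityMeasure P] {p : ℕ → ℕ → ℝ}
    (h : IsMarkovChainFrom p x S P) {z : ℝ} (hz : z ∈ Set.Icc (0 : ℝ) 1) (y n : ℕ) :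
    ∫ ω, z ^ localTime S n y ω ∂P =
      1 - (1 - z) * ∑ k ∈ Finset.range (n + 1), visitMoment P S y z k := by
  -- Visits up to and including n are the visits strictly before n+1, hence the range n+1.
  have h1 : ∀ ω, z ^ localTime S n y ω = 1 - (1 - z) * ∑ k ∈ Finset.range (n + 1),
      Set.indicator {ω | S k ω = y} (fun ω => z ^ visitsBefore S y k ω) ω := fun ω =>
    pow_visitsBefore S y z ω (n + 1)
  simp only [h1]
  rw [integral_sub (integrable_const _) ((integrable_finsetSum _ fun k _ =>
    h.integrable_visit hz y k).const_mul _), integral_const_mul,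
    integral_finsetSum _ fun k _ => h.integrable_visit hz y k]
  simp [visitMoment]

/-- The renewal equation. On a visit at n, expand z^(visits before n) over the earlier visits k; the
chain is then at y at time k, so it restarts there and returns after n-k steps independently of the
past. -/
theorem visitMoment_eq [IsProbabilityMeasure P]
    (h : IsMarkovChainFrom (gegenbauerTransition α hα' μ) x S P) (hα : -1 / 2 ≤ α) {z : ℝ}
    (hz : z ∈ Set.Icc (0 : ℝ) 1) (y n : ℕ) :
    visitMoment P S y z n = spectralTransition α μ n x y - (1 - z) * ∑ k ∈ Finset.range n,
      visitMoment P S y z k * spectralTransition α μ (n - k) y y := by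
  have hmeas : MeasurableSet {ω | S n ω = y} := h.measurable n (measurableSet_singleton y)
  have hprod : ∀ k, Integrable (fun ω => Set.indicator {ω | S k ω = y}
      (fun ω => z ^ visitsBefore S y k ω) ω * Set.indicator {ω | S n ω = y} 1 ω) P := fun k => by
    refine (h.integrable_visit hz y k).mul_bdd (c := 1)
      (aestronglyMeasurable_one.indicator hmeas) (ae_of_all _ fun ω => ?_)
    refine (norm_indicator_le_norm_self _ _).trans ?_
    simp
  have h1 : ∀ ω, Set.indicator {ω | S n ω = y} (fun ω => z ^ visitsBefore S y n ω) ω =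
      Set.indicator {ω | S n ω = y} 1 ω - (1 - z) * ∑ k ∈ Finset.range n,
        Set.indicator {ω | S k ω = y} (fun ω => z ^ visitsBefore S y k ω) ω *
          Set.indicator {ω | S n ω = y} 1 ω := fun ω => by
    rw [← Finset.sum_mul]
    by_cases hω : S n ω = y
    · rw [Set.indicator_of_mem (by exact hω), Set.indicator_of_mem (by exact hω),
        pow_visitsBefore, Pi.one_apply, mul_one]
    · rw [Set.indicator_of_notMem (by exact hω), Set.indicator_of_notMem (by exact hω)]
      ring
  have h2 : ∀ k ∈ Finset.range n, ∫ ω, Set.indicator {ω | S k ω = y}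
      (fun ω => z ^ visitsBefore S y k ω) ω * Set.indicator {ω | S n ω = y} 1 ω ∂P =
      visitMoment P S y z k * spectralTransition α μ (n - k) y y := fun k hk => by
    have hkn : k + (n - k) = n := Nat.add_sub_of_le (Finset.mem_range.mp hk).le
    have h3 := h.integral_mul_indicator_eq hα (n - k) k y (h.integrable_visit hz y k)
      (fun ω ω' hω => ?_) (fun ω hω => Set.indicator_of_notMem (by exact hω) _)
    · rw [hkn] at h3
      rw [h3, mul_comm, visitMoment]
    · have h4 : visitsBefore S y k ω = visitsBefore S y k ω' := by
        rw [visitsBefore, visitsBefore]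
        congr 1
        exact Finset.filter_congr fun j hj => by rw [hω j (Finset.mem_range.mp hj).le]
      simp only [Set.indicator, Set.mem_ofPred_eq, hω k le_rfl, h4]
  rw [visitMoment]
  simp only [h1]
  have hone : Integrable (fun ω => Set.indicator {ω | S n ω = y} (1 : Ω → ℝ) ω) P :=
    (integrable_const (1 : ℝ)).indicator hmeas
  rw [integral_sub hone ((integrable_finsetSum _ fun k _ =>
    hprod k).const_mul _), integral_const_mul, integral_finsetSum _ fun k _ => hprod k,
    Finset.sum_congr rfl h2, ← h.measureReal_eq hα]
  congr 1
  exact integral_indicator_one hmeas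

end IsMarkovChainFrom

/-! ### The Green function -/

theorem abs_spectralTransition_le {α : ℝ} (hα : -1 / 2 ≤ α) (μ : PMF ℕ) (m u y : ℕ) :
    |spectralTransition α μ m u y| ≤
      gegenbauerWeight α y * (gegenbauerMeasure α).real Set.univ := by
  have := isFiniteMeasure_gegenbauerMeasure (by linarith : -1 < α)
  have hw := (gegenbauerWeight_pos hα y).le
  rw [spectralTransition, abs_mul, abs_of_nonneg hw]
  refine mul_le_mul_of_nonneg_left ?_ hw
  rw [← Real.norm_eq_abs, ← one_mul ((gegenbauerMeasure α).real Set.univ)]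
  refine norm_integral_le_of_norm_le_const ?_
  filter_upwards [ae_gegenbauerMeasure α] with t ht
  have ht' : t ∈ Set.Icc (-1 : ℝ) 1 := ⟨ht.1.le, ht.2.le⟩
  have e1 := abs_gegenbauer_le_one hα u ht'
  have e2 := abs_gegenbauer_le_one hα y ht'
  have e3 := abs_gegenbauerTransform_le_one hα μ ht'
  rw [norm_mul, norm_mul, norm_pow]
  exact mul_le_one₀ (mul_le_one₀ e1 (abs_nonneg _) e2) (by positivity)
    (pow_le_one₀ (abs_nonneg _) e3)

/-- The spectral expression of the Green function `∑_k r^k P_u(S_k = y)`. -/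
noncomputable def spectralGreen (α : ℝ) (μ : PMF ℕ) (r : ℝ) (u y : ℕ) : ℝ :=
  gegenbauerWeight α y * ∫ t, (gegenbauer α u).eval t * (gegenbauer α y).eval t /
    (1 - r * gegenbauerTransform α μ t) ∂gegenbauerMeasure α

theorem hasSum_spectralGreen {α : ℝ} (hα : -1 / 2 ≤ α) (μ : PMF ℕ) {r : ℝ}
    (hr : r ∈ Set.Ico (0 : ℝ) 1) (u y : ℕ) :
    HasSum (fun k => r ^ k * spectralTransition α μ k u y) (spectralGreen α μ r u y) := by
  have hα' : -1 < α := by linarith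
  have := isFiniteMeasure_gegenbauerMeasure hα'
  have hint : ∀ k : ℕ, Integrable (fun t => (gegenbauer α u).eval t * (gegenbauer α y).eval t *
      (r * gegenbauerTransform α μ t) ^ k) (gegenbauerMeasure α) := fun k =>
    integrable_gegenbauerMeasure hα' (ContinuousOn.mul (Continuous.continuousOn (by fun_prop))
      ((continuousOn_const.mul (continuousOn_gegenbauerTransform hα μ)).pow k))
  have hbound : ∀ t ∈ Set.Icc (-1 : ℝ) 1, |r * gegenbauerTransform α μ t| ≤ r := fun t ht => by
    rw [abs_mul, abs_of_nonneg hr.1]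
    exact mul_le_of_le_one_right hr.1 (abs_gegenbauerTransform_le_one hα μ ht)
  have h1 := hasSum_integral_of_summable_integral_norm hint
    (Summable.of_nonneg_of_le (fun k => integral_nonneg fun t => norm_nonneg _) (fun k => ?_)
      ((summable_geometric_of_lt_one hr.1 hr.2).mul_right ((gegenbauerMeasure α).real Set.univ)))
  · have h2 : spectralGreen α μ r u y = gegenbauerWeight α y * ∫ t, ∑' k : ℕ,
        (gegenbauer α u).eval t * (gegenbauer α y).eval t *
          (r * gegenbauerTransform α μ t) ^ k ∂gegenbauerMeasure α := by
      refine congrArg (gegenbauerWeight α y * ·) (integral_congr_ae ?_)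
      filter_upwards [ae_gegenbauerMeasure α] with t ht
      have hb := (hbound t ⟨ht.1.le, ht.2.le⟩).trans_lt hr.2
      rw [tsum_mul_left, tsum_geometric_of_abs_lt_one hb, div_eq_mul_inv]
    rw [h2]
    refine (h1.mul_left (gegenbauerWeight α y)).congr_fun fun k => ?_
    rw [spectralTransition, mul_left_comm, ← integral_const_mul (r ^ k)]
    refine congrArg (gegenbauerWeight α y * ·) (integral_congr_ae (ae_of_all _ fun t => ?_))
    simp only [mul_pow]
    ring
  · have h2 : ∫ _, r ^ k ∂gegenbauerMeasure α =
        r ^ k * (gegenbauerMeasure α).real Set.univ := by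
      rw [integral_const, smul_eq_mul, mul_comm]
    rw [← h2]
    refine integral_mono_ae (hint k).norm (integrable_const _) ?_
    filter_upwards [ae_gegenbauerMeasure α] with t ht
    have ht' : t ∈ Set.Icc (-1 : ℝ) 1 := ⟨ht.1.le, ht.2.le⟩
    have e1 := abs_gegenbauer_le_one hα u ht'
    have e2 := abs_gegenbauer_le_one hα y ht'
    simp only [norm_mul, norm_pow, Real.norm_eq_abs]
    rw [← abs_mul r]
    exact (mul_le_mul (mul_le_one₀ e1 (abs_nonneg _) e2) (pow_le_pow_left₀ (abs_nonneg _)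
      (hbound t ht') k) (by positivity) zero_le_one).trans_eq (one_mul _)

theorem spectralGreen_self_nonneg {α : ℝ} (hα : -1 / 2 ≤ α) (μ : PMF ℕ) {r : ℝ}
    (hr : r ∈ Set.Ico (0 : ℝ) 1) (y : ℕ) : 0 ≤ spectralGreen α μ r y y := by
  refine mul_nonneg (gegenbauerWeight_pos hα y).le (integral_nonneg_of_ae ?_)
  filter_upwards [ae_gegenbauerMeasure α] with t ht
  have e := (abs_le.mp (abs_gegenbauerTransform_le_one hα μ ⟨ht.1.le, ht.2.le⟩)).2
  have : r * gegenbauerTransform α μ t ≤ r := mul_le_of_le_one_right hr.1 e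
  exact div_nonneg (mul_self_nonneg _) (by linarith [hr.2])

/-- The generating function of the Laplace transforms of the local times. -/
theorem IsMarkovChainFrom.hasSum_integral_pow_localTime {Ω : Type*} [MeasurableSpace Ω] {α : ℝ}
    {hα' : -1 < α} {μ : PMF ℕ} {x : ℕ} {S : ℕ → Ω → ℕ} {P : Measure Ω} [IsProbabilityMeasure P]
    (h : IsMarkovChainFrom (gegenbauerTransition α hα' μ) x S P) (hα : -1 / 2 ≤ α)
    {z r : ℝ} (hz : z ∈ Set.Ioc (0 : ℝ) 1) (hr : r ∈ Set.Ico (0 : ℝ) 1) (y : ℕ) :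
    HasSum (fun n => r ^ n * (1 - ∫ ω, z ^ localTime S n y ω ∂P))
      ((1 - z) * spectralGreen α μ r x y /
        (z + (1 - z) * spectralGreen α μ r y y) / (1 - r)) := by
  have hz' : z ∈ Set.Icc (0 : ℝ) 1 := ⟨hz.1.le, hz.2⟩
  have hgeom := summable_geometric_of_lt_one hr.1 hr.2
  set b := visitMoment P S y z
  have hb : ∀ n, b n ∈ Set.Icc (0 : ℝ) 1 := h.visitMoment_mem_Icc hz' y
  have hbs : Summable fun n => ‖r ^ n * b n‖ := by
    refine Summable.of_nonneg_of_le (fun _ => norm_nonneg _) (fun n => ?_) hgeom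
    rw [norm_mul, Real.norm_eq_abs, Real.norm_eq_abs, abs_of_nonneg (hb n).1,
      abs_of_nonneg (pow_nonneg hr.1 n)]
    exact mul_le_of_le_one_right (pow_nonneg hr.1 n) (hb n).2
  have hgs : Summable fun n => ‖r ^ n‖ := by
    simpa only [norm_pow, Real.norm_eq_abs, abs_of_nonneg hr.1] using hgeom
  have hqs : Summable fun n => ‖r ^ n * spectralTransition α μ n y y‖ := by
    refine Summable.of_nonneg_of_le (fun _ => norm_nonneg _) (fun n => ?_)
      (hgeom.mul_right (gegenbauerWeight α y * (gegenbauerMeasure α).real Set.univ))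
    rw [norm_mul, norm_pow, Real.norm_eq_abs, abs_of_nonneg hr.1]
    exact mul_le_mul_of_nonneg_left (abs_spectralTransition_le hα μ n y y) (pow_nonneg hr.1 n)
  have hq0 : spectralTransition α μ 0 y y = 1 := by
    have := integral_gegenbauer_mul_gegenbauer hα y y
    simpa [spectralTransition] using this
  -- The renewal equation as a full convolution. Since the 0-step return probability is 1, the term
  -- k = n can be included in the sum, which changes the coefficient of b_n outside it from 1 to z.
  have hconv : ∀ n, z * (r ^ n * b n) + (1 - z) * ∑ k ∈ Finset.range (n + 1),
      (r ^ k * b k) * (r ^ (n - k) * spectralTransition α μ (n - k) y y) =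
      r ^ n * spectralTransition α μ n x y := fun n => by
    have h1 := h.visitMoment_eq hα hz' y n
    have h2 : ∑ k ∈ Finset.range (n + 1),
        (r ^ k * b k) * (r ^ (n - k) * spectralTransition α μ (n - k) y y) =
        r ^ n * (∑ k ∈ Finset.range n, b k * spectralTransition α μ (n - k) y y + b n) := by
      rw [mul_add, Finset.sum_range_succ, Finset.mul_sum, Nat.sub_self, hq0]
      congr 1
      · refine Finset.sum_congr rfl fun k hk => ?_
        rw [← Nat.add_sub_of_le (Finset.mem_range.mp hk).le, pow_add]
        rw [Nat.add_sub_cancel_left]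
        ring
      · ring
    rw [h2]
    have h3 : b n = spectralTransition α μ n x y - (1 - z) * ∑ k ∈ Finset.range n,
      b k * spectralTransition α μ (n - k) y y := h1
    linear_combination r ^ n * h3
  have hG := hasSum_spectralGreen hα μ hr x y
  have hGy := hasSum_spectralGreen hα μ hr y y
  have hc1 := tsum_mul_tsum_eq_tsum_sum_range_of_summable_norm hbs hqs
  have hc1s := (summable_norm_sum_mul_range_of_summable_norm hbs hqs).of_norm
  have hB : (∑' n, r ^ n * b n) * (z + (1 - z) * spectralGreen α μ r y y) =
      spectralGreen α μ r x y := by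
    have h1 := (hbs.of_norm.hasSum.mul_left z).add (hc1s.hasSum.mul_left (1 - z))
    rw [← hc1, hGy.tsum_eq] at h1
    simp only [hconv] at h1
    rw [hG.unique h1]
    ring
  have hden : 0 < z + (1 - z) * spectralGreen α μ r y y :=
    add_pos_of_pos_of_nonneg hz.1
      (mul_nonneg (sub_nonneg.mpr hz.2) (spectralGreen_self_nonneg hα μ hr y))
  -- Multiplication by the geometric series 1/(1-r) produces the partial sums of b that express 1 -
  -- E z^{N_n}.
  have hc2 := tsum_mul_tsum_eq_tsum_sum_range_of_summable_norm hbs hgs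
  have hc2s := (summable_norm_sum_mul_range_of_summable_norm hbs hgs).of_norm
  have h1 := hc2s.hasSum.mul_left (1 - z)
  rw [← hc2, tsum_geometric_of_lt_one hr.1 hr.2, ← eq_div_iff hden.ne' |>.mpr hB |>.symm] at h1
  rw [div_eq_mul_inv _ (1 - r), mul_div_assoc, mul_assoc]
  refine h1.congr_fun fun n => ?_
  rw [h.integral_pow_localTime hz', sub_sub_cancel, mul_left_comm, Finset.mul_sum]
  congr 1
  refine Finset.sum_congr rfl fun k hk => ?_
  nth_rewrite 1 [← Nat.add_sub_of_le (Nat.lt_succ_iff.mp (Finset.mem_range.mp hk))]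
  rw [pow_add]
  ring

/-! ### Singular integrals -/

/-- Write 1/(1+cu) as ∫ e^{-(1+cu)v} dv over v > 0 and exchange the integrals; both become Gamma
integrals. Positivity of the inner value also yields the integrability needed for Fubini. -/
theorem integral_rpow_div_one_add_mul {a c : ℝ} (ha : -1 < a) (ha0 : a < 0) (hc : 0 < c) :
    ∫ u in Set.Ioi (0 : ℝ), u ^ a / (1 + c * u) =
      c ^ (-a - 1) * (Real.Gamma (a + 1) * Real.Gamma (-a)) := by
  let f : ℝ → ℝ → ℝ := fun u v => u ^ a * Real.exp (-((1 + c * u) * v))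
  have hu : ∀ v ∈ Set.Ioi (0 : ℝ), ∫ u in Set.Ioi (0 : ℝ), f u v =
      c ^ (-a - 1) * Real.Gamma (a + 1) * (v ^ (-a - 1) * Real.exp (-(1 * v))) := fun v hv => by
    have h1 := Real.integral_rpow_mul_exp_neg_mul_Ioi (a := a + 1) (r := c * v) (by linarith)
      (mul_pos hc hv)
    rw [add_sub_cancel_right] at h1
    have h2 : ∀ u, f u v = Real.exp (-(1 * v)) * (u ^ a * Real.exp (-(c * v * u))) := fun u => by
      simp only [f]
      rw [mul_left_comm, ← Real.exp_add]
      ring_nf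
    simp only [h2]
    rw [integral_const_mul, h1, one_div, Real.inv_rpow (mul_pos hc hv).le,
      ← Real.rpow_neg (mul_pos hc hv).le, Real.mul_rpow hc.le (le_of_lt hv), neg_add']
    ring
  have hv : ∀ u ∈ Set.Ioi (0 : ℝ), ∫ v in Set.Ioi (0 : ℝ), f u v = u ^ a / (1 + c * u) :=
    fun u hu => by
      have h0 : 0 < 1 + c * u := by have := mul_pos hc hu; linarith
      have h1 := integral_exp_mul_Ioi (neg_lt_zero.mpr h0) 0
      simp only [f, integral_const_mul]
      simp only [neg_mul] at h1
      rw [h1, mul_zero, neg_zero, Real.exp_zero, neg_div_neg_eq, mul_one_div]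
  have hpos : ∀ u ∈ Set.Ioi (0 : ℝ), ∀ v, 0 ≤ f u v := fun u hu v =>
    mul_nonneg (Real.rpow_nonneg (le_of_lt hu) _) (Real.exp_pos _).le
  have hG1 := Real.Gamma_pos_of_pos (by linarith : 0 < a + 1)
  have hint : Integrable (Function.uncurry f)
      ((volume.restrict (Set.Ioi 0)).prod (volume.restrict (Set.Ioi 0))) := by
    rw [integrable_prod_iff' (by simp only [f, Function.uncurry_def]; fun_prop)]
    constructor
    · filter_upwards [ae_restrict_mem measurableSet_Ioi] with v hv
      refine Integrable.of_integral_ne_zero ?_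
      simp only [Function.uncurry]
      rw [hu v hv]
      have : 0 < v ^ (-a - 1) := Real.rpow_pos_of_pos hv _
      positivity
    · have h1 : IntegrableOn (fun v => c ^ (-a - 1) * Real.Gamma (a + 1) *
          (v ^ (-a - 1) * Real.exp (-(1 * v)))) (Set.Ioi 0) := by
        have := (Real.GammaIntegral_convergent (neg_pos.mpr ha0)).const_mul
          (c ^ (-a - 1) * Real.Gamma (a + 1))
        simpa only [IntegrableOn, one_mul, mul_comm (Real.exp _)] using this
      refine h1.congr ?_
      filter_upwards [ae_restrict_mem measurableSet_Ioi] with v hv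
      rw [← hu v hv]
      refine setIntegral_congr_fun measurableSet_Ioi fun u hu => ?_
      exact (Real.norm_of_nonneg (hpos u hu v)).symm
  have h := integral_integral_swap hint
  rw [setIntegral_congr_fun measurableSet_Ioi hv, setIntegral_congr_fun measurableSet_Ioi hu,
    integral_const_mul, Real.integral_rpow_mul_exp_neg_mul_Ioi (neg_pos.mpr ha0) one_pos] at h
  rw [h]
  simp [mul_assoc]

theorem integrableOn_rpow_div_one_add_mul {a c : ℝ} (ha : -1 < a) (ha0 : a < 0) (hc : 0 < c) :
    IntegrableOn (fun u : ℝ => u ^ a / (1 + c * u)) (Set.Ioi 0) := by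
  refine Integrable.of_integral_ne_zero ?_
  rw [integral_rpow_div_one_add_mul ha ha0 hc]
  have := Real.Gamma_pos_of_pos (by linarith : 0 < a + 1)
  have := Real.Gamma_pos_of_pos (neg_pos.mpr ha0)
  positivity

theorem aestronglyMeasurable_indicator_of_continuousOn {s t : Set ℝ} (hs : MeasurableSet s)
    {f : ℝ → ℝ} (hf : ContinuousOn f s) :
    AEStronglyMeasurable (s.indicator f) (volume.restrict t) :=
  ((aestronglyMeasurable_indicator_iff hs).mpr (hf.aestronglyMeasurable hs)).restrict

/-- Behaviour as `ε → 0` of an integral whose integrand has a simple pole at distance `ε` and an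
algebraic singularity. -/
theorem tendsto_rpow_mul_integral {a κ D H h₀ : ℝ} {h g : ℝ → ℝ} (ha : -1 < a) (ha0 : a < 0)
    (hκ : 0 < κ) (hD : 0 < D) (hh : ContinuousOn h (Set.Ioo 0 1))
    (hg : ContinuousOn g (Set.Ioo 0 1)) (hH : ∀ v ∈ Set.Ioo (0 : ℝ) 1, |h v| ≤ H)
    (hgκ : ∀ v ∈ Set.Ioo (0 : ℝ) 1, κ * v ≤ g v) (hh0 : Tendsto h (𝓝[>] 0) (𝓝 h₀))
    (hg0 : Tendsto (fun v => g v / v) (𝓝[>] 0) (𝓝 D)) :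
    Tendsto (fun ε => ε ^ (-a) * ∫ v in Set.Ioo (0 : ℝ) 1, v ^ a * (h v / (ε + (1 - ε) * g v)))
      (𝓝[>] 0) (𝓝 (h₀ * (D ^ (-a - 1) * (Real.Gamma (a + 1) * Real.Gamma (-a))))) := by
  have hH0 : 0 ≤ H := (abs_nonneg _).trans (hH (1 / 2) (by norm_num))
  rw [← integral_rpow_div_one_add_mul ha ha0 hD, ← integral_const_mul]
  -- The integrand after the substitution v = εu, with the powers of ε cancelled: it lives on (0,
  -- 1/ε) and converges pointwise to h₀ u^a / (1 + Du).
  let F : ℝ → ℝ → ℝ := fun ε u => u ^ a * (h (ε * u) / (1 + (1 - ε) * (g (ε * u) / ε)))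
  have hsmall : ∀ᶠ ε : ℝ in 𝓝[>] 0, ε ∈ Set.Ioo (0 : ℝ) (1 / 2) := Ioo_mem_nhdsGT (by norm_num)
  have hmaps : ∀ ε : ℝ, 0 < ε → ∀ u ∈ Set.Ioo (0 : ℝ) (1 / ε), ε * u ∈ Set.Ioo (0 : ℝ) 1 :=
    fun ε hε u hu => ⟨mul_pos hε hu.1, by
      have := mul_lt_mul_of_pos_left hu.2 hε
      rwa [mul_one_div_cancel hε.ne'] at this⟩
  -- The constant κ/2 comes from 1-ε ≥ 1/2. The resulting denominator gives a dominating function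
  -- independent of ε.
  have hden : ∀ ε ∈ Set.Ioo (0 : ℝ) (1 / 2), ∀ u ∈ Set.Ioo (0 : ℝ) (1 / ε),
      1 + κ / 2 * u ≤ 1 + (1 - ε) * (g (ε * u) / ε) := fun ε hε u hu => by
    have h1 := hgκ _ (hmaps ε hε.1 u hu)
    have h2 : κ * u ≤ g (ε * u) / ε := by
      rw [le_div_iff₀ hε.1]
      linarith
    have h3 := mul_pos hκ hu.1
    nlinarith [hε.2]
  have hcont : ∀ ε ∈ Set.Ioo (0 : ℝ) (1 / 2), ContinuousOn (F ε) (Set.Ioo 0 (1 / ε)) :=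
    fun ε hε => by
      have hc : ContinuousOn (fun u : ℝ => ε * u) (Set.Ioo 0 (1 / ε)) := by fun_prop
      have hm : Set.MapsTo (fun u : ℝ => ε * u) (Set.Ioo 0 (1 / ε)) (Set.Ioo 0 1) := hmaps ε hε.1
      refine ContinuousOn.mul (ContinuousOn.rpow_const continuousOn_id fun u hu =>
        Or.inl (ne_of_gt hu.1)) (ContinuousOn.div (hh.comp hc hm)
        (continuousOn_const.add (continuousOn_const.mul ((hg.comp hc hm).div_const ε)))
        fun u hu => ?_)
      have h1 := hden ε hε u hu
      have h2 := mul_pos (half_pos hκ) hu.1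
      exact (lt_of_lt_of_le (by linarith) h1).ne'
  have key : Tendsto (fun ε => ∫ u in Set.Ioi (0 : ℝ), (Set.Ioo 0 (1 / ε)).indicator (F ε) u)
      (𝓝[>] 0) (𝓝 (∫ u in Set.Ioi (0 : ℝ), h₀ * (u ^ a / (1 + D * u)))) := by
    refine tendsto_integral_filter_of_dominated_convergence
      (fun u => H * (u ^ a / (1 + κ / 2 * u))) ?_ ?_
      ((integrableOn_rpow_div_one_add_mul ha ha0 (half_pos hκ)).const_mul H) ?_
    · filter_upwards [hsmall] with ε hε
      exact aestronglyMeasurable_indicator_of_continuousOn measurableSet_Ioo (hcont ε hε)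
    · filter_upwards [hsmall] with ε hε
      filter_upwards [ae_restrict_mem measurableSet_Ioi] with u hu
      have hu0 : 0 < u := hu
      have hd0 : 0 < 1 + κ / 2 * u := by positivity
      by_cases hmem : u ∈ Set.Ioo (0 : ℝ) (1 / ε)
      · rw [Set.indicator_of_mem hmem]
        have h1 := hden ε hε u hmem
        simp only [F, norm_mul, norm_div, Real.norm_eq_abs]
        rw [abs_of_nonneg (Real.rpow_nonneg hu0.le a), abs_of_pos (hd0.trans_le h1),
          mul_div_left_comm H]
        refine mul_le_mul_of_nonneg_left ?_ (Real.rpow_nonneg hu0.le a)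
        exact div_le_div₀ hH0 (hH _ (hmaps ε hε.1 u hmem)) hd0 h1
      · rw [Set.indicator_of_notMem hmem, norm_zero]
        have := Real.rpow_nonneg hu0.le a
        positivity
    · filter_upwards [ae_restrict_mem measurableSet_Ioi] with u hu
      have hu0 : 0 < u := hu
      have hε0 : Tendsto (fun ε : ℝ => ε) (𝓝[>] 0) (𝓝 0) :=
        tendsto_nhdsWithin_of_tendsto_nhds tendsto_id
      have hεu : Tendsto (fun ε : ℝ => ε * u) (𝓝[>] 0) (𝓝[>] 0) := by
        refine tendsto_nhdsWithin_iff.mpr ⟨by simpa using hε0.mul_const u, ?_⟩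
        filter_upwards [self_mem_nhdsWithin] with ε hε using mul_pos hε hu0
      have h1 : Tendsto (fun ε => g (ε * u) / ε) (𝓝[>] 0) (𝓝 (D * u)) := by
        refine ((hg0.comp hεu).mul_const u).congr' ?_
        filter_upwards [self_mem_nhdsWithin] with ε hε
        have hε' : ε ≠ 0 := ne_of_gt hε
        simp only [Function.comp]
        field_simp
      have h2 : Tendsto (fun ε => F ε u) (𝓝[>] 0)
          (𝓝 (u ^ a * (h₀ / (1 + (1 - 0) * (D * u))))) :=
        ((hh0.comp hεu).div (tendsto_const_nhds.add ((tendsto_const_nhds.sub hε0).mul h1))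
          (by have := mul_pos hD hu0; linarith)).const_mul _
      rw [sub_zero, one_mul, mul_div_left_comm] at h2
      refine h2.congr' ?_
      have hlt : ∀ᶠ ε : ℝ in 𝓝[>] 0, ε ∈ Set.Ioo (0 : ℝ) (1 / u) := Ioo_mem_nhdsGT (by positivity)
      filter_upwards [hlt] with ε hε
      rw [Set.indicator_of_mem]
      exact ⟨hu0, (lt_one_div hε.1 hu0).mp hε.2⟩
  refine key.congr' ?_
  filter_upwards [hsmall] with ε hε
  have hε0 := hε.1
  rw [setIntegral_indicator measurableSet_Ioo,
    Set.inter_eq_self_of_subset_right (fun u hu => hu.1),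
    ← integral_Ioc_eq_integral_Ioo, ← integral_Ioc_eq_integral_Ioo,
    ← intervalIntegral.integral_of_le (by positivity),
    ← intervalIntegral.integral_of_le zero_le_one]
  have h1 := intervalIntegral.integral_comp_mul_left (a := 0) (b := 1 / ε)
    (fun v => v ^ a * (h v / (ε + (1 - ε) * g v))) hε0.ne'
  rw [mul_zero, mul_one_div_cancel hε0.ne', smul_eq_mul, eq_inv_mul_iff_mul_eq₀ hε0.ne'] at h1
  rw [← h1, ← intervalIntegral.integral_const_mul, ← intervalIntegral.integral_const_mul]
  refine intervalIntegral.integral_congr_ae (ae_of_all _ fun u hu => ?_)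
  rw [Set.uIoc_of_le (by positivity)] at hu
  have e1 : (ε * u) ^ a = ε ^ a * u ^ a := Real.mul_rpow hε0.le hu.1.le
  have e2 : ε ^ (-a) * ε ^ a = 1 := by rw [← Real.rpow_add hε0]; simp
  have e3 : ε + (1 - ε) * g (ε * u) = ε * (1 + (1 - ε) * (g (ε * u) / ε)) := by field_simp
  simp only [F]
  rw [e1, e3, div_mul_eq_div_div]
  calc _ = (ε ^ (-a) * ε ^ a) * u ^ a * ((ε * (h (ε * u) / ε)) /
        (1 + (1 - ε) * (g (ε * u) / ε))) := by rw [e2, one_mul, mul_div_cancel₀ _ hε0.ne']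
    _ = _ := by ring

/-- The logarithmic case of `tendsto_rpow_mul_integral`. -/
theorem tendsto_integral_div_log {κ D H h₀ : ℝ} {h g : ℝ → ℝ}
    (hκ : 0 < κ) (hD : 0 < D) (hh : ContinuousOn h (Set.Ioo 0 1))
    (hg : ContinuousOn g (Set.Ioo 0 1)) (hH : ∀ v ∈ Set.Ioo (0 : ℝ) 1, |h v| ≤ H)
    (hgκ : ∀ v ∈ Set.Ioo (0 : ℝ) 1, κ * v ≤ g v) (hh0 : Tendsto h (𝓝[>] 0) (𝓝 h₀))
    (hg0 : Tendsto (fun v => g v / v) (𝓝[>] 0) (𝓝 D)) :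
    Tendsto (fun ε => (∫ v in Set.Ioo (0 : ℝ) 1, h v / (ε + (1 - ε) * g v)) / (-Real.log ε))
      (𝓝[>] 0) (𝓝 (h₀ / D)) := by
  have hH0 : 0 ≤ H := (abs_nonneg _).trans (hH (1 / 2) (by norm_num))
  have hlim : ∫ s in Set.Ioi (0 : ℝ), (Set.Iio 1).indicator (fun _ => h₀ / D) s = h₀ / D := by
    rw [setIntegral_indicator measurableSet_Iio, Set.Ioi_inter_Iio, setIntegral_const]
    simp
  rw [← hlim]
  -- The substitution v = ε^s, whose Jacobian absorbs the factor -log ε. For s < 1 the scale v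
  -- dominates ε and the integrand tends to h₀/D; for s > 1 the term ε dominates and the limit is 0.
  -- Hence the limit is h₀/D times the indicator of s < 1.
  let e : ℝ → ℝ → ℝ := fun ε s => Real.exp (Real.log ε * s)
  let F : ℝ → ℝ → ℝ := fun ε s => e ε s * (h (e ε s) / (ε + (1 - ε) * g (e ε s)))
  -- The bound 1/3 is below 1/e, so that log ε ≤ -1 and ε^{s-1} ≤ e^{1-s} for s ≥ 1.
  have hsmall : ∀ᶠ ε : ℝ in 𝓝[>] 0, ε ∈ Set.Ioo (0 : ℝ) (1 / 3) := Ioo_mem_nhdsGT (by norm_num)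
  have hlog : ∀ ε ∈ Set.Ioo (0 : ℝ) (1 / 3), Real.log ε ≤ -1 := fun ε hε => by
    rw [Real.log_le_iff_le_exp hε.1, Real.exp_neg, ← one_div]
    exact hε.2.le.trans (one_div_le_one_div_of_le (Real.exp_pos 1)
      (Real.exp_one_lt_d9.le.trans (by norm_num)))
  have hmaps : ∀ ε ∈ Set.Ioo (0 : ℝ) (1 / 3), ∀ s ∈ Set.Ioi (0 : ℝ), e ε s ∈ Set.Ioo (0 : ℝ) 1 :=
    fun ε hε s hs => ⟨Real.exp_pos _, by
      have h1 := hlog ε hε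
      have hs' : 0 < s := hs
      simp only [e]
      rw [Real.exp_lt_one_iff]
      nlinarith⟩
  have hden : ∀ ε ∈ Set.Ioo (0 : ℝ) (1 / 3), ∀ s ∈ Set.Ioi (0 : ℝ),
      ε + κ / 2 * e ε s ≤ ε + (1 - ε) * g (e ε s) := fun ε hε s hs => by
    have h0 := hmaps ε hε s hs
    have h1 := hgκ _ h0
    have h3 := mul_pos hκ h0.1
    nlinarith [hε.2]
  have hden0 : ∀ ε ∈ Set.Ioo (0 : ℝ) (1 / 3), ∀ s ∈ Set.Ioi (0 : ℝ),
      0 < ε + κ / 2 * e ε s := fun ε hε s hs =>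
    add_pos hε.1 (mul_pos (half_pos hκ) (Real.exp_pos _))
  have key : Tendsto (fun ε => ∫ s in Set.Ioi (0 : ℝ), F ε s)
      (𝓝[>] 0) (𝓝 (∫ s in Set.Ioi (0 : ℝ), (Set.Iio 1).indicator (fun _ => h₀ / D) s)) := by
    refine tendsto_integral_filter_of_dominated_convergence
      (fun s => H * (max (2 / κ) 1 * Real.exp 1 * Real.exp (-1 * s))) ?_ ?_
      (((exp_neg_integrableOn_Ioi 0 one_pos).const_mul _).const_mul H) ?_
    · filter_upwards [hsmall] with ε hε
      have hc : ContinuousOn (e ε) (Set.Ioi 0) := by simp only [e]; fun_prop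
      have hm : Set.MapsTo (e ε) (Set.Ioi 0) (Set.Ioo 0 1) := hmaps ε hε
      refine ContinuousOn.aestronglyMeasurable (hc.mul (ContinuousOn.div (hh.comp hc hm)
        (continuousOn_const.add (continuousOn_const.mul (hg.comp hc hm))) fun s hs => ?_))
        measurableSet_Ioi
      exact ((hden0 ε hε s hs).trans_le (hden ε hε s hs)).ne'
    · filter_upwards [hsmall] with ε hε
      filter_upwards [ae_restrict_mem measurableSet_Ioi] with s hs
      have he0 : 0 < e ε s := Real.exp_pos _
      -- For s ≤ 1 keep only the pole term of the denominator, which gives 2/κ; for s ≥ 1 keep only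
      -- ε, which gives ε^{s-1}. Both are at most max(2/κ, 1) e^{1-s}.
      have h1 : e ε s / (ε + (1 - ε) * g (e ε s)) ≤
          max (2 / κ) 1 * Real.exp 1 * Real.exp (-1 * s) := by
        have h2 : e ε s / (ε + (1 - ε) * g (e ε s)) ≤ e ε s / (ε + κ / 2 * e ε s) :=
          div_le_div_of_nonneg_left he0.le (hden0 ε hε s hs) (hden ε hε s hs)
        refine h2.trans ?_
        rw [mul_assoc, ← Real.exp_add]
        rcases le_total s 1 with h3 | h3
        · have h4 : e ε s / (ε + κ / 2 * e ε s) ≤ 2 / κ := by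
            rw [div_le_div_iff₀ (hden0 ε hε s hs) hκ]
            nlinarith [hε.1]
          have h5 : 1 ≤ Real.exp (1 + -1 * s) := Real.one_le_exp (by linarith)
          have h6 : 2 / κ ≤ max (2 / κ) 1 := le_max_left _ _
          have h7 : 0 < 2 / κ := by positivity
          nlinarith
        · have h4 : e ε s / (ε + κ / 2 * e ε s) ≤ Real.exp (1 + -1 * s) := by
            rw [div_le_iff₀ (hden0 ε hε s hs)]
            have h5 : e ε s ≤ Real.exp (1 + -1 * s) * ε := by
              nth_rewrite 2 [← Real.exp_log hε.1]
              rw [← Real.exp_add]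
              refine Real.exp_le_exp.mpr ?_
              nlinarith [hlog ε hε]
            have h6 : 0 ≤ Real.exp (1 + -1 * s) * (κ / 2 * e ε s) := by positivity
            linarith
          exact h4.trans (le_mul_of_one_le_left (Real.exp_pos _).le (le_max_right _ _))
      have h8 : 0 < ε + (1 - ε) * g (e ε s) := (hden0 ε hε s hs).trans_le (hden ε hε s hs)
      simp only [F, norm_mul, norm_div, Real.norm_eq_abs]
      rw [abs_of_pos he0, abs_of_pos h8, mul_div_left_comm]
      exact mul_le_mul (hH _ (hmaps ε hε s hs)) h1 (by positivity) hH0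
    · have hne : ∀ᵐ s : ℝ ∂volume.restrict (Set.Ioi 0), s ≠ 1 :=
        ae_restrict_of_ae (by simp [ae_iff])
      filter_upwards [ae_restrict_mem measurableSet_Ioi, hne] with s hs hs1
      have hs0 : 0 < s := hs
      have hε0 : Tendsto (fun ε : ℝ => ε) (𝓝[>] 0) (𝓝 0) :=
        tendsto_nhdsWithin_of_tendsto_nhds tendsto_id
      have he0 : ∀ c : ℝ, 0 < c → Tendsto (fun ε : ℝ => Real.exp (Real.log ε * c)) (𝓝[>] 0) (𝓝 0) :=
        fun c hc => Real.tendsto_exp_atBot.comp (Real.tendsto_log_nhdsGT_zero.atBot_mul_const hc)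
      have he : Tendsto (fun ε : ℝ => e ε s) (𝓝[>] 0) (𝓝[>] 0) :=
        tendsto_nhdsWithin_iff.mpr ⟨he0 s hs0, Eventually.of_forall fun ε => Real.exp_pos _⟩
      rcases lt_or_gt_of_ne hs1 with h1 | h1
      · rw [Set.indicator_of_mem (by exact h1)]
        have h2 : Tendsto (fun ε => h (e ε s) /
            (Real.exp (Real.log ε * (1 - s)) + (1 - ε) * (g (e ε s) / e ε s))) (𝓝[>] 0)
            (𝓝 (h₀ / (0 + (1 - 0) * D))) :=
          (hh0.comp he).div ((he0 _ (by linarith)).add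
            ((tendsto_const_nhds.sub hε0).mul (hg0.comp he))) (by linarith)
        rw [zero_add, sub_zero, one_mul] at h2
        refine h2.congr' ?_
        filter_upwards [hsmall] with ε hε
        have hp : e ε s ≠ 0 := (Real.exp_pos _).ne'
        have h3 : Real.exp (Real.log ε * (1 - s)) = ε / e ε s := by
          rw [eq_div_iff hp]
          simp only [e]
          rw [← Real.exp_add, ← mul_add, sub_add_cancel, mul_one, Real.exp_log hε.1]
        simp only [F]
        rw [h3, ← mul_div_assoc, ← add_div, div_div_eq_mul_div]
        ring
      · rw [Set.indicator_of_notMem (by simpa using h1.le)]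
        refine squeeze_zero_norm' ?_ (by simpa using (he0 (s - 1) (by linarith)).const_mul H)
        filter_upwards [hsmall] with ε hε
        have hp : 0 < e ε s := Real.exp_pos _
        have h8 : ε ≤ ε + (1 - ε) * g (e ε s) := by
          have := hden ε hε s hs
          have : 0 < κ / 2 * e ε s := by positivity
          linarith
        have h3 : Real.exp (Real.log ε * (s - 1)) = e ε s / ε := by
          rw [eq_div_iff hε.1.ne']
          simp only [e]
          nth_rewrite 2 [← Real.exp_log hε.1]
          rw [← Real.exp_add]
          ring_nf
        simp only [F, norm_mul, norm_div, Real.norm_eq_abs]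
        rw [abs_of_pos hp, abs_of_pos (hε.1.trans_le h8), mul_div_left_comm, h3]
        exact mul_le_mul (hH _ (hmaps ε hε s hs))
          (div_le_div_of_nonneg_left hp.le hε.1 h8)
          (div_nonneg hp.le (hε.1.trans_le h8).le) hH0
  refine key.congr' ?_
  filter_upwards [hsmall] with ε hε
  have hl := hlog ε hε
  have himg : e ε '' Set.Ioi 0 = Set.Ioo 0 1 := by
    refine Set.Subset.antisymm (Set.image_subset_iff.mpr (hmaps ε hε)) fun v hv => ?_
    refine ⟨Real.log v / Real.log ε,
      div_pos_of_neg_of_neg (Real.log_neg hv.1 hv.2) (by linarith), ?_⟩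
    simp only [e]
    rw [mul_div_cancel₀ _ (by linarith), Real.exp_log hv.1]
  have h1 := integral_image_eq_integral_abs_deriv_smul (s := Set.Ioi (0 : ℝ)) (f := e ε)
    (f' := fun s => e ε s * Real.log ε) measurableSet_Ioi
    (fun s _ => by
      have := ((hasDerivAt_id s).const_mul (Real.log ε)).exp
      simpa [e] using this.hasDerivWithinAt)
    (fun s _ s' _ hss => mul_left_cancel₀ (by linarith) (Real.exp_injective hss))
    (fun v => h v / (ε + (1 - ε) * g v))
  rw [himg] at h1
  rw [h1, eq_div_iff (by linarith), ← integral_mul_const]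
  refine setIntegral_congr_fun measurableSet_Ioi fun s hs => ?_
  simp only [F, smul_eq_mul]
  rw [abs_mul, abs_of_pos (Real.exp_pos _ : 0 < e ε s), abs_of_neg (by linarith)]
  ring

/-! ### Asymptotics of the Green function -/

theorem integrableOn_one_sub_sq_rpow_mul {α : ℝ} (hα : -1 < α) {f : ℝ → ℝ}
    (hf : ContinuousOn f (Set.Icc (-1) 1)) :
    IntegrableOn (fun t : ℝ => (1 - t ^ 2) ^ α * f t) (Set.Ioo (-1) 1) := by
  obtain ⟨K, hK⟩ := isCompact_Icc.exists_bound_of_continuousOn hf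
  refine (integrableOn_one_sub_sq_rpow hα).mul_bdd (c := K)
    ((hf.mono Set.Ioo_subset_Icc_self).aestronglyMeasurable measurableSet_Ioo) ?_
  filter_upwards [ae_restrict_mem measurableSet_Ioo] with t ht using hK t ⟨ht.1.le, ht.2.le⟩

/-- Only the neighbourhood of `1` contributes to the divergence of the Green function. -/
theorem exists_abs_spectralGreen_sub_le {α : ℝ} (hα : -1 / 2 ≤ α) {μ : PMF ℕ}
    (hμ : IsAperiodic α μ) (hμ2 : Summable fun n : ℕ => (μ n).toReal * (n : ℝ) ^ 2) (x y : ℕ) :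
    ∃ K : ℝ, ∀ ε ∈ Set.Ioo (0 : ℝ) (1 / 2), |spectralGreen α μ (1 - ε) x y -
      gegenbauerWeight α y * ∫ v in Set.Ioo (0 : ℝ) 1, v ^ α * (((2 - v) ^ α *
        ((gegenbauer α x).eval (1 - v) * (gegenbauer α y).eval (1 - v))) /
          (ε + (1 - ε) * (1 - gegenbauerTransform α μ (1 - v))))| ≤ K := by
  have hα' : -1 < α := by linarith
  obtain ⟨κ, hκ, hκt⟩ := exists_mul_one_sub_le hα hμ hμ2
  have hw := gegenbauerWeight_pos hα y
  -- For t ≤ 0 one has 1 - μ̂ ≥ κ(1-t) ≥ κ, so the denominator is at least (1-ε)κ ≥ κ/2 and the part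
  -- of the integral over (-1, 0] is bounded uniformly in ε.
  refine ⟨gegenbauerWeight α y * ∫ t in Set.Ioc (-1 : ℝ) 0, (1 - t ^ 2) ^ α * (2 / κ),
    fun ε hε => ?_⟩
  set k : ℝ → ℝ := fun t => (gegenbauer α x).eval t * (gegenbauer α y).eval t /
    (1 - (1 - ε) * gegenbauerTransform α μ t) with hk
  have hden : ∀ t ∈ Set.Icc (-1 : ℝ) 1, 0 < 1 - (1 - ε) * gegenbauerTransform α μ t :=
    fun t ht => by
      have := (abs_le.mp (abs_gegenbauerTransform_le_one hα μ ht)).2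
      nlinarith [hε.1, hε.2]
  have hkc : ContinuousOn k (Set.Icc (-1) 1) :=
    ContinuousOn.div (Continuous.continuousOn (by fun_prop))
      (continuousOn_const.sub (continuousOn_const.mul (continuousOn_gegenbauerTransform hα μ)))
      fun t ht => (hden t ht).ne'
  have hint := integrableOn_one_sub_sq_rpow_mul hα' hkc
  have hU : Set.Ioo (-1 : ℝ) 1 = Set.Ioc (-1) 0 ∪ Set.Ioo 0 1 :=
    (Set.Ioc_union_Ioo_eq_Ioo (by norm_num) (by norm_num)).symm
  -- Substitute v = 1-t, so that 1-t² = v(2-v) and the singularity becomes v^α at 0.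
  have hr : ∫ t in Set.Ioo (0 : ℝ) 1, (1 - t ^ 2) ^ α * k t =
      ∫ v in Set.Ioo (0 : ℝ) 1, v ^ α * (((2 - v) ^ α *
        ((gegenbauer α x).eval (1 - v) * (gegenbauer α y).eval (1 - v))) /
          (ε + (1 - ε) * (1 - gegenbauerTransform α μ (1 - v)))) := by
    have h1 := intervalIntegral.integral_comp_sub_left (a := 0) (b := 1)
      (fun t => (1 - t ^ 2) ^ α * k t) 1
    rw [sub_zero, sub_self, intervalIntegral.integral_of_le zero_le_one,
      intervalIntegral.integral_of_le zero_le_one, integral_Ioc_eq_integral_Ioo,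
      integral_Ioc_eq_integral_Ioo] at h1
    rw [← h1]
    refine setIntegral_congr_fun measurableSet_Ioo fun v hv => ?_
    have e1 : 1 - (1 - v) ^ 2 = v * (2 - v) := by ring
    have e2 : 1 - (1 - ε) * gegenbauerTransform α μ (1 - v) =
        ε + (1 - ε) * (1 - gegenbauerTransform α μ (1 - v)) := by ring
    simp only [hk]
    rw [e1, Real.mul_rpow hv.1.le (by linarith [hv.2]), e2]
    ring
  have hsplit : spectralGreen α μ (1 - ε) x y - gegenbauerWeight α y *
      ∫ t in Set.Ioo (0 : ℝ) 1, (1 - t ^ 2) ^ α * k t =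
      gegenbauerWeight α y * ∫ t in Set.Ioc (-1 : ℝ) 0, (1 - t ^ 2) ^ α * k t := by
    rw [spectralGreen, integral_gegenbauerMeasure, hU, setIntegral_union
      (Set.disjoint_left.mpr fun t h1 h2 => not_lt.mpr h1.2 h2.1) measurableSet_Ioo
      (hint.mono_set (hU ▸ Set.subset_union_left)) (hint.mono_set (hU ▸ Set.subset_union_right))]
    ring
  rw [← hr, hsplit, abs_mul, abs_of_pos hw]
  refine mul_le_mul_of_nonneg_left ?_ hw.le
  rw [← Real.norm_eq_abs]
  refine norm_integral_le_of_norm_le (((integrableOn_one_sub_sq_rpow hα').mono_set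
    (hU ▸ Set.subset_union_left)).mul_const _) ?_
  filter_upwards [ae_restrict_mem measurableSet_Ioc] with t ht
  have ht' : t ∈ Set.Icc (-1 : ℝ) 1 := ⟨ht.1.le, ht.2.trans zero_le_one⟩
  have hw0 : 0 ≤ (1 - t ^ 2) ^ α := Real.rpow_nonneg (by nlinarith [ht.1, ht.2]) _
  rw [norm_mul, Real.norm_of_nonneg hw0]
  refine mul_le_mul_of_nonneg_left ?_ hw0
  simp only [hk]
  rw [norm_div, norm_mul, Real.norm_of_nonneg (hden t ht').le]
  rw [show 2 / κ = 1 / (κ / 2) by field_simp]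
  refine div_le_div₀ zero_le_one ?_ (half_pos hκ) ?_
  · exact mul_le_one₀ (abs_gegenbauer_le_one hα x ht') (norm_nonneg _)
      (abs_gegenbauer_le_one hα y ht')
  · have h1 := hκt t ht'
    have h2 : κ ≤ 1 - gegenbauerTransform α μ t := by nlinarith [ht.2]
    nlinarith [hε.1, hε.2]

/-! ### Continuity, bounds and limits of the Green integrand near t = 1 -/

section GreenIntegrand

variable {α : ℝ} {μ : PMF ℕ}

theorem continuousOn_greenNumerator (x y : ℕ) :
    ContinuousOn (fun v : ℝ => (2 - v) ^ α *
      ((gegenbauer α x).eval (1 - v) * (gegenbauer α y).eval (1 - v))) (Set.Iio 2) := by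
  refine ContinuousOn.mul (ContinuousOn.rpow_const (by fun_prop) fun v hv => Or.inl ?_)
    (Continuous.continuousOn (by fun_prop))
  exact (sub_pos.mpr hv).ne'

theorem continuousOn_greenDenominator (hα : -1 / 2 ≤ α) :
    ContinuousOn (fun v : ℝ => 1 - gegenbauerTransform α μ (1 - v)) (Set.Ioo 0 1) :=
  continuousOn_const.sub ((continuousOn_gegenbauerTransform hα μ).comp (by fun_prop)
    fun v hv => ⟨by linarith [hv.2], by linarith [hv.1]⟩)

theorem abs_greenNumerator_le_one (hα : -1 / 2 ≤ α) (hα0 : α ≤ 0) (x y : ℕ) {v : ℝ}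
    (hv : v ∈ Set.Ioo (0 : ℝ) 1) : |(2 - v) ^ α *
      ((gegenbauer α x).eval (1 - v) * (gegenbauer α y).eval (1 - v))| ≤ 1 := by
  have hv' : 1 - v ∈ Set.Icc (-1 : ℝ) 1 := ⟨by linarith [hv.2], by linarith [hv.1]⟩
  have h1 : 0 ≤ (2 - v) ^ α := Real.rpow_nonneg (by linarith [hv.2]) _
  rw [abs_mul, abs_mul, abs_of_nonneg h1]
  exact mul_le_one₀ (Real.rpow_le_one_of_one_le_of_nonpos (by linarith [hv.2]) hα0)
    (by positivity) (mul_le_one₀ (abs_gegenbauer_le_one hα x hv') (abs_nonneg _)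
      (abs_gegenbauer_le_one hα y hv'))

theorem tendsto_greenNumerator (hα : -1 < α) (x y : ℕ) :
    Tendsto (fun v : ℝ => (2 - v) ^ α *
      ((gegenbauer α x).eval (1 - v) * (gegenbauer α y).eval (1 - v))) (𝓝[>] 0)
      (𝓝 (2 ^ α)) := by
  have h := (continuousOn_greenNumerator (α := α) x y).continuousAt (x := 0)
    (Iio_mem_nhds two_pos)
  have h2 := h.tendsto.mono_left (nhdsWithin_le_nhds (s := Set.Ioi (0 : ℝ)))
  simpa [gegenbauer_eval_one hα] using h2

theorem tendsto_greenDenominator_div (hα : -1 / 2 ≤ α)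
    (hμ2 : Summable fun n : ℕ => (μ n).toReal * (n : ℝ) ^ 2) :
    Tendsto (fun v : ℝ => (1 - gegenbauerTransform α μ (1 - v)) / v) (𝓝[>] 0)
      (𝓝 (2 * walkConst α μ)) := by
  have h1 : Tendsto (fun v : ℝ => 1 - v) (𝓝[>] 0) (𝓝[<] 1) := by
    refine tendsto_nhdsWithin_iff.mpr ⟨?_, ?_⟩
    · have : Tendsto (fun v : ℝ => 1 - v) (𝓝 0) (𝓝 (1 - 0)) := tendsto_const_nhds.sub tendsto_id
      rw [sub_zero] at this
      exact this.mono_left nhdsWithin_le_nhds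
    · filter_upwards [self_mem_nhdsWithin] with v hv
      exact sub_lt_self (1 : ℝ) hv
  simpa [Function.comp_def] using (tendsto_one_sub_gegenbauerTransform_div hα hμ2).comp h1

end GreenIntegrand

/-- The singular integral is used with a = α, h₀ = 2^α and D = 2C, and 2^α (2C)^(-α-1) = 1/(2
C^(α+1)). The bounded remainder is killed by ε^(-α) → 0. -/
theorem tendsto_spectralGreen_of_neg {α : ℝ} (hα : -1 / 2 ≤ α) (hα0 : α < 0) {μ : PMF ℕ}
    (hμ : IsAperiodic α μ) (hμ2 : Summable fun n : ℕ => (μ n).toReal * (n : ℝ) ^ 2) (x y : ℕ) :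
    Tendsto (fun ε => ε ^ (-α) * spectralGreen α μ (1 - ε) x y) (𝓝[>] 0)
      (𝓝 (gegenbauerWeight α y * Real.Gamma (α + 1) * Real.Gamma (-α) /
        (2 * walkConst α μ ^ (α + 1)))) := by
  have hC := walkConst_pos hα hμ hμ2
  obtain ⟨κ, hκ, hκt⟩ := exists_mul_one_sub_le hα hμ hμ2
  obtain ⟨K, hK⟩ := exists_abs_spectralGreen_sub_le hα hμ hμ2 x y
  have h1 := (tendsto_rpow_mul_integral (by linarith) hα0 hκ (mul_pos two_pos hC)
    ((continuousOn_greenNumerator x y).mono fun v hv => by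
      have := hv.2
      simp only [Set.mem_Iio]
      linarith)
    (continuousOn_greenDenominator hα) (fun v hv => abs_greenNumerator_le_one hα hα0.le x y hv)
    (fun v hv => by
      have := hκt (1 - v) ⟨by linarith [hv.2], by linarith [hv.1]⟩
      rwa [sub_sub_cancel] at this)
    (tendsto_greenNumerator (by linarith) x y)
    (tendsto_greenDenominator_div hα hμ2)).const_mul (gegenbauerWeight α y)
  have hε : Tendsto (fun ε : ℝ => ε ^ (-α)) (𝓝[>] 0) (𝓝 0) := by
    have := (Real.continuousAt_rpow_const 0 (-α) (Or.inr (neg_nonneg.mpr hα0.le))).tendsto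
    rw [Real.zero_rpow (neg_ne_zero.mpr hα0.ne)] at this
    exact this.mono_left nhdsWithin_le_nhds
  have hsmall : ∀ᶠ ε : ℝ in 𝓝[>] 0, ε ∈ Set.Ioo (0 : ℝ) (1 / 2) := Ioo_mem_nhdsGT (by norm_num)
  have h2 : Tendsto (fun ε => ε ^ (-α) * (spectralGreen α μ (1 - ε) x y -
      gegenbauerWeight α y * ∫ v in Set.Ioo (0 : ℝ) 1, v ^ α * (((2 - v) ^ α *
        ((gegenbauer α x).eval (1 - v) * (gegenbauer α y).eval (1 - v))) /
          (ε + (1 - ε) * (1 - gegenbauerTransform α μ (1 - v)))))) (𝓝[>] 0) (𝓝 0) := by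
    refine squeeze_zero_norm' ?_ (by simpa using hε.mul_const K)
    filter_upwards [hsmall] with ε hε
    rw [norm_mul, Real.norm_of_nonneg (Real.rpow_nonneg hε.1.le _)]
    exact mul_le_mul_of_nonneg_left (hK ε hε) (Real.rpow_nonneg hε.1.le _)
  have h3 := h1.add h2
  convert h3 using 2 with ε
  · ring
  · have e1 : (2 * walkConst α μ) ^ (-α - 1) = 2 ^ (-α - 1) * (walkConst α μ ^ (α + 1))⁻¹ := by
      rw [Real.mul_rpow two_pos.le hC.le, ← Real.rpow_neg hC.le (α + 1), neg_add']
    have e2 : (2 : ℝ) ^ α * 2 ^ (-α - 1) = 2⁻¹ := by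
      rw [← Real.rpow_add two_pos, show α + (-α - 1) = -1 by ring, Real.rpow_neg_one]
    rw [e1, add_zero, div_eq_mul_inv, mul_inv, ← e2]
    ring

/-- Here h₀ = 1, D = 2C and w_y = (2y+1)/2; the bounded remainder is negligible against log(1/ε). -/
theorem tendsto_spectralGreen_zero {μ : PMF ℕ} (hμ : IsAperiodic 0 μ)
    (hμ2 : Summable fun n : ℕ => (μ n).toReal * (n : ℝ) ^ 2) (x y : ℕ) :
    Tendsto (fun ε => spectralGreen 0 μ (1 - ε) x y / (-Real.log ε)) (𝓝[>] 0)
      (𝓝 ((2 * y + 1) / (4 * walkConst 0 μ))) := by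
  have hα : (-1 / 2 : ℝ) ≤ 0 := by norm_num
  have hC := walkConst_pos hα hμ hμ2
  obtain ⟨κ, hκ, hκt⟩ := exists_mul_one_sub_le hα hμ hμ2
  obtain ⟨K, hK⟩ := exists_abs_spectralGreen_sub_le hα hμ hμ2 x y
  have h1 := (tendsto_integral_div_log hκ (mul_pos two_pos hC)
    ((continuousOn_greenNumerator x y).mono fun v hv => by
      have := hv.2
      simp only [Set.mem_Iio]
      linarith)
    (continuousOn_greenDenominator hα) (fun v hv => abs_greenNumerator_le_one hα le_rfl x y hv)
    (fun v hv => by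
      have := hκt (1 - v) ⟨by linarith [hv.2], by linarith [hv.1]⟩
      rwa [sub_sub_cancel] at this)
    (tendsto_greenNumerator (by norm_num) x y)
    (tendsto_greenDenominator_div hα hμ2)).const_mul (gegenbauerWeight 0 y)
  have hε : Tendsto (fun ε : ℝ => (-Real.log ε)⁻¹) (𝓝[>] 0) (𝓝 0) :=
    (tendsto_neg_atBot_atTop.comp Real.tendsto_log_nhdsGT_zero).inv_tendsto_atTop
  have hsmall : ∀ᶠ ε : ℝ in 𝓝[>] 0, ε ∈ Set.Ioo (0 : ℝ) (1 / 2) := Ioo_mem_nhdsGT (by norm_num)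
  have h2 : Tendsto (fun ε => (spectralGreen 0 μ (1 - ε) x y -
      gegenbauerWeight 0 y * ∫ v in Set.Ioo (0 : ℝ) 1, v ^ (0 : ℝ) * (((2 - v) ^ (0 : ℝ) *
        ((gegenbauer 0 x).eval (1 - v) * (gegenbauer 0 y).eval (1 - v))) /
          (ε + (1 - ε) * (1 - gegenbauerTransform 0 μ (1 - v))))) * (-Real.log ε)⁻¹)
      (𝓝[>] 0) (𝓝 0) := by
    refine squeeze_zero_norm' ?_ (by simpa only [mul_zero] using hε.const_mul K)
    filter_upwards [hsmall] with ε hε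
    have hl : 0 ≤ (-Real.log ε)⁻¹ :=
      inv_nonneg.mpr (neg_nonneg.mpr (Real.log_nonpos hε.1.le (by linarith [hε.2])))
    rw [norm_mul, Real.norm_of_nonneg hl]
    exact mul_le_mul_of_nonneg_right (hK ε hε) hl
  have h3 := h1.add h2
  convert h3 using 2 with ε
  · simp only [Real.rpow_zero, one_mul]
    ring
  · have hw : gegenbauerWeight 0 y = (2 * y + 1) / 2 := by
      have : Real.Gamma ((y : ℝ) + 1) ≠ 0 := (Real.Gamma_pos_of_pos (by positivity)).ne'
      simp only [gegenbauerWeight]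
      norm_num
      field_simp
    rw [hw, Real.rpow_zero]
    field_simp
    norm_num

/-! ### Convergence of functionals on the unit interval -/

/-- A bounded linear functional on `C([0,1])`, given by its values. -/
structure IsBoundedFunctional (K : ℝ) (A : C(unitInterval, ℝ) → ℝ) : Prop where
  map_add : ∀ p q, A (p + q) = A p + A q
  map_smul : ∀ (c : ℝ) p, A (c • p) = c * A p
  bound : ∀ q, |A q| ≤ K * ‖q‖

namespace IsBoundedFunctional

theorem map_sub {K : ℝ} {A : C(unitInterval, ℝ) → ℝ} (hA : IsBoundedFunctional K A)
    (p q : C(unitInterval, ℝ)) : A (p - q) = A p - A q := by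
  have h : p - q = p + (-1 : ℝ) • q := by rw [neg_one_smul, sub_eq_add_neg]
  rw [h, hA.map_add, hA.map_smul]
  ring

theorem map_polynomial {K : ℝ} {A : C(unitInterval, ℝ) → ℝ} (hA : IsBoundedFunctional K A)
    (p : ℝ[X]) : A (p.toContinuousMapOn unitInterval) = ∑ k ∈ Finset.range (p.natDegree + 1),
      p.coeff k * A ((Polynomial.X ^ k : ℝ[X]).toContinuousMapOn unitInterval) := by
  have h0 : A 0 = 0 := by simpa using hA.map_smul 0 0
  have hsum : ∀ (s : Finset ℕ) (f : ℕ → C(unitInterval, ℝ)), A (∑ k ∈ s, f k) = ∑ k ∈ s, A (f k) :=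
    fun s f => by
      induction s using Finset.induction_on with
      | empty => simpa using h0
      | insert a s ha ih => rw [Finset.sum_insert ha, Finset.sum_insert ha, hA.map_add, ih]
  simp only [← hA.map_smul]
  rw [← hsum]
  congr 1
  ext t
  simp [Polynomial.eval_eq_sum_range]

/-- By the Weierstrass theorem, convergence on monomials implies convergence everywhere. -/
theorem tendsto {ι : Type*} {l : Filter ι} {K : ℝ} {A : ι → C(unitInterval, ℝ) → ℝ}
    {L : C(unitInterval, ℝ) → ℝ} (hA : ∀ᶠ i in l, IsBoundedFunctional K (A i))
    (hL : IsBoundedFunctional K L)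
    (h : ∀ k : ℕ, Tendsto (fun i => A i ((Polynomial.X ^ k : ℝ[X]).toContinuousMapOn unitInterval))
      l (𝓝 (L ((Polynomial.X ^ k : ℝ[X]).toContinuousMapOn unitInterval))))
    (q : C(unitInterval, ℝ)) : Tendsto (fun i => A i q) l (𝓝 (L q)) := by
  have hK : 0 ≤ K := by
    have := (abs_nonneg _).trans (hL.bound 1)
    simpa using this
  have hp : ∀ p : ℝ[X], Tendsto (fun i => A i (p.toContinuousMapOn unitInterval)) l
      (𝓝 (L (p.toContinuousMapOn unitInterval))) := fun p => by
    rw [hL.map_polynomial]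
    refine (tendsto_finsetSum _ fun k _ => (h k).const_mul (p.coeff k)).congr' ?_
    filter_upwards [hA] with i hi using (hi.map_polynomial p).symm
  rw [Metric.tendsto_nhds]
  intro ε hε
  -- Dividing by K+1 rather than K keeps the tolerance meaningful when K = 0.
  obtain ⟨p, hpq⟩ := exists_polynomial_near_continuousMap 0 1 q (ε / (3 * (K + 1))) (by positivity)
  have hpq' : K * ‖p.toContinuousMapOn unitInterval - q‖ < ε / 3 := by
    have h1 : K * ‖p.toContinuousMapOn unitInterval - q‖ ≤ K * (ε / (3 * (K + 1))) :=
      mul_le_mul_of_nonneg_left hpq.le hK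
    have h2 : K * (ε / (3 * (K + 1))) < ε / 3 := by
      rw [← mul_div_assoc, div_lt_div_iff₀ (by positivity) (by norm_num)]
      nlinarith
    exact h1.trans_lt h2
  filter_upwards [hA, (Metric.tendsto_nhds.mp (hp p)) (ε / 3) (by positivity)] with i hi h1
  have h2 := hi.bound (p.toContinuousMapOn unitInterval - q)
  have h3 := hL.bound (p.toContinuousMapOn unitInterval - q)
  rw [hi.map_sub] at h2
  rw [hL.map_sub] at h3
  rw [Real.dist_eq] at h1 ⊢
  have h4 := abs_le.mp h2
  have h5 := abs_le.mp h3
  have h6 := abs_lt.mp h1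
  rw [abs_lt]
  constructor <;> linarith

end IsBoundedFunctional

/-- The map `t ↦ exp (-t)`, truncated to take values in the unit interval. -/
noncomputable def expUnit (t : ℝ) : unitInterval := Set.projIcc 0 1 zero_le_one (Real.exp (-t))

theorem continuous_expUnit : Continuous expUnit :=
  continuous_projIcc.comp (Real.continuous_exp.comp continuous_neg)

theorem coe_expUnit {t : ℝ} (ht : 0 ≤ t) : (expUnit t : ℝ) = Real.exp (-t) := by
  rw [expUnit, Set.projIcc_of_mem zero_le_one
    ⟨(Real.exp_pos _).le, Real.exp_le_one_iff.mpr (neg_nonpos.mpr ht)⟩]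

/-! ### A Tauberian theorem -/

theorem tendsto_nat_mul_one_sub_exp (c : ℝ) :
    Tendsto (fun n : ℕ => (n : ℝ) * (1 - Real.exp (-c / n))) atTop (𝓝 c) := by
  have h1 : HasDerivAt (fun x : ℝ => Real.exp (-c * x)) (-c) 0 := by
    simpa using ((hasDerivAt_id (0 : ℝ)).const_mul (-c)).exp
  have h2 := (hasDerivAt_iff_tendsto_slope.mp h1).comp
    ((tendsto_inv_atTop_nhdsGT_zero.mono_right
      (nhdsWithin_mono _ fun _ h => ne_of_gt h)).comp (tendsto_natCast_atTop_atTop (R := ℝ)))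
  have h3 := h2.neg
  rw [neg_neg] at h3
  refine h3.congr fun n => ?_
  simp only [Function.comp, slope_def_field, mul_zero, Real.exp_zero, sub_zero, div_inv_eq_mul,
    ← div_eq_mul_inv]
  ring

theorem hasSum_exp_div_pow {c : ℝ} (hc : 0 < c) {n : ℕ} (hn : 0 < n) :
    HasSum (fun m : ℕ => Real.exp (-c / n) ^ m) (1 - Real.exp (-c / n))⁻¹ := by
  refine hasSum_geometric_of_lt_one (Real.exp_pos _).le (Real.exp_lt_one_iff.mpr ?_)
  have : (0 : ℝ) < n := by exact_mod_cast hn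
  exact div_neg_of_neg_of_pos (neg_lt_zero.mpr hc) this

section Tauberian

variable {Φ : ℕ → ℕ → ℝ} {F : ℝ → ℝ} {Λ : ℝ}

/-- The functional `q ↦ (1/n) ∑_m e^{-Λm/n} q(e^{-Λm/n}) Φ_n(m)`. -/
noncomputable def discreteFunctional (Λ : ℝ) (Φ : ℕ → ℕ → ℝ) (n : ℕ)
    (q : C(unitInterval, ℝ)) : ℝ :=
  (n : ℝ)⁻¹ * ∑' m : ℕ, Real.exp (-Λ / n) ^ m * (q (expUnit (Λ * (m / n))) * Φ n m)

/-- The functional `q ↦ ∫ e^{-Λt} q(e^{-Λt}) F(t) dt`. -/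
noncomputable def laplaceFunctional (Λ : ℝ) (F : ℝ → ℝ) (q : C(unitInterval, ℝ)) : ℝ :=
  ∫ t in Set.Ioi (0 : ℝ), q (expUnit (Λ * t)) * (Real.exp (-(Λ * t)) * F t)

theorem summable_discreteFunctional (hΛ : 0 < Λ) (hΦ : ∀ n m, Φ n m ∈ Set.Icc (0 : ℝ) 1) {n : ℕ}
    (hn : 0 < n) (q : C(unitInterval, ℝ)) :
    Summable fun m : ℕ => Real.exp (-Λ / n) ^ m * (q (expUnit (Λ * (m / n))) * Φ n m) := by
  refine Summable.of_norm_bounded ((hasSum_exp_div_pow hΛ hn).summable.mul_right ‖q‖) fun m => ?_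
  rw [norm_mul, Real.norm_of_nonneg (by positivity), norm_mul, Real.norm_of_nonneg (hΦ n m).1]
  refine mul_le_mul_of_nonneg_left ?_ (by positivity)
  exact (mul_le_mul (q.norm_coe_le_norm _) (hΦ n m).2 (hΦ n m).1 (norm_nonneg q)).trans_eq
        (mul_one _)

theorem eventually_isBoundedFunctional_discrete (hΛ : 0 < Λ)
    (hΦ : ∀ n m, Φ n m ∈ Set.Icc (0 : ℝ) 1) :
    ∀ᶠ n : ℕ in atTop, IsBoundedFunctional (Λ⁻¹ + 1) (discreteFunctional Λ Φ n) := by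
  have hlim := (tendsto_nat_mul_one_sub_exp Λ).inv₀ hΛ.ne'
  filter_upwards [eventually_gt_atTop 0, hlim.eventually (gt_mem_nhds (lt_add_one Λ⁻¹))]
    with n hn hb
  have hs := summable_discreteFunctional (Φ := Φ) hΛ hΦ hn
  refine ⟨fun p q => ?_, fun c q => ?_, fun q => ?_⟩
  · simp only [discreteFunctional, ContinuousMap.add_apply, add_mul, mul_add]
    rw [(hs p).tsum_add (hs q), mul_add]
  · simp only [discreteFunctional, ContinuousMap.smul_apply, smul_eq_mul]
    rw [mul_left_comm, ← tsum_mul_left (a := c)]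
    congr 1
    exact tsum_congr fun m => by ring
  · have h1 : |∑' m : ℕ, Real.exp (-Λ / n) ^ m * (q (expUnit (Λ * (m / n))) * Φ n m)| ≤
        (1 - Real.exp (-Λ / n))⁻¹ * ‖q‖ := by
      rw [← Real.norm_eq_abs]
      refine tsum_of_norm_bounded ((hasSum_exp_div_pow hΛ hn).mul_right ‖q‖) fun m => ?_
      rw [norm_mul, Real.norm_of_nonneg (by positivity), norm_mul, Real.norm_of_nonneg (hΦ n m).1]
      refine mul_le_mul_of_nonneg_left ?_ (by positivity)
      exact (mul_le_mul (q.norm_coe_le_norm _) (hΦ n m).2 (hΦ n m).1 (norm_nonneg q)).trans_eq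
        (mul_one _)
    rw [discreteFunctional, abs_mul, abs_of_nonneg (by positivity)]
    refine (mul_le_mul_of_nonneg_left h1 (by positivity)).trans ?_
    rw [← mul_assoc, ← mul_inv]
    exact mul_le_mul_of_nonneg_right hb.le (norm_nonneg q)

theorem integrableOn_laplaceFunctional (hF : IntegrableOn (fun t => Real.exp (-(Λ * t)) * F t)
    (Set.Ioi 0)) (q : C(unitInterval, ℝ)) :
    IntegrableOn (fun t => q (expUnit (Λ * t)) * (Real.exp (-(Λ * t)) * F t)) (Set.Ioi 0) := by
  refine hF.bdd_mul (c := ‖q‖) ?_ (ae_of_all _ fun t => q.norm_coe_le_norm _)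
  exact (q.continuous.comp (continuous_expUnit.comp
    (continuous_const.mul continuous_id))).aestronglyMeasurable

theorem isBoundedFunctional_laplace {K : ℝ} (hF : IntegrableOn (fun t => Real.exp (-(Λ * t)) * F t)
    (Set.Ioi 0)) (hK : ∫ t in Set.Ioi (0 : ℝ), ‖Real.exp (-(Λ * t)) * F t‖ ≤ K) :
    IsBoundedFunctional K (laplaceFunctional Λ F) := by
  have hs := integrableOn_laplaceFunctional hF
  refine ⟨fun p q => ?_, fun c q => ?_, fun q => ?_⟩
  · simp only [laplaceFunctional, ContinuousMap.add_apply, add_mul]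
    exact integral_add (hs p) (hs q)
  · simp only [laplaceFunctional, ContinuousMap.smul_apply, smul_eq_mul, mul_assoc]
    exact integral_const_mul _ _
  · rw [mul_comm]
    refine le_trans ?_ (mul_le_mul_of_nonneg_left hK (norm_nonneg q))
    rw [laplaceFunctional, ← Real.norm_eq_abs, ← integral_const_mul]
    refine norm_integral_le_of_norm_le (hF.norm.const_mul _) (ae_of_all _ fun t => ?_)
    rw [norm_mul]
    exact mul_le_mul_of_nonneg_right (q.norm_coe_le_norm _) (norm_nonneg _)

theorem IsBoundedFunctional.mono {K K' : ℝ} {A : C(unitInterval, ℝ) → ℝ}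
    (hA : IsBoundedFunctional K A) (h : K ≤ K') : IsBoundedFunctional K' A :=
  ⟨hA.map_add, hA.map_smul, fun q =>
    (hA.bound q).trans (mul_le_mul_of_nonneg_right h (norm_nonneg q))⟩

/-- On the monomial v^k the two functionals are Laplace transforms at (k+1)Λ. Convergence along this
arithmetic progression therefore suffices, by Weierstrass. -/
theorem tendsto_discreteFunctional (hΛ : 0 < Λ) (hΦ : ∀ n m, Φ n m ∈ Set.Icc (0 : ℝ) 1)
    (hF : IntegrableOn (fun t => Real.exp (-(Λ * t)) * F t) (Set.Ioi 0))
    (h : ∀ k : ℕ, Tendsto (fun n : ℕ => (n : ℝ)⁻¹ *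
      ∑' m : ℕ, Real.exp (-((k + 1) * Λ) / n) ^ m * Φ n m) atTop
      (𝓝 (∫ t in Set.Ioi (0 : ℝ), Real.exp (-((k + 1) * Λ * t)) * F t)))
    (q : C(unitInterval, ℝ)) :
    Tendsto (fun n => discreteFunctional Λ Φ n q) atTop (𝓝 (laplaceFunctional Λ F q)) := by
  refine IsBoundedFunctional.tendsto
    (K := max (Λ⁻¹ + 1) (∫ t in Set.Ioi (0 : ℝ), ‖Real.exp (-(Λ * t)) * F t‖))
    ((eventually_isBoundedFunctional_discrete hΛ hΦ).mono fun n hn => hn.mono (le_max_left _ _))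
    (isBoundedFunctional_laplace hF (le_max_right _ _)) (fun k => ?_) q
  have hL : laplaceFunctional Λ F ((Polynomial.X ^ k : ℝ[X]).toContinuousMapOn unitInterval) =
      ∫ t in Set.Ioi (0 : ℝ), Real.exp (-((k + 1) * Λ * t)) * F t := by
    refine setIntegral_congr_fun measurableSet_Ioi fun t ht => ?_
    have ht0 : 0 ≤ Λ * t := mul_nonneg hΛ.le (le_of_lt ht)
    simp only [Polynomial.toContinuousMapOn_apply, Polynomial.toContinuousMap_apply,
      Polynomial.eval_pow, Polynomial.eval_X, coe_expUnit ht0, ← Real.exp_nat_mul]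
    rw [← mul_assoc, ← Real.exp_add]
    ring_nf
  rw [hL]
  refine (h k).congr fun n => ?_
  rw [discreteFunctional]
  congr 1
  refine tsum_congr fun m => ?_
  have ht0 : 0 ≤ Λ * ((m : ℝ) / n) := by positivity
  simp only [Polynomial.toContinuousMapOn_apply, Polynomial.toContinuousMap_apply,
      Polynomial.eval_pow, Polynomial.eval_X, coe_expUnit ht0, ← Real.exp_nat_mul]
  rw [← mul_assoc, ← Real.exp_add]
  ring_nf

/-- Supplies the normalising denominators of the weighted averages used in the Tauberian argument.
-/
theorem tendsto_discreteFunctional_one (hΛ : 0 < Λ) (q : C(unitInterval, ℝ)) :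
    Tendsto (fun n => discreteFunctional Λ (fun _ _ => 1) n q) atTop
      (𝓝 (laplaceFunctional Λ (fun _ => 1) q)) := by
  refine tendsto_discreteFunctional hΛ (fun _ _ => by simp) ?_ (fun k => ?_) q
  · simpa [neg_mul] using exp_neg_integrableOn_Ioi 0 hΛ
  · have hc : 0 < (k + 1) * Λ := by positivity
    have h1 : ∫ t in Set.Ioi (0 : ℝ), Real.exp (-((k + 1) * Λ * t)) * 1 = ((k + 1) * Λ)⁻¹ := by
      have := integral_exp_mul_Ioi (neg_lt_zero.mpr hc) 0
      simp only [neg_mul] at this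
      simp only [mul_one]
      rw [this]
      simp [div_eq_mul_inv]
    rw [h1]
    refine ((tendsto_nat_mul_one_sub_exp ((k + 1) * Λ)).inv₀ hc.ne').congr' ?_
    filter_upwards [eventually_gt_atTop 0] with n hn
    simp only [mul_one]
    rw [(hasSum_exp_div_pow hc hn).tsum_eq, mul_inv]

/-- A nonnegative test function localised between the times `a` and `b`. -/
theorem exists_localised (hΛ : 0 < Λ) {a b : ℝ} (ha : 0 ≤ a) (hab : a < b) :
    ∃ q : C(unitInterval, ℝ), (∀ v, 0 ≤ q v) ∧
      (∀ t, 0 ≤ t → t ∉ Set.Ioo a b → q (expUnit (Λ * t)) = 0) ∧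
      0 < laplaceFunctional Λ (fun _ => 1) q := by
  -- A tent in the variable v = e^{-Λt}, which decreases in t: its support runs from e^{-Λb} to
  -- e^{-Λa}.
  let q : C(unitInterval, ℝ) := ⟨fun v => max 0
    (min ((v : ℝ) - Real.exp (-(Λ * b))) (Real.exp (-(Λ * a)) - v)), by fun_prop⟩
  have hq : ∀ t, 0 ≤ t → q (expUnit (Λ * t)) = max 0 (min (Real.exp (-(Λ * t)) -
      Real.exp (-(Λ * b))) (Real.exp (-(Λ * a)) - Real.exp (-(Λ * t)))) := fun t ht => by
    simp only [q, ContinuousMap.coe_mk, coe_expUnit (mul_nonneg hΛ.le ht)]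
  have hq0 : ∀ v, 0 ≤ q v := fun v => le_max_left _ _
  refine ⟨q, hq0, fun t ht hnot => ?_, ?_⟩
  · rw [hq t ht]
    refine max_eq_left ?_
    rw [Set.mem_Ioo, not_and_or, not_lt, not_lt] at hnot
    rcases hnot with h | h
    · refine (min_le_right _ _).trans (sub_nonpos.mpr (Real.exp_le_exp.mpr ?_))
      exact neg_le_neg (mul_le_mul_of_nonneg_left h hΛ.le)
    · refine (min_le_left _ _).trans (sub_nonpos.mpr (Real.exp_le_exp.mpr ?_))
      exact neg_le_neg (mul_le_mul_of_nonneg_left h hΛ.le)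
  · have hint := integrableOn_laplaceFunctional (Λ := Λ) (F := fun _ => 1)
      (by simpa [neg_mul] using exp_neg_integrableOn_Ioi 0 hΛ) q
    rw [laplaceFunctional, setIntegral_pos_iff_support_of_nonneg_ae (ae_of_all _ fun t =>
      mul_nonneg (hq0 _) (by positivity)) hint]
    have hsub : Set.Ioo a b ⊆ (Function.support fun t => q (expUnit (Λ * t)) *
        (Real.exp (-(Λ * t)) * 1)) ∩ Set.Ioi 0 := fun t ht => by
      have ht0 : 0 < t := ha.trans_lt ht.1
      refine ⟨?_, ht0⟩
      rw [Function.mem_support, hq t ht0.le]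
      have h1 : Real.exp (-(Λ * b)) < Real.exp (-(Λ * t)) :=
        Real.exp_lt_exp.mpr (neg_lt_neg (mul_lt_mul_of_pos_left ht.2 hΛ))
      have h2 : Real.exp (-(Λ * t)) < Real.exp (-(Λ * a)) :=
        Real.exp_lt_exp.mpr (neg_lt_neg (mul_lt_mul_of_pos_left ht.1 hΛ))
      have h3 : 0 < min (Real.exp (-(Λ * t)) - Real.exp (-(Λ * b)))
          (Real.exp (-(Λ * a)) - Real.exp (-(Λ * t))) :=
        lt_min (sub_pos.mpr h1) (sub_pos.mpr h2)
      have := Real.exp_pos (-(Λ * t))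
      have := lt_of_lt_of_le h3 (le_max_right 0 _)
      positivity
    refine lt_of_lt_of_le ?_ (measure_mono hsub)
    simpa using hab

theorem laplaceFunctional_le (hF : IntegrableOn (fun t => Real.exp (-(Λ * t)) * F t) (Set.Ioi 0))
    (hΛ : 0 < Λ) {q : C(unitInterval, ℝ)} (hq0 : ∀ v, 0 ≤ q v) {a b c : ℝ}
    (hq : ∀ t, 0 ≤ t → t ∉ Set.Ioo a b → q (expUnit (Λ * t)) = 0)
    (hc : ∀ t ∈ Set.Ioo a b, F t ≤ c) :
    laplaceFunctional Λ F q ≤ c * laplaceFunctional Λ (fun _ => 1) q := by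
  have h1 := integrableOn_laplaceFunctional (Λ := Λ) (F := fun _ => 1)
    (by simpa [neg_mul] using exp_neg_integrableOn_Ioi 0 hΛ) q
  rw [laplaceFunctional, laplaceFunctional, ← integral_const_mul]
  refine setIntegral_mono_on (integrableOn_laplaceFunctional hF q) (h1.const_mul c)
    measurableSet_Ioi fun t ht => ?_
  by_cases hmem : t ∈ Set.Ioo a b
  · have := mul_le_mul_of_nonneg_left (hc t hmem)
      (mul_nonneg (hq0 (expUnit (Λ * t))) (Real.exp_pos (-(Λ * t))).le)
    linarith
  · rw [hq t (le_of_lt ht) hmem]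
    simp

theorem discreteFunctional_mono {Φ Ψ : ℕ → ℕ → ℝ} (hΛ : 0 < Λ)
    (hΦ : ∀ n m, Φ n m ∈ Set.Icc (0 : ℝ) 1) (hΨ : ∀ n m, Ψ n m ∈ Set.Icc (0 : ℝ) 1)
    {q : C(unitInterval, ℝ)} (hq0 : ∀ v, 0 ≤ q v) {a b : ℝ}
    (hq : ∀ t, 0 ≤ t → t ∉ Set.Ioo a b → q (expUnit (Λ * t)) = 0) {n : ℕ} (hn : 0 < n)
    (h : ∀ m : ℕ, (m : ℝ) / n ∈ Set.Ioo a b → Φ n m ≤ Ψ n m) :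
    discreteFunctional Λ Φ n q ≤ discreteFunctional Λ Ψ n q := by
  refine mul_le_mul_of_nonneg_left ?_ (by positivity)
  refine (summable_discreteFunctional hΛ hΦ hn q).tsum_le_tsum (fun m => ?_)
    (summable_discreteFunctional hΛ hΨ hn q)
  refine mul_le_mul_of_nonneg_left ?_ (by positivity)
  by_cases hmem : (m : ℝ) / n ∈ Set.Ioo a b
  · exact mul_le_mul_of_nonneg_left (h m hmem) (hq0 _)
  · rw [hq _ (by positivity) hmem, zero_mul, zero_mul]

theorem discreteFunctional_const_mul (c : ℝ) (n : ℕ) (q : C(unitInterval, ℝ)) :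
    discreteFunctional Λ (fun _ _ => c) n q = c * discreteFunctional Λ (fun _ _ => 1) n q := by
  rw [discreteFunctional, discreteFunctional, mul_left_comm]
  congr 1
  rw [← tsum_mul_left]
  exact tsum_congr fun m => by ring

theorem laplaceFunctional_neg (q : C(unitInterval, ℝ)) :
    laplaceFunctional Λ (fun t => -F t) q = -laplaceFunctional Λ F q := by
  simp only [laplaceFunctional, mul_neg, integral_neg]

/-- A Tauberian theorem of Karamata type for bounded monotone sequences. -/
theorem tendsto_diagonal_of_tendsto_laplace (hmono : ∀ n, Monotone (Φ n)) (hΛ : 0 < Λ)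
    (hΦ : ∀ n m, Φ n m ∈ Set.Icc (0 : ℝ) 1)
    (hF : IntegrableOn (fun t => Real.exp (-(Λ * t)) * F t) (Set.Ioi 0)) (hc : ContinuousAt F 1)
    (h : ∀ k : ℕ, Tendsto (fun n : ℕ => (n : ℝ)⁻¹ *
      ∑' m : ℕ, Real.exp (-((k + 1) * Λ) / n) ^ m * Φ n m) atTop
      (𝓝 (∫ t in Set.Ioi (0 : ℝ), Real.exp (-((k + 1) * Λ * t)) * F t))) :
    Tendsto (fun n => Φ n n) atTop (𝓝 (F 1)) := by
  have hlim := tendsto_discreteFunctional hΛ hΦ hF h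
  rw [Metric.tendsto_nhds]
  intro ε hε
  obtain ⟨δ, hδ, hδF⟩ := Metric.continuousAt_iff.mp hc (ε / 2) (by positivity)
  -- The cap at 1 keeps 1-η ≥ 0, so the lower test interval consists of nonnegative times.
  set η := min δ 1
  have hη : 0 < η := lt_min hδ one_pos
  -- The diagonal value Φ_n(n), viewed as a sequence constant in m, to be compared with Φ_n(m) under
  -- the same functional.
  have hΦ' : ∀ n m : ℕ, (fun a (_ : ℕ) => Φ a a) n m ∈ Set.Icc (0 : ℝ) 1 := fun n m => hΦ n n
  have hconst : ∀ (n : ℕ) (q : C(unitInterval, ℝ)), discreteFunctional Λ (fun a _ => Φ a a) n q =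
      Φ n n * discreteFunctional Λ (fun _ _ => 1) n q := fun n q =>
    discreteFunctional_const_mul (Φ n n) n q
  have hdiv : ∀ {n m : ℕ}, 0 < n → (m : ℝ) / n < 1 → m ≤ n := fun {n m} hn hm => by
    rw [div_lt_one (by exact_mod_cast hn)] at hm
    exact_mod_cast hm.le
  have hdiv' : ∀ {n m : ℕ}, 0 < n → 1 < (m : ℝ) / n → n ≤ m := fun {n m} hn hm => by
    rw [one_lt_div (by exact_mod_cast hn)] at hm
    exact_mod_cast hm.le
  -- Test on times m/n in (1, 1+η): there m ≥ n, so Φ_n(n) is at most the weighted average of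
  -- Φ_n(m), whose limit is at most F(1) + ε/2.
  have upper : ∀ᶠ n : ℕ in atTop, Φ n n < F 1 + ε := by
    obtain ⟨q, hq0, hq, hpos⟩ := exists_localised hΛ (zero_le_one) (by linarith : 1 < 1 + η)
    have h1 : laplaceFunctional Λ F q ≤ (F 1 + ε / 2) * laplaceFunctional Λ (fun _ => 1) q :=
      laplaceFunctional_le hF hΛ hq0 hq fun t ht => by
        have hd : dist t 1 < δ := by
          rw [Real.dist_eq, abs_lt]
          constructor <;> linarith [ht.1, ht.2, min_le_left δ 1]
        have := abs_lt.mp (hδF hd)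
        linarith
    have h2 := (hlim q).div (tendsto_discreteFunctional_one hΛ q) hpos.ne'
    have h3 : laplaceFunctional Λ F q / laplaceFunctional Λ (fun _ => 1) q < F 1 + ε := by
      rw [div_lt_iff₀ hpos]
      nlinarith
    filter_upwards [h2.eventually (gt_mem_nhds h3), eventually_gt_atTop 0,
      (tendsto_discreteFunctional_one hΛ q).eventually (lt_mem_nhds hpos)] with n h4 hn h5
    refine lt_of_le_of_lt ?_ h4
    rw [Pi.div_apply, le_div_iff₀ h5, ← hconst]
    exact discreteFunctional_mono hΛ hΦ' hΦ hq0 hq hn fun m hm => hmono n (hdiv' hn hm.1)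
  -- The mirror argument on (1-η, 1), where m ≤ n; the bound on F is obtained from the one for -F.
  have lower : ∀ᶠ n : ℕ in atTop, F 1 - ε < Φ n n := by
    obtain ⟨q, hq0, hq, hpos⟩ := exists_localised hΛ (sub_nonneg.mpr (min_le_right δ 1))
      (by linarith : 1 - η < 1)
    have h1 : (F 1 - ε / 2) * laplaceFunctional Λ (fun _ => 1) q ≤ laplaceFunctional Λ F q := by
      have h0 := laplaceFunctional_le (F := fun t => -F t) (c := -(F 1 - ε / 2))
        (by simpa using hF.neg) hΛ hq0 hq fun t ht => by
          have hd : dist t 1 < δ := by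
            rw [Real.dist_eq, abs_lt]
            constructor <;> linarith [ht.1, ht.2, min_le_left δ 1]
          have := abs_lt.mp (hδF hd)
          linarith
      rw [laplaceFunctional_neg] at h0
      linarith
    have h2 := (hlim q).div (tendsto_discreteFunctional_one hΛ q) hpos.ne'
    have h3 : F 1 - ε < laplaceFunctional Λ F q / laplaceFunctional Λ (fun _ => 1) q := by
      rw [lt_div_iff₀ hpos]
      nlinarith
    filter_upwards [h2.eventually (lt_mem_nhds h3), eventually_gt_atTop 0,
      (tendsto_discreteFunctional_one hΛ q).eventually (lt_mem_nhds hpos)] with n h4 hn h5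
    refine lt_of_lt_of_le h4 ?_
    rw [Pi.div_apply, div_le_iff₀ h5, ← hconst]
    exact discreteFunctional_mono hΛ hΦ hΦ' hq0 hq hn fun m hm => hmono n (hdiv hn hm.2)
  filter_upwards [upper, lower] with n h1 h2
  rw [Real.dist_eq, abs_lt]
  constructor <;> linarith

end Tauberian

/-! ### Laplace transforms of laws on the half-line -/

theorem ae_nonneg_of_measure_Iio_eq_zero {ρ : Measure ℝ} (h : ρ (Set.Iio 0) = 0) :
    ∀ᵐ t ∂ρ, 0 ≤ t := by
  rw [ae_iff]
  simpa [Set.Iio] using h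

theorem isBoundedFunctional_integral (ρ : Measure ℝ) [IsProbabilityMeasure ρ] :
    IsBoundedFunctional 1 fun q : C(unitInterval, ℝ) => ∫ t, q (expUnit t) ∂ρ := by
  have hint : ∀ q : C(unitInterval, ℝ), Integrable (fun t => q (expUnit t)) ρ := fun q =>
    Integrable.of_bound (q.continuous.comp continuous_expUnit).aestronglyMeasurable ‖q‖
      (ae_of_all _ fun t => q.norm_coe_le_norm _)
  refine ⟨fun p q => ?_, fun c q => ?_, fun q => ?_⟩
  · simp only [ContinuousMap.add_apply]
    exact integral_add (hint p) (hint q)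
  · simp only [ContinuousMap.smul_apply, smul_eq_mul]
    exact integral_const_mul _ _
  · rw [one_mul, ← Real.norm_eq_abs]
    simpa using norm_integral_le_of_norm_le_const (μ := ρ)
      (ae_of_all _ fun t => q.norm_coe_le_norm (expUnit t))

theorem tendsto_integral_expUnit_of_tendsto_laplace {ρ : ℕ → Measure ℝ}
    [∀ n, IsProbabilityMeasure (ρ n)] {ρ' : Measure ℝ} [IsProbabilityMeasure ρ']
    (h0 : ∀ n, ρ n (Set.Iio 0) = 0) (h0' : ρ' (Set.Iio 0) = 0)
    (h : ∀ s : ℝ, 0 < s → Tendsto (fun n => ∫ t, Real.exp (-(s * t)) ∂(ρ n)) atTop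
      (𝓝 (∫ t, Real.exp (-(s * t)) ∂ρ'))) (q : C(unitInterval, ℝ)) :
    Tendsto (fun n => ∫ t, q (expUnit t) ∂(ρ n)) atTop (𝓝 (∫ t, q (expUnit t) ∂ρ')) := by
  refine IsBoundedFunctional.tendsto (Eventually.of_forall fun n =>
    isBoundedFunctional_integral (ρ n)) (isBoundedFunctional_integral ρ') (fun k => ?_) q
  have hk : ∀ (κ : Measure ℝ), κ (Set.Iio 0) = 0 → ∫ t, ((Polynomial.X ^ k : ℝ[X]).toContinuousMapOn
      unitInterval) (expUnit t) ∂κ = ∫ t, Real.exp (-(k * t)) ∂κ := fun κ hκ => by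
    refine integral_congr_ae ?_
    filter_upwards [ae_nonneg_of_measure_Iio_eq_zero hκ] with t ht
    simp only [Polynomial.toContinuousMapOn_apply, Polynomial.toContinuousMap_apply,
      Polynomial.eval_pow, Polynomial.eval_X, coe_expUnit ht, ← Real.exp_nat_mul]
    ring_nf
  rw [hk ρ' h0']
  rcases Nat.eq_zero_or_pos k with rfl | hk0
  · refine tendsto_const_nhds.congr fun n => ?_
    rw [hk _ (h0 n)]
    simp
  · exact (h k (by exact_mod_cast hk0)).congr fun n => (hk _ (h0 n)).symm

/-- The function `v ↦ min 1 (M v) * f (-log v)` on the unit interval. -/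
noncomputable def truncatedLog (M : ℕ) (f : BoundedContinuousFunction ℝ ℝ) :
    C(unitInterval, ℝ) where
  toFun v := min 1 (M * (v : ℝ)) * f (-Real.log v)
  continuous_toFun := by
    rw [continuous_iff_continuousAt]
    intro v
    -- At v = 0 the convention for log 0 is harmless: the factor min(1, Mv) vanishes there and f is
    -- bounded.
    rcases eq_or_ne (v : ℝ) 0 with hv | hv
    · have h1 : Tendsto (fun w : unitInterval => M * (w : ℝ) * ‖f‖) (𝓝 v) (𝓝 0) := by
        have : Continuous fun w : unitInterval => M * (w : ℝ) * ‖f‖ := by fun_prop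
        simpa [hv] using this.tendsto v
      rw [ContinuousAt, hv, mul_zero, min_eq_right zero_le_one, zero_mul]
      refine squeeze_zero_norm (fun w => ?_) h1
      have hw : 0 ≤ (M : ℝ) * (w : ℝ) := mul_nonneg (Nat.cast_nonneg _) w.2.1
      rw [norm_mul, Real.norm_of_nonneg (le_min zero_le_one hw)]
      exact mul_le_mul (min_le_right _ _) (f.norm_coe_le_norm _) (norm_nonneg _) hw
    · refine ContinuousAt.mul (by fun_prop) ?_
      exact f.continuous.continuousAt.comp
        ((Real.continuousAt_log hv).comp continuous_subtype_val.continuousAt).neg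

theorem truncatedLog_expUnit (M : ℕ) (f : BoundedContinuousFunction ℝ ℝ) {t : ℝ} (ht : 0 ≤ t) :
    truncatedLog M f (expUnit t) = min 1 (M * Real.exp (-t)) * f t := by
  simp only [truncatedLog, ContinuousMap.coe_mk, coe_expUnit ht, Real.log_exp, neg_neg]

/-- The error of truncating any f is at most ‖f‖ times the error of truncating the constant 1. The
latter is itself an integral of a continuous function of e^{-t}, so it passes to the limit and plays
the role of tightness. -/
theorem abs_integral_sub_truncatedLog_le {κ : Measure ℝ} [IsProbabilityMeasure κ]
    (hκ : κ (Set.Iio 0) = 0) (M : ℕ) (f : BoundedContinuousFunction ℝ ℝ) :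
    |∫ t, f t ∂κ - ∫ t, truncatedLog M f (expUnit t) ∂κ| ≤
      ‖f‖ * (1 - ∫ t, truncatedLog M (BoundedContinuousFunction.const ℝ 1) (expUnit t) ∂κ) := by
  have hint : ∀ q : C(unitInterval, ℝ), Integrable (fun t => q (expUnit t)) κ := fun q =>
    Integrable.of_bound (q.continuous.comp continuous_expUnit).aestronglyMeasurable ‖q‖
      (ae_of_all _ fun t => q.norm_coe_le_norm _)
  have h1 : (1 : ℝ) - ∫ t, truncatedLog M (BoundedContinuousFunction.const ℝ 1) (expUnit t) ∂κ =
      ∫ t, (1 - truncatedLog M (BoundedContinuousFunction.const ℝ 1) (expUnit t)) ∂κ := by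
    rw [integral_sub (integrable_const _) (hint _)]
    simp
  rw [← integral_sub (f.integrable κ) (hint _), h1, ← integral_const_mul, ← Real.norm_eq_abs]
  refine norm_integral_le_of_norm_le (((integrable_const _).sub (hint _)).const_mul _) ?_
  filter_upwards [ae_nonneg_of_measure_Iio_eq_zero hκ] with t ht
  rw [truncatedLog_expUnit M f ht, truncatedLog_expUnit M _ ht,
    BoundedContinuousFunction.const_apply, mul_one, ← one_sub_mul, norm_mul, mul_comm,
    Real.norm_of_nonneg (sub_nonneg.mpr (min_le_left _ _))]
  exact mul_le_mul_of_nonneg_right (f.norm_coe_le_norm _) (sub_nonneg.mpr (min_le_left _ _))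

theorem tendsto_integral_truncatedLog_one {κ : Measure ℝ} [IsProbabilityMeasure κ]
    (hκ : κ (Set.Iio 0) = 0) :
    Tendsto (fun M : ℕ => ∫ t, truncatedLog M (BoundedContinuousFunction.const ℝ 1) (expUnit t) ∂κ)
      atTop (𝓝 1) := by
  suffices h : Tendsto (fun M : ℕ => ∫ t, truncatedLog M (BoundedContinuousFunction.const ℝ 1)
      (expUnit t) ∂κ) atTop (𝓝 (∫ _, (1 : ℝ) ∂κ)) by simpa using h
  refine tendsto_integral_of_dominated_convergence (fun _ => 1) (fun M =>
    ((ContinuousMap.continuous _).comp continuous_expUnit).aestronglyMeasurable)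
    (integrable_const _) (fun M => ?_) ?_
  · filter_upwards [ae_nonneg_of_measure_Iio_eq_zero hκ] with t ht
    rw [truncatedLog_expUnit M _ ht, BoundedContinuousFunction.const_apply, mul_one,
      Real.norm_of_nonneg (le_min zero_le_one (by positivity))]
    exact min_le_left _ _
  · filter_upwards [ae_nonneg_of_measure_Iio_eq_zero hκ] with t ht
    have h2 : ∀ᶠ M : ℕ in atTop, 1 ≤ (M : ℝ) * Real.exp (-t) :=
      (tendsto_natCast_atTop_atTop.atTop_mul_const (Real.exp_pos _)).eventually_ge_atTop 1
    refine tendsto_const_nhds.congr' ?_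
    filter_upwards [h2] with M hM
    rw [truncatedLog_expUnit M _ ht, BoundedContinuousFunction.const_apply, mul_one, min_eq_left hM]

/-- The continuity theorem for Laplace transforms of laws on the half-line. -/
theorem tendsto_of_tendsto_laplace {ρ : ℕ → ProbabilityMeasure ℝ} {ρ' : ProbabilityMeasure ℝ}
    (h0 : ∀ n, (ρ n : Measure ℝ) (Set.Iio 0) = 0) (h0' : (ρ' : Measure ℝ) (Set.Iio 0) = 0)
    (h : ∀ s : ℝ, 0 < s → Tendsto (fun n => ∫ t, Real.exp (-(s * t)) ∂(ρ n : Measure ℝ)) atTop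
      (𝓝 (∫ t, Real.exp (-(s * t)) ∂(ρ' : Measure ℝ)))) : Tendsto ρ atTop (𝓝 ρ') := by
  rw [ProbabilityMeasure.tendsto_iff_forall_integral_tendsto]
  intro f
  have hlim := tendsto_integral_expUnit_of_tendsto_laplace h0 h0' h
  rw [Metric.tendsto_nhds]
  intro ε hε
  have hf := norm_nonneg f
  have h1 := ((tendsto_integral_truncatedLog_one h0').const_sub 1).const_mul ‖f‖
  rw [sub_self, mul_zero] at h1
  obtain ⟨M, hM⟩ := (h1.eventually (gt_mem_nhds (by positivity : 0 < ε / 3))).exists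
  have h2 := ((hlim (truncatedLog M (BoundedContinuousFunction.const ℝ 1))).const_sub 1).const_mul
    ‖f‖
  filter_upwards [h2.eventually (gt_mem_nhds hM),
    (Metric.tendsto_nhds.mp (hlim (truncatedLog M f))) (ε / 3) (by positivity)] with n hn1 hn2
  have h3 := (abs_integral_sub_truncatedLog_le (h0 n) M f).trans_lt hn1
  have h4 := (abs_integral_sub_truncatedLog_le h0' M f).trans_lt hM
  rw [Real.dist_eq] at hn2 ⊢
  rw [abs_lt] at *
  constructor <;> linarith [h3.1, h3.2, h4.1, h4.2, hn2.1, hn2.2]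

theorem exp_neg_mul_neg_log {v s : ℝ} (hv : 0 < v) : Real.exp (-(s * -Real.log v)) = v ^ s := by
  rw [Real.rpow_def_of_pos hv]
  ring_nf

/-- A pointwise limit of Laplace transforms of laws on the half-line that tends to `1` at `0` is
the Laplace transform of a law. -/
theorem exists_laplace_eq_of_tendsto {ρ : ℕ → ProbabilityMeasure ℝ} {ℓ : ℝ → ℝ}
    (h0 : ∀ n, (ρ n : Measure ℝ) (Set.Iio 0) = 0)
    (h : ∀ s : ℝ, 0 < s → Tendsto (fun n => ∫ t, Real.exp (-(s * t)) ∂(ρ n : Measure ℝ)) atTop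
      (𝓝 (ℓ s))) (hℓ : Tendsto ℓ (𝓝[>] 0) (𝓝 1)) :
    ∃ ρ' : ProbabilityMeasure ℝ, (ρ' : Measure ℝ) (Set.Iio 0) = 0 ∧
      ∀ s : ℝ, 0 < s → ∫ t, Real.exp (-(s * t)) ∂(ρ' : Measure ℝ) = ℓ s := by
  -- Transport by t ↦ e^{-t} to the compact interval [0, 1], where the laws have a limit along any
  -- ultrafilter. Escape of mass to t = ∞ becomes a possible atom at 0.
  let κ : ℕ → ProbabilityMeasure unitInterval := fun n =>
    (ρ n).map continuous_expUnit.measurable.aemeasurable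
  let κ' : ProbabilityMeasure unitInterval := ((hyperfilter ℕ).map κ).lim
  have hκ : Tendsto κ (hyperfilter ℕ) (𝓝 κ') := ((hyperfilter ℕ).map κ).le_nhds_lim
  have hpow : ∀ s : ℝ, 0 < s → ∫ v : unitInterval, (v : ℝ) ^ s ∂(κ' : Measure unitInterval) = ℓ s :=
    fun s hs => by
      let g : BoundedContinuousFunction unitInterval ℝ := BoundedContinuousFunction.mkOfCompact
        ⟨fun v => (v : ℝ) ^ s, continuous_subtype_val.rpow_const fun _ => Or.inr hs.le⟩
      have h1 := ProbabilityMeasure.tendsto_iff_forall_integral_tendsto.mp hκ g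
      refine tendsto_nhds_unique h1
        (((h s hs).mono_left Nat.hyperfilter_le_atTop).congr fun n => ?_)
      rw [ProbabilityMeasure.toMeasure_map, integral_map continuous_expUnit.measurable.aemeasurable
        g.continuous.aestronglyMeasurable]
      refine integral_congr_ae ?_
      filter_upwards [ae_nonneg_of_measure_Iio_eq_zero (h0 n)] with t ht
      simp only [g, BoundedContinuousFunction.mkOfCompact_apply, ContinuousMap.coe_mk,
        coe_expUnit ht, ← Real.exp_mul]
      ring_nf
  -- As s decreases to 0, v^s tends to the indicator of v > 0. Hence ℓ(s) → 1 says exactly that the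
  -- limit law has no atom at 0.
  have hind : ∫ v : unitInterval, Set.indicator {v : unitInterval | 0 < (v : ℝ)} 1 v
      ∂(κ' : Measure unitInterval) = (1 : ℝ) := by
    refine tendsto_nhds_unique (f := fun s => ∫ v : unitInterval, (v : ℝ) ^ s
      ∂(κ' : Measure unitInterval)) (l := 𝓝[>] (0 : ℝ)) ?_ (hℓ.congr' ?_)
    · refine tendsto_integral_filter_of_dominated_convergence (fun _ => 1) ?_ ?_
        (integrable_const _) (ae_of_all _ fun v => ?_)
      · exact Eventually.of_forall fun s =>
          (measurable_subtype_coe.pow_const s).aestronglyMeasurable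
      · filter_upwards [self_mem_nhdsWithin] with s hs
        refine ae_of_all _ fun v => ?_
        rw [Real.norm_of_nonneg (Real.rpow_nonneg v.2.1 _)]
        exact Real.rpow_le_one v.2.1 v.2.2 (le_of_lt hs)
      · by_cases hv : 0 < (v : ℝ)
        · rw [Set.indicator_of_mem (by exact hv), Pi.one_apply, ← Real.rpow_zero (v : ℝ)]
          exact ((Real.continuous_const_rpow hv.ne').tendsto 0).mono_left nhdsWithin_le_nhds
        · rw [Set.indicator_of_notMem (by exact hv)]
          have hv0 : (v : ℝ) = 0 := le_antisymm (not_lt.mp hv) v.2.1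
          refine tendsto_const_nhds.congr' ?_
          filter_upwards [self_mem_nhdsWithin] with s hs
          rw [hv0, Real.zero_rpow (ne_of_gt hs)]
    · filter_upwards [self_mem_nhdsWithin] with s hs using (hpow s hs).symm
  have hmeas : MeasurableSet {v : unitInterval | 0 < (v : ℝ)} :=
    measurableSet_lt measurable_const measurable_subtype_coe
  have hpos : ∀ᵐ v : unitInterval ∂(κ' : Measure unitInterval), 0 < (v : ℝ) := by
    rw [integral_indicator_one hmeas] at hind
    refine (mem_ae_iff_prob_eq_one hmeas).mpr ?_
    rwa [Measure.real, ENNReal.toReal_eq_one_iff] at hind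
  have hlog : Measurable fun v : unitInterval => -Real.log (v : ℝ) :=
    (Real.measurable_log.comp measurable_subtype_coe).neg
  refine ⟨κ'.map hlog.aemeasurable, ?_, fun s hs => ?_⟩
  · rw [ProbabilityMeasure.toMeasure_map, Measure.map_apply hlog measurableSet_Iio]
    convert measure_empty (μ := (κ' : Measure unitInterval))
    ext v
    simp only [Set.mem_preimage, Set.mem_Iio, Set.mem_empty_iff_false, iff_false, not_lt]
    exact neg_nonneg.mpr (Real.log_nonpos v.2.1 v.2.2)
  · rw [ProbabilityMeasure.toMeasure_map, integral_map hlog.aemeasurable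
      (by fun_prop), ← hpow s hs]
    refine integral_congr_ae ?_
    filter_upwards [hpos] with v hv
    exact exp_neg_mul_neg_log hv

/-! ### The Mittag-Leffler function -/

/-- Keep only t ≥ M in the Gamma integral. With M free, this makes Γ(pa+1) grow faster than any
geometric sequence in p. -/
theorem rpow_mul_exp_neg_le_Gamma {M q : ℝ} (hM : 0 < M) (hq : 0 ≤ q) :
    M ^ q * Real.exp (-M) ≤ Real.Gamma (q + 1) := by
  have hint : IntegrableOn (fun t : ℝ => Real.exp (-t) * t ^ (q + 1 - 1)) (Set.Ioi 0) :=
    Real.GammaIntegral_convergent (by linarith)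
  rw [Real.Gamma_eq_integral (by linarith)]
  calc M ^ q * Real.exp (-M) = ∫ t in Set.Ioi M, M ^ q * Real.exp (-t) := by
        rw [integral_const_mul, integral_exp_neg_Ioi]
    _ ≤ ∫ t in Set.Ioi M, Real.exp (-t) * t ^ (q + 1 - 1) := by
        refine setIntegral_mono_on ((integrableOn_exp_neg_Ioi M).const_mul _)
          (hint.mono_set (Set.Ioi_subset_Ioi hM.le)) measurableSet_Ioi fun t ht => ?_
        rw [mul_comm, add_sub_cancel_right]
        exact mul_le_mul_of_nonneg_left (Real.rpow_le_rpow hM.le (le_of_lt ht) hq)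
          (Real.exp_pos _).le
    _ ≤ ∫ t in Set.Ioi (0 : ℝ), Real.exp (-t) * t ^ (q + 1 - 1) := by
        refine setIntegral_mono_set hint ?_ (Set.Ioi_subset_Ioi hM.le).eventuallyLE
        filter_upwards [ae_restrict_mem measurableSet_Ioi] with t ht
        exact mul_nonneg (Real.exp_pos _).le (Real.rpow_nonneg (le_of_lt ht) _)

theorem Gamma_nat_mul_add_one_pos {a : ℝ} (ha : 0 < a) (p : ℕ) : 0 < Real.Gamma (p * a + 1) :=
  Real.Gamma_pos_of_pos (by positivity)

theorem summable_pow_div_Gamma {a : ℝ} (ha : 0 < a) (x : ℝ) :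
    Summable fun p : ℕ => x ^ p / Real.Gamma (p * a + 1) := by
  have hR : 0 < 2 * (|x| + 1) := by positivity
  -- M is chosen so that M^a = 2(|x|+1), which makes the terms of the series at most e^M 2^{-p}.
  let M := (2 * (|x| + 1)) ^ a⁻¹
  have hM : 0 < M := Real.rpow_pos_of_pos hR _
  have hMa : M ^ a = 2 * (|x| + 1) := Real.rpow_inv_rpow hR.le ha.ne'
  have hgeom : Summable fun p : ℕ => Real.exp M * (1 / 2 : ℝ) ^ p :=
    (summable_geometric_of_lt_one (by norm_num) (by norm_num)).mul_left (Real.exp M)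
  refine Summable.of_norm_bounded hgeom fun p => ?_
  have h1 := rpow_mul_exp_neg_le_Gamma hM (by positivity : 0 ≤ (p : ℝ) * a)
  rw [mul_comm (p : ℝ), Real.rpow_mul hM.le, hMa, Real.rpow_natCast, Real.exp_neg,
    ← div_eq_mul_inv, div_le_iff₀ (Real.exp_pos _), mul_comm a] at h1
  have hG := Gamma_nat_mul_add_one_pos ha p
  rw [norm_div, Real.norm_of_nonneg hG.le, norm_pow, Real.norm_eq_abs, div_le_iff₀ hG]
  calc |x| ^ p ≤ (|x| + 1) ^ p := pow_le_pow_left₀ (abs_nonneg x) (by linarith) p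
    _ = (1 / 2) ^ p * (2 * (|x| + 1)) ^ p := by rw [← mul_pow]; congr 1; ring
    _ ≤ (1 / 2) ^ p * (Real.Gamma (p * a + 1) * Real.exp M) :=
      mul_le_mul_of_nonneg_left h1 (by positivity)
    _ = _ := by ring

/-- The Mittag-Leffler function `E_a(x) = ∑_p x^p / Γ(pa + 1)`. -/
noncomputable def mittagLeffler (a x : ℝ) : ℝ := ∑' p : ℕ, x ^ p / Real.Gamma (p * a + 1)

theorem hasSum_mittagLeffler {a : ℝ} (ha : 0 < a) (x : ℝ) :
    HasSum (fun p : ℕ => x ^ p / Real.Gamma (p * a + 1)) (mittagLeffler a x) :=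
  (summable_pow_div_Gamma ha x).hasSum

theorem mittagLeffler_zero {a : ℝ} : mittagLeffler a 0 = 1 := by
  rw [mittagLeffler, tsum_eq_single 0 fun p hp => by simp [hp]]
  simp

theorem continuous_mittagLeffler {a : ℝ} (ha : 0 < a) : Continuous (mittagLeffler a) := by
  rw [continuous_iff_continuousAt]
  intro x
  have h : ContinuousOn (mittagLeffler a) (Set.Ioo (-(|x| + 1)) (|x| + 1)) := by
    refine continuousOn_tsum (fun p => by fun_prop) (summable_pow_div_Gamma ha (|x| + 1))
      fun p y hy => ?_
    have hG := Gamma_nat_mul_add_one_pos ha p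
    rw [norm_div, Real.norm_of_nonneg hG.le, norm_pow, Real.norm_eq_abs]
    exact div_le_div_of_nonneg_right (pow_le_pow_left₀ (abs_nonneg y) (abs_lt.mpr hy).le p) hG.le
  refine h.continuousAt (isOpen_Ioo.mem_nhds ⟨?_, ?_⟩)
  · linarith [neg_abs_le x]
  · linarith [le_abs_self x]

/-- Integrated term by term, the Gamma factors cancel and a geometric series of ratio x L^(-a)
remains. The hypothesis |x| < L^a is its convergence condition. -/
theorem integral_exp_neg_mul_mittagLeffler {a x L : ℝ} (ha : 0 < a) (hL : 0 < L)
    (hx : |x| < L ^ a) :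
    ∫ t in Set.Ioi (0 : ℝ), Real.exp (-(L * t)) * mittagLeffler a (x * t ^ a) =
      L⁻¹ * (1 - x * L ^ (-a))⁻¹ := by
  have hLa : 0 < L ^ a := Real.rpow_pos_of_pos hL a
  let f : ℝ → ℕ → ℝ → ℝ := fun x p t =>
    x ^ p / Real.Gamma (p * a + 1) * (t ^ (p * a + 1 - 1) * Real.exp (-(L * t)))
  have hpos : ∀ p : ℕ, 0 < (p : ℝ) * a + 1 := fun p => by positivity
  have hf : ∀ x p, ∫ t in Set.Ioi (0 : ℝ), f x p t = L⁻¹ * (x * L ^ (-a)) ^ p := fun x p => by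
    have hG := Gamma_nat_mul_add_one_pos ha p
    simp only [f]
    rw [integral_const_mul, Real.integral_rpow_mul_exp_neg_mul_Ioi (hpos p) hL, one_div,
      Real.inv_rpow hL.le, Real.rpow_add_one hL.ne', mul_comm (p : ℝ) a, Real.rpow_mul hL.le,
      Real.rpow_natCast, mul_comm a, mul_pow, Real.rpow_neg hL.le, inv_pow]
    field_simp
  have hint : ∀ p, IntegrableOn (f x p) (Set.Ioi 0) := fun p => by
    refine Integrable.const_mul (Integrable.of_integral_ne_zero ?_) _
    rw [Real.integral_rpow_mul_exp_neg_mul_Ioi (hpos p) hL]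
    exact (mul_pos (Real.rpow_pos_of_pos (by positivity) _) (Gamma_nat_mul_add_one_pos ha p)).ne'
  have hnorm : ∀ p, ∫ t in Set.Ioi (0 : ℝ), ‖f x p t‖ = L⁻¹ * (|x| * L ^ (-a)) ^ p := fun p => by
    rw [← hf |x| p]
    refine setIntegral_congr_fun measurableSet_Ioi fun t ht => ?_
    have ht0 : (0 : ℝ) ≤ t ^ ((p : ℝ) * a + 1 - 1) := Real.rpow_nonneg (le_of_lt ht) _
    simp only [f, norm_mul, norm_div, norm_pow, Real.norm_of_nonneg ht0,
      Real.norm_of_nonneg (Gamma_nat_mul_add_one_pos ha p).le, Real.norm_of_nonneg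
      (Real.exp_pos _).le, Real.norm_eq_abs]
  have hlt : |x| * L ^ (-a) < 1 := by
    rwa [Real.rpow_neg hL.le, ← div_eq_mul_inv, div_lt_one hLa]
  have hsum : Summable fun p => ∫ t in Set.Ioi (0 : ℝ), ‖f x p t‖ := by
    simp only [hnorm]
    exact (summable_geometric_of_lt_one (by positivity) hlt).mul_left L⁻¹
  have h1 := hasSum_integral_of_summable_integral_norm hint hsum
  simp only [hf] at h1
  have habs : |x * L ^ (-a)| < 1 := by
    rwa [abs_mul, abs_of_nonneg (Real.rpow_nonneg hL.le _)]
  have h2 := (hasSum_geometric_of_abs_lt_one habs).mul_left L⁻¹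
  rw [← h1.unique h2]
  refine setIntegral_congr_fun measurableSet_Ioi fun t ht => ?_
  have ht0 : (0 : ℝ) ≤ t := le_of_lt ht
  simp only [f]
  rw [mittagLeffler, ← tsum_mul_left]
  refine tsum_congr fun p => ?_
  rw [add_sub_cancel_right, mul_pow, mul_comm (p : ℝ) a, Real.rpow_mul ht0, Real.rpow_natCast]
  ring

theorem integrableOn_exp_neg_mul_mittagLeffler {a x L : ℝ} (ha : 0 < a) (hL : 0 < L)
    (hx : |x| < L ^ a) :
    IntegrableOn (fun t => Real.exp (-(L * t)) * mittagLeffler a (x * t ^ a)) (Set.Ioi 0) := by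
  refine Integrable.of_integral_ne_zero ?_
  rw [integral_exp_neg_mul_mittagLeffler ha hL hx]
  have habs : |x * L ^ (-a)| < 1 := by
    rwa [abs_mul, abs_of_nonneg (Real.rpow_nonneg hL.le _), Real.rpow_neg hL.le, ← div_eq_mul_inv,
      div_lt_one (Real.rpow_pos_of_pos hL a)]
  have := (abs_lt.mp habs).2
  exact mul_ne_zero (inv_ne_zero hL.ne') (inv_ne_zero (by linarith))

theorem integral_exp_neg_mul_one_Ioi {L : ℝ} (hL : 0 < L) :
    ∫ t in Set.Ioi (0 : ℝ), Real.exp (-(L * t)) = L⁻¹ := by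
  have := integral_exp_mul_Ioi (neg_lt_zero.mpr hL) 0
  simp only [neg_mul] at this
  rw [this]
  simp [div_eq_mul_inv]

/-! ### Laplace transforms of the rescaled local times -/

theorem monotone_localTime {Ω : Type*} (S : ℕ → Ω → ℕ) (y : ℕ) (ω : Ω) :
    Monotone fun n => localTime S n y ω := fun _ _ hmn =>
  Finset.card_le_card (Finset.filter_subset_filter _
    (Finset.range_subset_range.mpr (Nat.add_le_add_right hmn 1)))

section LocalTime

variable {Ω : Type*} [MeasurableSpace Ω] {P : Measure Ω} [IsProbabilityMeasure P]
  {α : ℝ} {hα' : -1 < α} {μ : PMF ℕ} {x y : ℕ} {S : ℕ → Ω → ℕ}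

theorem IsMarkovChainFrom.integrable_pow_localTime
    (h : IsMarkovChainFrom (gegenbauerTransition α hα' μ) x S P) {z : ℝ} (hz : z ∈ Set.Icc 0 1)
    (m y : ℕ) : Integrable (fun ω => z ^ localTime S m y ω) P := by
  refine Integrable.of_bound ((measurable_from_nat (f := fun k => z ^ k)).comp
    (h.measurable_localTime m y)).aestronglyMeasurable 1 (ae_of_all _ fun ω => ?_)
  rw [Real.norm_of_nonneg (pow_nonneg hz.1 _)]
  exact pow_le_one₀ hz.1 hz.2

theorem IsMarkovChainFrom.integral_pow_localTime_mem_Icc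
    (h : IsMarkovChainFrom (gegenbauerTransition α hα' μ) x S P) {z : ℝ} (hz : z ∈ Set.Icc 0 1)
    (m y : ℕ) : 1 - ∫ ω, z ^ localTime S m y ω ∂P ∈ Set.Icc (0 : ℝ) 1 := by
  have h1 : 0 ≤ ∫ ω, z ^ localTime S m y ω ∂P := integral_nonneg fun ω => pow_nonneg hz.1 _
  have h2 : ∫ ω, z ^ localTime S m y ω ∂P ≤ ∫ _, (1 : ℝ) ∂P :=
    integral_mono (h.integrable_pow_localTime hz m y) (integrable_const _)
      fun ω => pow_le_one₀ hz.1 hz.2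
  rw [integral_const, probReal_univ, one_smul] at h2
  exact ⟨by linarith, by linarith⟩

theorem IsMarkovChainFrom.monotone_integral_pow_localTime
    (h : IsMarkovChainFrom (gegenbauerTransition α hα' μ) x S P) {z : ℝ} (hz : z ∈ Set.Icc 0 1)
    (y : ℕ) : Monotone fun m => 1 - ∫ ω, z ^ localTime S m y ω ∂P := fun m n hmn =>
  sub_le_sub_left (integral_mono (h.integrable_pow_localTime hz n y)
    (h.integrable_pow_localTime hz m y) fun ω =>
      pow_le_pow_of_le_one hz.1 hz.2 (monotone_localTime S y ω hmn)) 1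

/-- If the Green functions at `r = e^{-L/n}` are of order `g n`, then the Laplace transforms of the
local times divided by `g n` converge. -/
theorem IsMarkovChainFrom.tendsto_integral_exp_localTime
    (h : IsMarkovChainFrom (gegenbauerTransition α hα' μ) x S P) (hα : -1 / 2 ≤ α)
    {g : ℕ → ℝ} (hg0 : ∀ n, 0 ≤ g n) (hg : Tendsto g atTop atTop) {κ : ℝ → ℝ}
    (hκ0 : ∀ L, 0 < L → 0 ≤ κ L)
    (hκ : ∀ L, 0 < L → ∀ u, Tendsto (fun n : ℕ => spectralGreen α μ (Real.exp (-L / n)) u y / g n)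
      atTop (𝓝 (κ L)))
    {s : ℝ} (hs : 0 < s) {Λ : ℝ} (hΛ : 0 < Λ) {F : ℝ → ℝ}
    (hF : IntegrableOn (fun t => Real.exp (-(Λ * t)) * F t) (Set.Ioi 0)) (hc : ContinuousAt F 1)
    (hFκ : ∀ L, Λ ≤ L → ∫ t in Set.Ioi (0 : ℝ), Real.exp (-(L * t)) * F t =
      L⁻¹ * (s * κ L / (1 + s * κ L))) :
    Tendsto (fun n => ∫ ω, Real.exp (-(s / g n)) ^ localTime S n y ω ∂P) atTop (𝓝 (1 - F 1)) := by
  have hz : ∀ n, Real.exp (-(s / g n)) ∈ Set.Icc (0 : ℝ) 1 := fun n =>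
    ⟨(Real.exp_pos _).le, Real.exp_le_one_iff.mpr (neg_nonpos.mpr (div_nonneg hs.le (hg0 n)))⟩
  have hsg : Tendsto (fun n => s / g n) atTop (𝓝 0) := hg.const_div_atTop s
  have hz1 : Tendsto (fun n => Real.exp (-(s / g n))) atTop (𝓝 1) := by
    simpa [Function.comp_def] using (Real.continuous_exp.tendsto _).comp hsg.neg
  -- 1 - e^{-s v} has slope s at v = 0, evaluated along v = 1/g(n).
  have hgz : Tendsto (fun n => (1 - Real.exp (-(s / g n))) * g n) atTop (𝓝 s) := by
    have h1 : HasDerivAt (fun v : ℝ => Real.exp (-s * v)) (-s) 0 := by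
      simpa using ((hasDerivAt_id (0 : ℝ)).const_mul (-s)).exp
    have h2 := ((hasDerivAt_iff_tendsto_slope.mp h1).comp
      ((tendsto_inv_atTop_nhdsGT_zero.mono_right
        (nhdsWithin_mono _ fun _ h => ne_of_gt h)).comp hg)).neg
    rw [neg_neg] at h2
    refine h2.congr fun n => ?_
    simp only [Function.comp, slope_def_field, mul_zero, Real.exp_zero, sub_zero, div_inv_eq_mul,
      neg_mul, neg_zero, ← div_eq_mul_inv]
    ring
  have hzG : ∀ L, 0 < L → ∀ u, Tendsto (fun n : ℕ => (1 - Real.exp (-(s / g n))) *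
      spectralGreen α μ (Real.exp (-L / n)) u y) atTop (𝓝 (s * κ L)) := fun L hL u => by
    refine (hgz.mul (hκ L hL u)).congr' ?_
    filter_upwards [hg.eventually_gt_atTop 0] with n hn
    field_simp
  have hmain := tendsto_diagonal_of_tendsto_laplace (F := F) (Λ := Λ)
    (Φ := fun n m => 1 - ∫ ω, Real.exp (-(s / g n)) ^ localTime S m y ω ∂P)
    (fun n => h.monotone_integral_pow_localTime (hz n) y) hΛ
    (fun n m => h.integral_pow_localTime_mem_Icc (hz n) m y) hF hc fun k => ?_
  · simpa using hmain.const_sub 1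
  -- Only the points (k+1)Λ ≥ Λ are called for, so the transform of F need not be known for small L.
  · have hkΛ : Λ ≤ (k + 1) * Λ := le_mul_of_one_le_left hΛ.le (by linarith [k.cast_nonneg (α := ℝ)])
    have hk0 : 0 < (k + 1) * Λ := hΛ.trans_le hkΛ
    have hpos : 0 < 1 + s * κ ((k + 1) * Λ) := by
      have := mul_nonneg hs.le (hκ0 _ hk0)
      linarith
    rw [hFκ _ hkΛ]
    -- With r = e^{-L/n}, the prefactor 1/(n(1-r)) tends to 1/L. Since z → 1 and (1-z)G → sκ from
    -- either start, the remaining quotient tends to sκ/(1+sκ).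
    have hlim := ((tendsto_nat_mul_one_sub_exp ((k + 1) * Λ)).inv₀ hk0.ne').mul
      ((hzG _ hk0 x).div (hz1.add (hzG _ hk0 y)) hpos.ne')
    refine hlim.congr' ?_
    filter_upwards [eventually_gt_atTop 0] with n hn
    have hn0 : (0 : ℝ) < n := by exact_mod_cast hn
    have hr : Real.exp (-((k + 1) * Λ) / n) ∈ Set.Ico (0 : ℝ) 1 :=
      ⟨(Real.exp_pos _).le, Real.exp_lt_one_iff.mpr
        (div_neg_of_neg_of_pos (neg_lt_zero.mpr hk0) hn0)⟩
    rw [(h.hasSum_integral_pow_localTime hα ⟨Real.exp_pos _, (hz n).2⟩ hr y).tsum_eq, mul_inv]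
    simp only [Pi.div_apply, div_eq_mul_inv]
    ring

end LocalTime

theorem tendsto_one_sub_exp_nhdsGT {L : ℝ} (hL : 0 < L) :
    Tendsto (fun n : ℕ => 1 - Real.exp (-L / n)) atTop (𝓝[>] 0) := by
  refine tendsto_nhdsWithin_iff.mpr ⟨?_, ?_⟩
  · have h1 : Tendsto (fun n : ℕ => -L / (n : ℝ)) atTop (𝓝 0) :=
      tendsto_natCast_atTop_atTop.const_div_atTop (-L)
    simpa using ((Real.continuous_exp.tendsto _).comp h1).const_sub 1
  · filter_upwards [eventually_gt_atTop 0] with n hn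
    have hn0 : (0 : ℝ) < n := by exact_mod_cast hn
    exact sub_pos.mpr (Real.exp_lt_one_iff.mpr (div_neg_of_neg_of_pos (neg_lt_zero.mpr hL) hn0))

/-- Take ε = 1 - e^{-L/n}, for which nε → L. The exponent is kept as -(-α) so that -α can later be
replaced by a single letter a. -/
theorem tendsto_spectralGreen_div_rpow {α : ℝ} (hα : -1 / 2 ≤ α) (hα0 : α < 0) {μ : PMF ℕ}
    (hμ : IsAperiodic α μ) (hμ2 : Summable fun n : ℕ => (μ n).toReal * (n : ℝ) ^ 2) (x y : ℕ)
    {L : ℝ} (hL : 0 < L) :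
    Tendsto (fun n : ℕ => spectralGreen α μ (Real.exp (-L / n)) x y / (n : ℝ) ^ (-α)) atTop
      (𝓝 (gegenbauerWeight α y * Real.Gamma (α + 1) * Real.Gamma (-α) /
        (2 * walkConst α μ ^ (α + 1)) * L ^ (-(-α)))) := by
  have h1 := (tendsto_spectralGreen_of_neg hα hα0 hμ hμ2 x y).comp (tendsto_one_sub_exp_nhdsGT hL)
  have h2 := (tendsto_nat_mul_one_sub_exp L).rpow_const (p := -(-α)) (Or.inl hL.ne')
  refine (h1.mul h2).congr' ?_
  filter_upwards [eventually_gt_atTop 0,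
    (tendsto_one_sub_exp_nhdsGT hL).eventually self_mem_nhdsWithin] with n hn hε
  have hn0 : (0 : ℝ) < n := by exact_mod_cast hn
  have hε0 : 0 < 1 - Real.exp (-L / n) := hε
  simp only [Function.comp, sub_sub_cancel]
  rw [Real.mul_rpow hn0.le hε0.le, Real.rpow_neg hε0.le (-α), Real.rpow_neg hn0.le (-α)]
  have hne := (Real.rpow_pos_of_pos hε0 (-α)).ne'
  generalize (1 - Real.exp (-L / n)) ^ (-α) = e at hne ⊢
  field_simp

/-- Since n(1 - e^{-L/n}) → L, the logarithm of ε = 1 - e^{-L/n} is -log n up to a bounded term, so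
the limit does not depend on L. -/
theorem tendsto_spectralGreen_div_log {μ : PMF ℕ}
    (hμ : IsAperiodic 0 μ) (hμ2 : Summable fun n : ℕ => (μ n).toReal * (n : ℝ) ^ 2) (x y : ℕ)
    {L : ℝ} (hL : 0 < L) :
    Tendsto (fun n : ℕ => spectralGreen 0 μ (Real.exp (-L / n)) x y / Real.log n) atTop
      (𝓝 ((2 * y + 1) / (4 * walkConst 0 μ))) := by
  have h1 := (tendsto_spectralGreen_zero hμ hμ2 x y).comp (tendsto_one_sub_exp_nhdsGT hL)
  have hlog : Tendsto (fun n : ℕ => Real.log n) atTop atTop :=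
    Real.tendsto_log_atTop.comp tendsto_natCast_atTop_atTop
  have h2 := ((tendsto_nat_mul_one_sub_exp L).log hL.ne').div_atTop hlog
  have h3 := h1.mul (h2.const_sub 1)
  rw [sub_zero, mul_one] at h3
  refine h3.congr' ?_
  filter_upwards [eventually_gt_atTop 0, hlog.eventually_gt_atTop 0,
    (tendsto_one_sub_exp_nhdsGT hL).eventually (Ioo_mem_nhdsGT one_pos)] with n hn hl hε
  have hn0 : (n : ℝ) ≠ 0 := by exact_mod_cast hn.ne'
  have hε0 : 1 - Real.exp (-L / n) ≠ 0 := hε.1.ne'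
  have hne : Real.log (1 - Real.exp (-L / n)) ≠ 0 := (Real.log_neg hε.1 hε.2).ne
  simp only [Function.comp, sub_sub_cancel]
  rw [Real.log_mul hn0 hε0]
  generalize Real.log (1 - Real.exp (-L / n)) = e at hne ⊢
  field_simp
  ring

/-! ### The nearest-neighbour walk -/

/-- A Markov chain driven by a sequence of independent innovations of law `κ`. -/
theorem exists_isMarkovChainFrom_of_step {E : Type} [MeasurableSpace E] (κ : Measure E)
    [IsProbabilityMeasure κ] {step : ℕ → E → ℕ} (hstep : ∀ u, Measurable (step u))
    {p : ℕ → ℕ → ℝ} (hp : ∀ u v, κ.real {t | step u t = v} = p u v) (x : ℕ) :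
    ∃ (Ω : Type) (_ : MeasurableSpace Ω) (P : Measure Ω) (S : ℕ → Ω → ℕ),
      IsProbabilityMeasure P ∧ IsMarkovChainFrom p x S P := by
  obtain ⟨Ω, mΩ, P, U, hU, hlaw, hind, hP⟩ := exists_iid ℕ κ
  let S : ℕ → Ω → ℕ := fun n ω => Nat.rec x (fun k u => step u (U k ω)) n
  have hS : ∀ k ω, S (k + 1) ω = step (S k ω) (U k ω) := fun k ω => rfl
  have hstep' : Measurable fun q : ℕ × E => step q.1 q.2 :=
    measurable_from_prod_countable_right hstep
  have hmeas : ∀ n, Measurable (S n) := fun n => by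
    induction n with
    | zero => exact measurable_const
    | succ k ih => exact hstep'.comp (ih.prodMk (hU k))
  refine ⟨Ω, mΩ, P, S, hP, hmeas, fun n s => ?_⟩
  -- Following a prescribed path amounts to one condition on each innovation, so independence turns
  -- its probability into a product.
  have hset : {ω | ∀ k ≤ n, S k ω = s k} = if s 0 = x then
      ⋂ k ∈ Finset.range n, U k ⁻¹' {t | step (s k) t = s (k + 1)} else ∅ := by
    ext ω
    split_ifs with h0
    · simp only [Set.mem_ofPred_eq, Finset.mem_range, Set.mem_iInter, Set.mem_preimage]
      constructor
      · intro h k hk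
        rw [← h k hk.le, ← h (k + 1) hk, hS]
      · intro h k
        induction k with
        | zero => exact fun _ => h0.symm
        | succ k ih => intro hk; rw [hS, ih (by omega), h k (by omega)]
    · simp only [Set.mem_ofPred_eq, Set.mem_empty_iff_false, iff_false]
      exact fun h => h0 (h 0 (Nat.zero_le n)).symm
  rw [hset]
  split_ifs with h0
  · have hms : ∀ k, MeasurableSet {t | step (s k) t = s (k + 1)} := fun k =>
      hstep (s k) (measurableSet_singleton _)
    rw [Measure.real, hind.measure_inter_preimage_eq_mul _ (fun k _ => hms k), ENNReal.toReal_prod]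
    refine Finset.prod_congr rfl fun k _ => ?_
    rw [← hp, Measure.real, ← (hlaw k).map_eq, Measure.map_apply (hU k) (hms k)]
  · simp

/-! ### The transition kernel of the step law δ_1 -/

theorem gegenbauerConv_zero_one {α : ℝ} (hα : -1 < α) (v : ℕ) :
    gegenbauerConv α hα 0 1 v = if v = 1 then 1 else 0 := by
  have h : gegenbauer α 0 * gegenbauer α 1 = gegenbauerBasis α hα 1 := by
    rw [gegenbauerBasis_apply, gegenbauer.eq_1, one_mul]
  rw [gegenbauerConv, h, Module.Basis.repr_self, Finsupp.single_apply]
  simp only [eq_comm]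

theorem gegenbauerConv_succ_one {α : ℝ} (hα : -1 < α) (n v : ℕ) :
    gegenbauerConv α hα (n + 1) 1 v =
      (if v = n then (n + 1) / (2 * n + 2 * α + 3) else 0) +
        if v = n + 2 then (n + 2 * α + 2) / (2 * n + 2 * α + 3) else 0 := by
  have h : gegenbauer α (n + 1) * gegenbauer α 1 =
      ((n + 1) / (2 * n + 2 * α + 3) : ℝ) • gegenbauerBasis α hα n +
        ((n + 2 * α + 2) / (2 * n + 2 * α + 3) : ℝ) • gegenbauerBasis α hα (n + 2) := by
    rw [gegenbauerBasis_apply, gegenbauerBasis_apply, ← X_mul_gegenbauer_succ hα, mul_comm,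
      gegenbauer.eq_2]
  rw [gegenbauerConv, h, map_add, map_smul, map_smul, Module.Basis.repr_self,
    Module.Basis.repr_self, Finsupp.add_apply, Finsupp.smul_apply, Finsupp.smul_apply,
    Finsupp.single_apply, Finsupp.single_apply]
  simp only [smul_eq_mul, mul_ite, mul_one, mul_zero, eq_comm (b := v)]

theorem gegenbauerTransition_pure {α : ℝ} (hα : -1 < α) (n u v : ℕ) :
    gegenbauerTransition α hα (PMF.pure n) u v = gegenbauerConv α hα u n v := by
  rw [gegenbauerTransition, tsum_eq_single n fun m hm => by simp [PMF.pure_apply, hm]]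
  simp

theorem isAperiodic_pure_one (α : ℝ) : IsAperiodic α (PMF.pure 1) := by
  refine ⟨fun h => ?_, fun _ d hd h => ?_⟩
  · have := h (show 1 ∈ (PMF.pure 1).support by simp)
    simp at this
  · have := h (show 1 ∈ (PMF.pure 1).support by simp)
    simp only [Set.mem_ofPred_eq, Nat.dvd_one] at this
    omega

theorem summable_pure_mul (n : ℕ) (f : ℕ → ℝ) :
    Summable fun m : ℕ => ((PMF.pure n : PMF ℕ) m).toReal * f m :=
  summable_of_ne_finset_zero (s := {n}) fun m hm => by
    simp [PMF.pure_apply, Finset.notMem_singleton.mp hm]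

/-- The law of a nearest-neighbour step that moves up with probability `q`. -/
theorem volume_real_step (q : unitInterval) (u v : ℕ) :
    volume.real {t : unitInterval | (if t < q then u + 1 else u - 1) = v} =
      (if v = u - 1 then 1 - (q : ℝ) else 0) + if v = u + 1 then (q : ℝ) else 0 := by
  by_cases h1 : v = u + 1
  · have hset : {t : unitInterval | (if t < q then u + 1 else u - 1) = v} = Set.Iio q := by
      ext t
      simp only [Set.mem_ofPred_eq, Set.mem_Iio]
      split_ifs with h <;> simp only [h, iff_true, iff_false] <;> omega
    rw [hset, Measure.real, unitInterval.volume_Iio, ENNReal.toReal_ofReal q.2.1, if_pos h1,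
      if_neg (by omega), zero_add]
  · by_cases h2 : v = u - 1
    · have hset : {t : unitInterval | (if t < q then u + 1 else u - 1) = v} = Set.Ici q := by
        ext t
        simp only [Set.mem_ofPred_eq, Set.mem_Ici]
        rw [← not_lt]
        split_ifs with h <;> simp only [h, not_true, not_false_iff, iff_true, iff_false] <;> omega
      rw [hset, Measure.real, unitInterval.volume_Ici, ENNReal.toReal_ofReal
        (sub_nonneg.mpr q.2.2), if_pos h2, if_neg h1, add_zero]
    · have hset : {t : unitInterval | (if t < q then u + 1 else u - 1) = v} = ∅ := by
        ext t
        simp only [Set.mem_ofPred_eq, Set.mem_empty_iff_false, iff_false]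
        split_ifs <;> omega
      rw [hset, measureReal_empty, if_neg h2, if_neg h1, add_zero]

theorem exists_isMarkovChainFrom_pure_one {α : ℝ} (hα : -1 < α) (x : ℕ) :
    ∃ (Ω : Type) (_ : MeasurableSpace Ω) (P : Measure Ω) (S : ℕ → Ω → ℕ),
      IsProbabilityMeasure P ∧
        IsMarkovChainFrom (gegenbauerTransition α hα (PMF.pure 1)) x S P := by
  have hden : ∀ n : ℕ, 0 < 2 * (n : ℝ) + 2 * α + 3 := fun n => by
    linarith [n.cast_nonneg (α := ℝ)]
  -- The probability of moving up, read from the recurrence. At 0 it is 1, so the truncated downward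
  -- move 0 - 1 = 0 carries no mass.
  let q : ℕ → unitInterval := fun u => match u with
    | 0 => 1
    | n + 1 => ⟨(n + 2 * α + 2) / (2 * n + 2 * α + 3),
        div_nonneg (by linarith [n.cast_nonneg (α := ℝ)]) (hden n).le,
        (div_le_one (hden n)).mpr (by linarith [n.cast_nonneg (α := ℝ)])⟩
  refine exists_isMarkovChainFrom_of_step (volume : Measure unitInterval)
    (step := fun u t => if t < q u then u + 1 else u - 1)
    (fun u => Measurable.ite measurableSet_Iio measurable_const measurable_const) (fun u v => ?_) x
  rw [volume_real_step, gegenbauerTransition_pure]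
  cases u with
  | zero => simp [q, gegenbauerConv_zero_one]
  | succ n =>
    rw [gegenbauerConv_succ_one]
    have h1 : 1 - (q (n + 1) : ℝ) = (n + 1) / (2 * n + 2 * α + 3) := by
      change 1 - ((n : ℝ) + 2 * α + 2) / (2 * n + 2 * α + 3) = _
      rw [one_sub_div (hden n).ne']
      ring
    rw [h1, Nat.add_sub_cancel]

/-! ### The limit laws -/

section LimitLaws

variable {Ω : Type*} [MeasurableSpace Ω] {P : Measure Ω} [IsProbabilityMeasure P]
  {α : ℝ} {hα' : -1 < α} {μ : PMF ℕ} {x : ℕ} {S : ℕ → Ω → ℕ}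

theorem localTimeConst_pos (hα : -1 / 2 ≤ α) (hα0 : α < 0) (hμ : IsAperiodic α μ)
    (hμ2 : Summable fun n : ℕ => (μ n).toReal * (n : ℝ) ^ 2) (y : ℕ) :
    0 < gegenbauerWeight α y * Real.Gamma (α + 1) * Real.Gamma (-α) /
      (2 * walkConst α μ ^ (α + 1)) := by
  have h1 := gegenbauerWeight_pos hα y
  have h2 := Real.Gamma_pos_of_pos (by linarith : 0 < α + 1)
  have h3 := Real.Gamma_pos_of_pos (by linarith : 0 < -α)
  have h4 := Real.rpow_pos_of_pos (walkConst_pos hα hμ hμ2) (α + 1)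
  positivity

theorem IsMarkovChainFrom.tendsto_integral_exp_localTime_of_neg
    (h : IsMarkovChainFrom (gegenbauerTransition α hα' μ) x S P) (hα : -1 / 2 ≤ α) (hα0 : α < 0)
    (hμ : IsAperiodic α μ) (hμ2 : Summable fun n : ℕ => (μ n).toReal * (n : ℝ) ^ 2) (y : ℕ)
    {s : ℝ} (hs : 0 < s) :
    Tendsto (fun n : ℕ => ∫ ω, Real.exp (-(s * (localTime S n y ω / (n : ℝ) ^ (-α)))) ∂P) atTop
      (𝓝 (mittagLeffler (-α) (-(s * (gegenbauerWeight α y * Real.Gamma (α + 1) * Real.Gamma (-α) /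
        (2 * walkConst α μ ^ (α + 1))))))) := by
  have hc := localTimeConst_pos hα hα0 hμ hμ2 y
  have hG := fun (L : ℝ) (hL : 0 < L) u =>
    tendsto_spectralGreen_div_rpow hα hα0 hμ hμ2 u y hL
  generalize gegenbauerWeight α y * Real.Gamma (α + 1) * Real.Gamma (-α) /
    (2 * walkConst α μ ^ (α + 1)) = c at hc hG ⊢
  have ha : 0 < -α := by linarith
  generalize hadef : -α = a at ha hG ⊢
  have hsc : 0 < s * c := mul_pos hs hc
  -- Chosen so that Λ^a = sc + 1 > sc: the series formula for the Laplace transform of t ↦ E_a(-sc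
  -- t^a) then holds for every L ≥ Λ.
  let Λ := (s * c + 1) ^ a⁻¹
  have hΛ : 0 < Λ := Real.rpow_pos_of_pos (by linarith) _
  have hΛa : Λ ^ a = s * c + 1 := Real.rpow_inv_rpow (by linarith) ha.ne'
  have hlt : ∀ L, Λ ≤ L → |-(s * c)| < L ^ a := fun L hL => by
    rw [abs_neg, abs_of_pos hsc]
    have := Real.rpow_le_rpow hΛ.le hL ha.le
    linarith
  have hexp : ∀ L, 0 < L → IntegrableOn (fun t => Real.exp (-(L * t))) (Set.Ioi 0) := fun L hL => by
    simpa [neg_mul] using exp_neg_integrableOn_Ioi 0 hL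
  have key := h.tendsto_integral_exp_localTime hα (g := fun n : ℕ => (n : ℝ) ^ a)
    (fun n => by positivity) ((tendsto_rpow_atTop ha).comp tendsto_natCast_atTop_atTop)
    (κ := fun L => c * L ^ (-a)) (fun L hL => by positivity) hG hs hΛ
    (F := fun t => 1 - mittagLeffler a (-(s * c) * t ^ a)) ?_ ?_ ?_
  · rw [Real.one_rpow, mul_one, sub_sub_cancel] at key
    refine key.congr fun n => integral_congr_ae (ae_of_all _ fun ω => ?_)
    simp only [← Real.exp_nat_mul]
    congr 1
    ring
  · simp only [mul_sub, mul_one]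
    exact (hexp Λ hΛ).sub (integrableOn_exp_neg_mul_mittagLeffler ha hΛ (hlt Λ le_rfl))
  · refine continuousAt_const.sub ((continuous_mittagLeffler ha).continuousAt.comp ?_)
    exact continuousAt_const.mul (Real.continuousAt_rpow_const _ _ (Or.inr ha.le))
  · intro L hL
    have hL0 : 0 < L := hΛ.trans_le hL
    simp only [mul_sub, mul_one]
    rw [integral_sub (hexp L hL0) (integrableOn_exp_neg_mul_mittagLeffler ha hL0 (hlt L hL)),
      integral_exp_neg_mul_mittagLeffler ha hL0 (hlt L hL), integral_exp_neg_mul_one_Ioi hL0]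
    have hpos : 0 < 1 + s * c * L ^ (-a) := by positivity
    rw [neg_mul, sub_neg_eq_add, ← mul_assoc s]
    generalize s * c * L ^ (-a) = D at hpos ⊢
    have hne := hpos.ne'
    field_simp
    ring

/-- As the Green asymptotics do not depend on L, the function to recover is the constant sc/(1+sc).
Its complement 1/(1+sc) is the Laplace transform of c times an exponential variable. -/
theorem IsMarkovChainFrom.tendsto_integral_exp_localTime_zero {hα' : (-1 : ℝ) < 0}
    (h : IsMarkovChainFrom (gegenbauerTransition 0 hα' μ) x S P)
    (hμ : IsAperiodic 0 μ) (hμ2 : Summable fun n : ℕ => (μ n).toReal * (n : ℝ) ^ 2) (y : ℕ)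
    {s : ℝ} (hs : 0 < s) :
    Tendsto (fun n : ℕ => ∫ ω, Real.exp (-(s * (localTime S n y ω / Real.log n))) ∂P) atTop
      (𝓝 (1 + s * ((2 * y + 1) / (4 * walkConst 0 μ)))⁻¹) := by
  have hC := walkConst_pos (by norm_num) hμ hμ2
  have hc : 0 < (2 * (y : ℝ) + 1) / (4 * walkConst 0 μ) := by positivity
  have hG := fun (L : ℝ) (hL : 0 < L) u => tendsto_spectralGreen_div_log hμ hμ2 u y hL
  generalize (2 * (y : ℝ) + 1) / (4 * walkConst 0 μ) = c at hc hG ⊢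
  have hexp : ∀ L : ℝ, 0 < L → IntegrableOn (fun t => Real.exp (-(L * t))) (Set.Ioi 0) :=
    fun L hL => by simpa [neg_mul] using exp_neg_integrableOn_Ioi 0 hL
  have key := h.tendsto_integral_exp_localTime (by norm_num) (g := fun n : ℕ => Real.log n)
    (fun n => Real.log_natCast_nonneg n)
    (Real.tendsto_log_atTop.comp tendsto_natCast_atTop_atTop)
    (κ := fun _ => c) (fun _ _ => hc.le) hG hs one_pos
    (F := fun _ => s * c / (1 + s * c)) ((hexp 1 one_pos).mul_const _) continuousAt_const
    fun L hL => by
      rw [integral_mul_const, integral_exp_neg_mul_one_Ioi (one_pos.trans_le hL)]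
  have hne : 1 + s * c ≠ 0 := by positivity
  have hlim : 1 - s * c / (1 + s * c) = (1 + s * c)⁻¹ := by field_simp; ring
  rw [hlim] at key
  refine key.congr fun n => integral_congr_ae (ae_of_all _ fun ω => ?_)
  simp only [← Real.exp_nat_mul]
  congr 1
  ring

/-- Convergence in distribution of nonnegative random variables from convergence of the Laplace
transforms. -/
theorem tendstoInDistribution_of_tendsto_laplace {Ω' : Type*} [MeasurableSpace Ω']
    {P' : Measure Ω'} [IsProbabilityMeasure P'] {Y : ℕ → Ω → ℝ} {Z : Ω' → ℝ}
    (hY : ∀ n, Measurable (Y n)) (hZ : Measurable Z) (hY0 : ∀ n ω, 0 ≤ Y n ω)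
    (hZ0 : ∀ᵐ ω ∂P', 0 ≤ Z ω)
    (h : ∀ s : ℝ, 0 < s → Tendsto (fun n => ∫ ω, Real.exp (-(s * Y n ω)) ∂P) atTop
      (𝓝 (∫ ω, Real.exp (-(s * Z ω)) ∂P'))) :
    TendstoInDistribution Y atTop Z (fun _ => P) P' where
  forall_aemeasurable n := (hY n).aemeasurable
  aemeasurable_limit := hZ.aemeasurable
  tendsto := by
    refine tendsto_of_tendsto_laplace (fun n => ?_) ?_ fun s hs => ?_
    · rw [ProbabilityMeasure.coe_mk, Measure.map_apply (hY n) measurableSet_Iio]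
      convert measure_empty (μ := P)
      ext ω
      simpa using hY0 n ω
    · rw [ProbabilityMeasure.coe_mk, Measure.map_apply hZ measurableSet_Iio]
      rw [ae_iff] at hZ0
      simpa [Set.preimage, Set.Iio] using hZ0
    · simp only [ProbabilityMeasure.coe_mk]
      rw [integral_map hZ.aemeasurable (by fun_prop)]
      refine (h s hs).congr fun n => ?_
      rw [integral_map (hY n).aemeasurable (by fun_prop)]

end LimitLaws

/-- The law arises as a limit: the local time at 0 of the nearest-neighbour walk from 0, divided by
n^{-α} and by its constant c, has Laplace transforms tending to E_{-α}(-s), which is continuous with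
value 1 at s = 0. -/
theorem exists_isMittagLeffler {α : ℝ} (hα : -1 / 2 ≤ α) (hα0 : α < 0) :
    ∃ ν : ProbabilityMeasure ℝ, IsMittagLeffler (-α) (ν : Measure ℝ) := by
  obtain ⟨Ω, mΩ, P, S, hP, h⟩ :=
    exists_isMarkovChainFrom_pure_one (by linarith : -1 < α) 0
  have hμ := isAperiodic_pure_one α
  have hμ2 := summable_pure_mul 1 fun n => (n : ℝ) ^ 2
  have hc := localTimeConst_pos hα hα0 hμ hμ2 0
  have hlim := fun (s : ℝ) (hs : 0 < s) =>
    h.tendsto_integral_exp_localTime_of_neg hα hα0 hμ hμ2 0 hs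
  generalize gegenbauerWeight α 0 * Real.Gamma (α + 1) * Real.Gamma (-α) /
    (2 * walkConst α (PMF.pure 1) ^ (α + 1)) = c at hc hlim
  have ha : 0 < -α := by linarith
  have hmeas : ∀ n : ℕ, Measurable fun ω => (localTime S n 0 ω : ℝ) / (n : ℝ) ^ (-α) / c := fun n =>
    ((measurable_from_nat.comp (h.measurable_localTime n 0)).div_const _).div_const _
  let ρ : ℕ → ProbabilityMeasure ℝ := fun n =>
    ⟨P.map fun ω => (localTime S n 0 ω : ℝ) / (n : ℝ) ^ (-α) / c,
      Measure.isProbabilityMeasure_map (hmeas n).aemeasurable⟩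
  have hρ0 : ∀ n, (ρ n : Measure ℝ) (Set.Iio 0) = 0 := fun n => by
    rw [ProbabilityMeasure.coe_mk, Measure.map_apply (hmeas n) measurableSet_Iio]
    convert measure_empty (μ := P)
    ext ω
    simp only [Set.mem_preimage, Set.mem_Iio, Set.mem_empty_iff_false, iff_false, not_lt]
    positivity
  have hρ : ∀ s : ℝ, 0 < s → Tendsto (fun n => ∫ t, Real.exp (-(s * t)) ∂(ρ n : Measure ℝ)) atTop
      (𝓝 (mittagLeffler (-α) (-s))) := fun s hs => by
    have h1 := hlim _ (div_pos hs hc)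
    rw [div_mul_cancel₀ _ hc.ne'] at h1
    refine h1.congr fun n => ?_
    rw [ProbabilityMeasure.coe_mk, integral_map (hmeas n).aemeasurable (by fun_prop)]
    refine integral_congr_ae (ae_of_all _ fun ω => ?_)
    simp only
    congr 1
    ring
  have hcont : Tendsto (fun s => mittagLeffler (-α) (-s)) (𝓝[>] 0) (𝓝 1) := by
    have h1 := ((continuous_mittagLeffler ha).comp continuous_neg).tendsto 0
    simp only [Function.comp_def, neg_zero, mittagLeffler_zero] at h1
    exact h1.mono_left nhdsWithin_le_nhds
  obtain ⟨ν, hν0, hν⟩ := exists_laplace_eq_of_tendsto hρ0 hρ hcont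
  refine ⟨ν, hν0, fun s hs => ?_⟩
  have h1 := hasSum_mittagLeffler ha (-s)
  rcases hs.eq_or_lt with rfl | hs
  · rw [neg_zero, mittagLeffler_zero] at h1
    simpa using h1
  · rw [← hν s hs] at h1
    simpa only [neg_mul] using h1

/-! ### Laplace transforms of the two limit laws -/

theorem IsMittagLeffler.integral_exp {a : ℝ} {ν : Measure ℝ} (hν : IsMittagLeffler a ν) {s : ℝ}
    (hs : 0 ≤ s) : ∫ t, Real.exp (-(s * t)) ∂ν = mittagLeffler a (-s) := by
  rw [mittagLeffler, (hν.laplace s hs).tsum_eq]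
  simp only [neg_mul]

theorem ae_nonneg_expMeasure (r : ℝ) : ∀ᵐ t ∂(expMeasure r), 0 ≤ t := by
  refine ae_nonneg_of_measure_Iio_eq_zero ?_
  rw [expMeasure, gammaMeasure, withDensity_apply _ measurableSet_Iio]
  exact lintegral_gammaPDF_of_nonpos le_rfl

theorem integral_exp_neg_mul_expMeasure_one {s : ℝ} (hs : 0 < s) :
    ∫ t, Real.exp (-(s * t)) ∂(expMeasure 1) = (1 + s)⁻¹ := by
  have hpdf : ∀ t, (exponentialPDF 1 t).toReal * Real.exp (-(s * t)) =
      (Set.Ici 0).indicator (fun t => Real.exp (-((1 + s) * t))) t := fun t => by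
    rw [exponentialPDF_eq]
    by_cases ht : 0 ≤ t
    · rw [if_pos ht, Set.indicator_of_mem (by exact ht), ENNReal.toReal_ofReal (by positivity),
        one_mul, ← Real.exp_add]
      congr 1
      ring
    · rw [if_neg ht, Set.indicator_of_notMem (by exact ht)]
      simp
  have hmeas : Measurable (gammaPDF 1 1) := (measurable_gammaPDFReal 1 1).ennreal_ofReal
  rw [expMeasure, gammaMeasure, integral_withDensity_eq_integral_toReal_smul hmeas
    (ae_of_all _ fun t => ENNReal.ofReal_lt_top), ← integral_exp_neg_mul_one_Ioi (by positivity),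
    ← integral_Ici_eq_integral_Ioi, ← integral_indicator measurableSet_Ici]
  exact integral_congr_ae (ae_of_all _ hpdf)

/-- The law ν is chosen ahead of x, y and the chain, so one law serves them all. In both cases the
limit variable is a constant multiple of the identity under the reference law, and its Laplace
transform at s is that of the reference law at s times the constant. -/
theorem theorem5p1 (α : ℝ) (hα : -1 / 2 ≤ α) (hα0 : α ≤ 0)
    (μ : PMF ℕ) (hμ : IsAperiodic α μ)
    (hμ2 : Summable fun n : ℕ => (μ n).toReal * (n : ℝ) ^ 2) :
    (α < 0 → ∃ ν : ProbabilityMeasure ℝ, IsMittagLeffler |α| (ν : Measure ℝ) ∧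
      ∀ (x y : ℕ) {Ω : Type*} [MeasurableSpace Ω] (P : Measure Ω) [IsProbabilityMeasure P]
        (S : ℕ → Ω → ℕ),
        IsMarkovChainFrom (gegenbauerTransition α (by linarith) μ) x S P →
        TendstoInDistribution
          (fun (n : ℕ) ω => (localTime S n y ω : ℝ) / (n : ℝ) ^ |α|) atTop
          (fun m : ℝ => gegenbauerWeight α y * Real.Gamma (α + 1) * Real.Gamma |α| /
            (2 * walkConst α μ ^ (α + 1)) * m)
          (fun _ => P) (ν : Measure ℝ)) ∧
    (α = 0 → ∀ (x y : ℕ) {Ω : Type*} [MeasurableSpace Ω] (P : Measure Ω)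
        [IsProbabilityMeasure P] (S : ℕ → Ω → ℕ),
        IsMarkovChainFrom (gegenbauerTransition α (by linarith) μ) x S P →
        TendstoInDistribution
          (fun (n : ℕ) ω => (localTime S n y ω : ℝ) / Real.log n) atTop
          (fun e : ℝ => (2 * y + 1) / (4 * walkConst α μ) * e)
          (fun _ => P) (expMeasure 1)) := by
  refine ⟨fun hneg => ?_, ?_⟩
  · rw [abs_of_neg hneg]
    obtain ⟨ν, hν⟩ := exists_isMittagLeffler hα hneg
    refine ⟨ν, hν, fun x y Ω _ P _ S h => ?_⟩
    have hc := localTimeConst_pos hα hneg hμ hμ2 y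
    refine tendstoInDistribution_of_tendsto_laplace (fun n =>
      (measurable_from_nat.comp (h.measurable_localTime n y)).div_const _)
      (measurable_id.const_mul _) (fun n ω => by positivity) ?_ fun s hs => ?_
    · filter_upwards [ae_nonneg_of_measure_Iio_eq_zero hν.nonneg] with t ht
        using mul_nonneg hc.le ht
    · have h1 := h.tendsto_integral_exp_localTime_of_neg hα hneg hμ hμ2 y hs
      rw [← hν.integral_exp (mul_pos hs hc).le] at h1
      simpa only [mul_assoc] using h1
  · rintro rfl x y Ω _ P _ S h
    have hC := walkConst_pos (by norm_num) hμ hμ2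
    have hc : 0 < (2 * (y : ℝ) + 1) / (4 * walkConst 0 μ) := by positivity
    refine tendstoInDistribution_of_tendsto_laplace (fun n =>
      (measurable_from_nat.comp (h.measurable_localTime n y)).div_const _)
      (measurable_id.const_mul _) (fun n ω =>
        div_nonneg (Nat.cast_nonneg _) (Real.log_natCast_nonneg n)) ?_ fun s hs => ?_
    · filter_upwards [ae_nonneg_expMeasure 1] with t ht using mul_nonneg hc.le ht
    · have h1 := h.tendsto_integral_exp_localTime_zero hμ hμ2 y hs
      rw [← integral_exp_neg_mul_expMeasure_one (mul_pos hs hc)] at h1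
      simpa only [mul_assoc] using h1
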